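/- Let $n \geq 2$ be an integer, let $(a,b) \subseteq \mathbb{R}$ be an open interval (bounded or unbounded), and let $f : (a,b) \to \mathbb{R}$ be a function. Notation. $f$ is called $n$-convex if $f(tA + (1-t)B) \leq t f(A) + (1-t) f(B)$ in the Loewner order for all $t \in [0,1]$ and all $n \times n$ complex Hermitian matrices $A, B$ with $aI < A, B < bI$, i.e. with all eigenvalues in $(a,b)$. The divided difference $[x_0, \ldots, x_k]_g$ is symmetric in its nodes and is given by $[x_0, \ldots, x_k]_g = \frac{[x_0, \ldots, x_{k-1}]_g - [x_1, \ldots, x_k]_g}{x_0 - x_k}$ if $x_0 \neq x_k$, with $[x]_g = g(x)$, and $[x, \ldots, x]_g = g^{(k)}(x)/k!$ if all $k+1$ nodes equal $x$. $\mathbb{R}_{n-1}[x]$ and $\mathbb{C}_{n-1}[x]$ denote the real and complex polynomials of degree at most $n-1$. For a complex polynomial $q$ put $N(q) = q q^*$, where $q^*$ is obtained from $q$ by conjugating the coefficients; thus $N(q)(t) = |q(t)|^2$ for real $t$. "Positive" for matrices means positive semidefinite, and "almost everywhere" refers to Lebesgue measure on $(a,b)$. A derivative $g^{(k+1)}$ that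 need not exist everywhere is understood as the derivative of the function $g^{(k)}$ on the set of points where $g^{(k)}$ exists: $g^{(k+1)}(t)$ is the finite limit of the difference quotients of $g^{(k)}$ at $t$ taken within that set, if $t$ is an accumulation point of it, belongs to it, and the limit exists. Theorem. The following are equivalent. 1. $f$ is $n$-convex. 2. For any $a < x_0 < x_1 < \cdots < x_{2n} < b$ and $q \in \mathbb{R}_{n-1}[x]$, $[x_0, x_1, \ldots, x_{2n}]_{f q^2} \geq 0$. 3. For any $a < x_0 < x_1 < \cdots < x_{2n} < b$ and $q \in \mathbb{C}_{n-1}[x]$, $[x_0, x_1, \ldots, x_{2n}]_{f N(q)} \geq 0$. 4. $f \in C^2(a,b)$ and for any $a < x_1 < \cdots < x_n < b$, $1 \leq l \leq n$ and $q \in \mathbb{C}_{n-1}[x]$, $[x_1, x_1, x_2, x_2, \ldots, x_n, x_n, x_l]_{f N(q)} \geq 0$. 5. $f \in C^2(a,b)$ and for any $a < x_1 < \cdots < x_n < b$, $x_0 \in (a,b)$ and $q \in \mathbb{C}_{n-1}[x]$, $[x_1, x_1, x_2, x_2, \ldots, x_n, x_n, x_0]_{f N(q)} \geq 0$. 6.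 $f \in C^2(a,b)$ and for any $a < x_1 < \cdots < x_n < b$ and $1 \leq l \leq n$ the matrix $([x_i, x_j, x_l]_f)_{1 \leq i,j \leq n}$ is positive. 7. $f \in C^2(a,b)$ and for any $a < x_1 < \cdots < x_n < b$ and $x_0 \in (a,b)$ the matrix $([x_i, x_j, x_0]_f)_{1 \leq i,j \leq n}$ is positive. 8. $f \in C^{2n-2}(a,b)$, $f^{(2n-2)}$ is convex and, for every $q \in \mathbb{C}_{n-1}[x]$, $(f N(q))^{(2n)}$ exists and is non-negative almost everywhere. 9. $f \in C^{2n-2}(a,b)$, $f^{(2n-2)}$ is convex and the matrix $\left(\frac{f^{(i+j)}(t)}{(i+j)!}\right)_{1 \leq i,j \leq n}$ exists and is positive for almost every $t \in (a,b)$. -/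

import Mathlib

open Set Filter Topology MeasureTheory Polynomial

open scoped ComplexOrder

noncomputable section

/-- The open interval `(a, b)` of real numbers, where `-∞ ≤ a` and `b ≤ ∞`. -/
def openInterval (a b : EReal) : Set ℝ :=
  {x : ℝ | a < (x : EReal) ∧ (x : EReal) < b}

/-- `f : (a, b) → ℝ` is `n`-convex, with `I = (a, b)`: for all `n × n` Hermitian matrices `A`, `B`
with `a I < A, B < b I` (that is, with all eigenvalues in `(a, b)`) and `t ∈ [0, 1]`,
`f(t A + (1 - t) B) ≤ t f(A) + (1 - t) f(B)` in the Loewner order. Here `cfc f A` is the usual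
`f(A)`; it involves only the values of `f` on the spectrum of `A`. -/
def MatrixConvexOn (n : ℕ) (I : Set ℝ) (f : ℝ → ℝ) : Prop :=
  ∀ A B : Matrix (Fin n) (Fin n) ℂ, A.IsHermitian → B.IsHermitian →
    spectrum ℝ A ⊆ I → spectrum ℝ B ⊆ I → ∀ t : ℝ, t ∈ Icc (0 : ℝ) 1 →
      (t • cfc f A + (1 - t) • cfc f B - cfc f (t • A + (1 - t) • B)).PosSemidef

/-- Divided difference `[x 0, …, x k]_f` of order `k` of an increasingly ordered tuple
`x 0 ≤ x 1 ≤ … ≤ x k`: equal nodes give `f⁽ᵏ⁾(x 0) / k!`, otherwise the usual recursion is used.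
(The condition `x 0 = x k` says that all the nodes are equal, as the tuple is ordered.) -/
def divDiffSorted (f : ℝ → ℝ) : (k : ℕ) → (Fin (k + 1) → ℝ) → ℝ
  | 0, x => f (x 0)
  | k + 1, x =>
    if x 0 = x (Fin.last (k + 1)) then
      iteratedDeriv (k + 1) f (x 0) / ((k + 1).factorial : ℝ)
    else
      (divDiffSorted f k (fun i => x i.castSucc) - divDiffSorted f k (fun i => x i.succ)) /
        (x 0 - x (Fin.last (k + 1)))

/-- Divided difference `[x 0, …, x k]_f` of order `k`, for not necessarily distinct nodes in any
order (it is symmetric in the nodes, so they may be sorted first). For pairwise distinct nodes it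
is the usual one; in general it is meaningful as soon as `f` is `C^(m-1)` near each node that
occurs `m` times. -/
def divDiff (f : ℝ → ℝ) {k : ℕ} (x : Fin (k + 1) → ℝ) : ℝ :=
  divDiffSorted f k (x ∘ Tuple.sort x)

/-- The tuple `(x 0, x 0, x 1, x 1, …, x (n-1), x (n-1), y)`. -/
def doubledNodes {n : ℕ} (x : Fin n → ℝ) (y : ℝ) : Fin (2 * n + 1) → ℝ :=
  fun k => if h : (k : ℕ) < 2 * n then x ⟨(k : ℕ) / 2, by omega⟩ else y

/-- `N(q) = q q^*`, where `q^*` is the polynomial with conjugated coefficients. -/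
def normPoly (q : ℂ[X]) : ℂ[X] := q * q.map (starRingEnd ℂ)

/-- On the real line `N(q)` has the real values `|q(t)|²`. -/
theorem normPoly_eval_ofReal (q : ℂ[X]) (t : ℝ) :
    (normPoly q).eval (t : ℂ) = ((‖q.eval (t : ℂ)‖ ^ 2 : ℝ) : ℂ) := by
  have h : (q.map (starRingEnd ℂ)).eval (t : ℂ) = starRingEnd ℂ (q.eval (t : ℂ)) := by
    rw [Polynomial.eval_map, ← Polynomial.eval₂_hom, Complex.conj_ofReal]
  rw [normPoly, Polynomial.eval_mul, h, Complex.mul_conj, Complex.normSq_eq_norm_sq]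

/-- The real function `f N(q)`. -/
def mulNorm (f : ℝ → ℝ) (q : ℂ[X]) : ℝ → ℝ :=
  fun t => f t * ((normPoly q).eval (t : ℂ)).re

/-- Iterated derivatives of `g : U → ℝ` as partially defined functions: the `k`-th entry is the
domain of `g⁽ᵏ⁾` together with `g⁽ᵏ⁾` itself (only its values on the domain matter). The domain of
`g⁽ᵏ⁺¹⁾` consists of the points `t` in the domain `D` of `g⁽ᵏ⁾` at which the difference quotients
`(g⁽ᵏ⁾(s) - g⁽ᵏ⁾(t)) / (s - t)` have a finite limit as `s → t`, `s ∈ D`. -/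
def partialDeriv (U : Set ℝ) (g : ℝ → ℝ) : ℕ → Set ℝ × (ℝ → ℝ)
  | 0 => (U, g)
  | k + 1 =>
    ({t | t ∈ (partialDeriv U g k).1 ∧ AccPt t (𝓟 (partialDeriv U g k).1) ∧
        DifferentiableWithinAt ℝ (partialDeriv U g k).2 (partialDeriv U g k).1 t},
      derivWithin (partialDeriv U g k).2 (partialDeriv U g k).1)

/-- The set of points at which `g⁽ᵏ⁾` exists, for `g : U → ℝ`. -/
def derivDomain (U : Set ℝ) (g : ℝ → ℝ) (k : ℕ) : Set ℝ := (partialDeriv U g k).1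

/-- The value `g⁽ᵏ⁾(t)`, for `g : U → ℝ` and `t ∈ derivDomain U g k`. -/
def nthDerivOn (U : Set ℝ) (g : ℝ → ℝ) (k : ℕ) (t : ℝ) : ℝ := (partialDeriv U g k).2 t

end

/-! Condition 2, in the form `DivDiffSqNonneg`, is the pivot. Splitting a complex `q` into real and
imaginary parts turns `N(q)` into a sum of two real squares, which gives condition 3.

The link with Kraus matrices is algebraic. A factor `t - a` deletes the node `a` from a divided
difference. Expanding `q` in the Lagrange bases of two tuples `x` and `x'` therefore turns the
difference of `f q²` at the nodes `x, x', y` into `∑ c i * c' j * [x i, x' j, y]_f`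
(`polyDD_mul_sum_nodalErase`, `dd_mul_sum_nodalErase`). With `x' = x` this identifies the
doubled-node conditions with positivity of the matrices `[x i, x j, y]_f`; with `x'` close to `x` it
exhibits their quadratic forms as limits of differences at distinct nodes
(`exists_dd_near_sum_divDiff`).

The link with matrices is second order perturbation: the coefficient of `h ^ 2` in `⟨f(D + h B) w,
w⟩` is `krausForm`, a sum over `l` of quadratic forms of `[x i, x j, x l]_f`
(`eventually_abs_secondDifference_le`). If these matrices are positive, `f` has asymptotically
nonnegative second differences along every segment of Hermitian matrices, which forces convexity.
Conversely, a suitable family of `B` and `w` isolates a single Kraus matrix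
(`MatrixConvexOn.posSemidef`).

To go from an `n`-convex `f`, with no smoothness assumed, to condition 2, mollify. Convolution keeps
`n`-convexity on a smaller interval, and the smooth function has positive Kraus matrices. These are
limits of differences on arbitrarily small intervals, so the mean value theorem makes `(f q²)⁽²ⁿ⁾`
nonnegative, hence all its divided differences; these inequalities pass to the limit
(`divDiffSqNonneg_of_posSemidef`, `MatrixConvexOn.divDiffSqNonneg`).

The link with derivatives is that nonnegative divided differences of order `m + 2` characterise the
`C^m` functions with convex `m`-th derivative (`contDiffOn_and_convexOn_of_dd_nonneg`,
`dd_nonneg_of_convexOn_iteratedDeriv`). Applied to `f` and `f N(q)` with `m = 2 n - 2` this yields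
condition 8. The Leibniz rule makes `(f q²)⁽²ⁿ⁾` a Hankel quadratic form in the Taylor coefficients
of `q`, and rational `q` reduce the exceptional null sets to one, which yields condition 9. In the
way back, an almost everywhere sign alone would not control the singular part of a second
derivative; here the right derivative of `(f N)⁽²ⁿ⁻²⁾` is `N ≥ 0` times an increasing function plus
a Lipschitz function, so its singular part is nonnegative (`convexOn_iteratedDeriv_mul`). -/

/-! ### Divided differences at distinct nodes. -/

/-- The divided difference of `g` at the distinct nodes `a ∈ s`, in Lagrange form. -/
noncomputable def dd (s : Finset ℝ) (g : ℝ → ℝ) : ℝ := ∑ a ∈ s, g a / ∏ b ∈ s.erase a, (a - b)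

theorem dd_congr {s : Finset ℝ} {g h : ℝ → ℝ} (H : ∀ a ∈ s, g a = h a) : dd s g = dd s h :=
  Finset.sum_congr rfl fun a ha => by rw [H a ha]

theorem dd_add (s : Finset ℝ) (g h : ℝ → ℝ) : dd s (fun t => g t + h t) = dd s g + dd s h := by
  simp only [dd, add_div, Finset.sum_add_distrib]

theorem dd_sub (s : Finset ℝ) (g h : ℝ → ℝ) : dd s (fun t => g t - h t) = dd s g - dd s h := by
  simp only [dd, sub_div, Finset.sum_sub_distrib]

theorem dd_const_mul (s : Finset ℝ) (c : ℝ) (g : ℝ → ℝ) :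
    dd s (fun t => c * g t) = c * dd s g := by
  simp only [dd, mul_div_assoc, Finset.mul_sum]

/-- The term of the node `a` vanishes, and in every other term `t - a` cancels against one factor of
the denominator. All recursions below come from this. -/
theorem dd_insert_mul {s : Finset ℝ} {a : ℝ} (ha : a ∉ s) (g : ℝ → ℝ) :
    dd (insert a s) (fun t => (t - a) * g t) = dd s g := by
  rw [dd, Finset.sum_insert ha]
  simp only [sub_self, zero_mul, zero_div, zero_add, dd]
  refine Finset.sum_congr rfl fun c hc => ?_
  have hca : c ≠ a := fun h => ha (h ▸ hc)
  rw [Finset.erase_insert_of_ne hca.symm, Finset.prod_insert (by simp [ha]),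
    mul_div_mul_left _ _ (sub_ne_zero.2 hca)]

/-- Follows from `dd_insert_mul` and `(t - b) - (t - a) = a - b`. -/
theorem dd_recursion {s : Finset ℝ} {a b : ℝ} (ha : a ∉ s) (hb : b ∉ s) (hab : a ≠ b)
    (g : ℝ → ℝ) :
    (a - b) * dd (insert a (insert b s)) g = dd (insert a s) g - dd (insert b s) g := by
  have h1 := dd_insert_mul (s := insert a s) (a := b) (by simp [hb, hab.symm]) g
  have h2 := dd_insert_mul (s := insert b s) (a := a) (by simp [ha, hab]) g
  rw [Finset.insert_comm] at h1
  rw [← h1, ← h2, ← dd_sub, ← dd_const_mul]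
  exact dd_congr fun t _ => by ring

theorem dd_polynomial {s : Finset ℝ} {p : ℝ[X]} (hp : p.degree < s.card) :
    dd s (fun t => p.eval t) = p.coeff (s.card - 1) :=
  (Lagrange.coeff_eq_sum (v := id) (Function.injective_id.injOn) hp).symm

theorem dd_const {s : Finset ℝ} (hs : 1 < s.card) (c : ℝ) : dd s (fun _ => c) = 0 := by
  have h := dd_polynomial (s := s) (p := C c)
    (lt_of_le_of_lt degree_C_le (by exact_mod_cast (by omega : 0 < s.card)))
  rw [coeff_C, if_neg (by omega)] at h
  simpa using h

/-- After subtracting the constant `g c`, the function is `(t - c) * slope g c t`. This trades one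
order of difference for a slope and drives the regularity induction. -/
theorem dd_insert_slope {s : Finset ℝ} {c : ℝ} (hc : c ∉ s) (hs : s.Nonempty) (g : ℝ → ℝ) :
    dd (insert c s) g = dd s (slope g c) := by
  rw [← dd_insert_mul hc, ← sub_zero (dd _ g),
    ← dd_const (s := insert c s) (by rw [Finset.card_insert_of_notMem hc]; simpa using hs) (g c),
    ← dd_sub]
  refine dd_congr fun t _ => ?_
  simpa using (sub_smul_slope g c t).symm

theorem dd_pair {x y : ℝ} (h : x ≠ y) (g : ℝ → ℝ) : dd {x, y} g = slope g x y := by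
  rw [dd_insert_slope (by simpa using h) (by simp)]
  simp [dd]

theorem dd_triple {x y z : ℝ} (hxy : x < y) (hyz : y < z) (g : ℝ → ℝ) :
    (z - x) * dd {x, y, z} g = slope g y z - slope g x y := by
  have h := dd_recursion (s := {y}) (a := x) (b := z) (by simp [hxy.ne]) (by simp [hyz.ne'])
    (hxy.trans hyz).ne g
  rw [dd_pair hxy.ne, dd_pair hyz.ne', Finset.pair_comm z y, slope_comm g z y] at h
  linarith

theorem ConvexOn.dd_triple_nonneg {U : Set ℝ} {g : ℝ → ℝ} (hg : ConvexOn ℝ U g) {x y z : ℝ}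
    (hx : x ∈ U) (hz : z ∈ U) (hxy : x < y) (hyz : y < z) : 0 ≤ dd {x, y, z} g := by
  have h := dd_triple hxy hyz g
  have h2 := hg.slope_mono_adjacent hx hz hxy hyz
  rw [slope_def_field, slope_def_field] at h
  nlinarith

/-! ### Rolle's theorem, interpolation and the mean value theorem. -/

theorem iteratedDeriv_polynomial (p : ℝ[X]) (k : ℕ) :
    iteratedDeriv k (fun t => p.eval t) = fun t => (derivative^[k] p).eval t := by
  induction k with
  | zero => simp
  | succ k ih =>
    rw [iteratedDeriv_succ, ih, Function.iterate_succ_apply']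
    ext t; exact Polynomial.deriv _

theorem contDiff_polynomial (p : ℝ[X]) {k : WithTop ℕ∞} : ContDiff ℝ k (fun t => p.eval t) :=
  by simpa using p.contDiff_aeval (𝕜 := ℝ) k

theorem natDegree_le_of_degree_lt_succ {p : ℝ[X]} {k : ℕ} (h : p.degree < (k + 1 : ℕ)) :
    p.natDegree ≤ k := by
  rw [degree_lt_iff_coeff_zero] at h
  exact natDegree_le_iff_coeff_eq_zero.2 fun N hN => h N hN

/-- Rolle between consecutive zeros; the intervals are disjoint, so the new zeros are distinct. -/
theorem exists_finset_deriv_eq_zero {U : Set ℝ} (hU : OrdConnected U) {h : ℝ → ℝ}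
    (hd : ∀ t ∈ U, DifferentiableAt ℝ h t) {r : ℕ} {Z : Finset ℝ} (hZU : (Z : Set ℝ) ⊆ U)
    (hZ : Z.card = r + 1) (hz : ∀ z ∈ Z, h z = 0) :
    ∃ W : Finset ℝ, (W : Set ℝ) ⊆ U ∧ W.card = r ∧ ∀ w ∈ W, deriv h w = 0 := by
  have key : ∀ i : Fin r, ∃ w ∈ Ioo (Z.orderEmbOfFin hZ i.castSucc) (Z.orderEmbOfFin hZ i.succ),
      deriv h w = 0 := by
    intro i
    have hsub : Icc (Z.orderEmbOfFin hZ i.castSucc) (Z.orderEmbOfFin hZ i.succ) ⊆ U :=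
      hU.out (hZU (Z.orderEmbOfFin_mem hZ _)) (hZU (Z.orderEmbOfFin_mem hZ _))
    refine exists_deriv_eq_zero ((Z.orderEmbOfFin hZ).strictMono i.castSucc_lt_succ)
      (fun t ht => (hd t (hsub ht)).continuousAt.continuousWithinAt) ?_
    rw [hz _ (Z.orderEmbOfFin_mem hZ _), hz _ (Z.orderEmbOfFin_mem hZ _)]
  choose w hw hw0 using key
  have hmono : StrictMono w := by
    intro i j hij
    refine (hw i).2.trans_le (le_trans ?_ (hw j).1.le)
    exact (Z.orderEmbOfFin hZ).monotone (by simpa [Fin.le_def] using hij)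
  refine ⟨Finset.univ.image w, ?_, ?_, ?_⟩
  · intro t ht
    simp only [Finset.coe_image, Finset.coe_univ, image_univ, mem_range] at ht
    obtain ⟨i, rfl⟩ := ht
    exact hU.out (hZU (Z.orderEmbOfFin_mem hZ _)) (hZU (Z.orderEmbOfFin_mem hZ _))
      ⟨(hw i).1.le, (hw i).2.le⟩
  · rw [Finset.card_image_of_injective _ hmono.injective]; simp
  · simp [hw0]

theorem ContDiffOn.iteratedDeriv_of_isOpen {U : Set ℝ} (hU : IsOpen U) {h : ℝ → ℝ} {j k : ℕ}
    (hc : ContDiffOn ℝ (j + k : ℕ) h U) : ContDiffOn ℝ j (iteratedDeriv k h) U := by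
  induction k generalizing h with
  | zero => simpa using hc
  | succ k ih =>
    rw [iteratedDeriv_succ']
    refine ih ?_
    have hc' : ContDiffOn ℝ ((j + k : ℕ) + 1) h U := by
      refine hc.of_le (le_of_eq ?_); push_cast; ring
    exact ((contDiffOn_succ_iff_deriv_of_isOpen hU).1 hc').2.2

theorem ContDiffOn.differentiableAt_iteratedDeriv {U : Set ℝ} (hU : IsOpen U) {h : ℝ → ℝ} {m k : ℕ}
    (hc : ContDiffOn ℝ m h U) (hk : k < m) {t : ℝ} (ht : t ∈ U) :
    DifferentiableAt ℝ (iteratedDeriv k h) t := by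
  have h1 : ContDiffOn ℝ (1 : ℕ) (iteratedDeriv k h) U :=
    ContDiffOn.iteratedDeriv_of_isOpen hU (hc.of_le (by norm_cast; omega))
  exact (h1.differentiableOn (by simp)).differentiableAt (hU.mem_nhds ht)

theorem exists_finset_iteratedDeriv_eq_zero {U : Set ℝ} (hU : OrdConnected U) (hUo : IsOpen U)
    {h : ℝ → ℝ} {m r : ℕ} (hc : ContDiffOn ℝ m h U) {Z : Finset ℝ} (hZU : (Z : Set ℝ) ⊆ U)
    (hZ : Z.card = r + m) (hz : ∀ z ∈ Z, h z = 0) :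
    ∃ W : Finset ℝ, (W : Set ℝ) ⊆ U ∧ W.card = r ∧ ∀ w ∈ W, iteratedDeriv m h w = 0 := by
  induction m generalizing r with
  | zero => exact ⟨Z, hZU, by simpa using hZ, by simpa using hz⟩
  | succ m ih =>
    obtain ⟨W, hWU, hW, hw⟩ := ih (r := r + 1) (hc.of_le (by norm_cast; omega)) (by omega)
    rw [iteratedDeriv_succ]
    exact exists_finset_deriv_eq_zero hU
      (fun t ht => ContDiffOn.differentiableAt_iteratedDeriv hUo hc (Nat.lt_succ_self m) ht) hWU hW hw

/-- Mean value theorem for divided differences. -/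
theorem exists_dd_eq_iteratedDeriv {U : Set ℝ} (hU : OrdConnected U) (hUo : IsOpen U)
    {g : ℝ → ℝ} {k : ℕ} (hc : ContDiffOn ℝ k g U) {s : Finset ℝ} (hsU : (s : Set ℝ) ⊆ U)
    (hs : s.card = k + 1) : ∃ ξ ∈ U, dd s g = iteratedDeriv k g ξ / k.factorial := by
  set P := Lagrange.interpolate s id g with hP
  have hdeg : P.degree < s.card := Lagrange.degree_interpolate_lt _ Function.injective_id.injOn
  have heq : ∀ a ∈ s, g a = P.eval a := fun a ha =>
    (Lagrange.eval_interpolate_at_node g (v := id) Function.injective_id.injOn ha).symm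
  obtain ⟨W, hWU, hW, hw⟩ := exists_finset_iteratedDeriv_eq_zero hU hUo (r := 1)
    (h := fun t => g t - P.eval t) (hc.sub (contDiff_polynomial P).contDiffOn) hsU (by omega)
    (fun z hz => by simp [heq z hz])
  obtain ⟨ξ, rfl⟩ := Finset.card_eq_one.1 hW
  have hξ : ξ ∈ U := hWU (by simp)
  refine ⟨ξ, hξ, ?_⟩
  have h0 := hw ξ (by simp)
  rw [iteratedDeriv_fun_sub (hc.contDiffAt (hUo.mem_nhds hξ)) (contDiff_polynomial P).contDiffAt,
    iteratedDeriv_polynomial] at h0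
  have hc0 : derivative^[k] P = C ((k.factorial : ℝ) * P.coeff k) := by
    have h1 : (derivative^[k] P).natDegree ≤ 0 := by
      refine (natDegree_iterate_derivative P k).trans ?_
      have h2 : P.natDegree ≤ k := natDegree_le_of_degree_lt_succ (hs ▸ hdeg)
      omega
    rw [eq_C_of_natDegree_le_zero h1, coeff_iterate_derivative]
    simp [Nat.descFactorial_self]
  simp only [hc0, eval_C] at h0
  rw [dd_congr heq, dd_polynomial hdeg, hs, Nat.add_sub_cancel, eq_div_iff (by positivity)]
  linarith

/-- If `P` interpolates `g` at the `m + 3` nodes, Rolle gives three points where the `m`-th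
derivatives of `g` and `P` agree. There the second difference of the convex function `g⁽ᵐ⁾` is a
positive multiple of the coefficient of `X ^ (m + 2)` in `P`, which is `dd s g`. -/
theorem dd_nonneg_of_convexOn_iteratedDeriv {U : Set ℝ} (hU : OrdConnected U) (hUo : IsOpen U)
    {g : ℝ → ℝ} {m : ℕ} (hc : ContDiffOn ℝ m g U) (hconv : ConvexOn ℝ U (iteratedDeriv m g))
    {s : Finset ℝ} (hsU : (s : Set ℝ) ⊆ U) (hs : s.card = m + 3) : 0 ≤ dd s g := by
  set P := Lagrange.interpolate s id g with hP
  have hdeg : P.degree < s.card := Lagrange.degree_interpolate_lt _ Function.injective_id.injOn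
  have heq : ∀ a ∈ s, g a = P.eval a := fun a ha =>
    (Lagrange.eval_interpolate_at_node g (v := id) Function.injective_id.injOn ha).symm
  obtain ⟨W, hWU, hW, hw⟩ := exists_finset_iteratedDeriv_eq_zero hU hUo (r := 3)
    (h := fun t => g t - P.eval t) (hc.sub (contDiff_polynomial P).contDiffOn) hsU (by omega)
    (fun z hz => by simp [heq z hz])
  have hW0 : ∀ t ∈ W, iteratedDeriv m g t = (derivative^[m] P).eval t := fun t ht => by
    have h0 := hw t ht
    rw [iteratedDeriv_fun_sub (hc.contDiffAt (hUo.mem_nhds (hWU ht)))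
      (contDiff_polynomial P).contDiffAt, iteratedDeriv_polynomial] at h0
    linarith
  have hnat : P.natDegree ≤ m + 2 := natDegree_le_of_degree_lt_succ (hs ▸ hdeg)
  have hdd : 0 ≤ dd W (iteratedDeriv m g) := by
    set e := W.orderEmbOfFin hW
    have hWe : W = {e 0, e 1, e 2} := by
      rw [← Finset.image_orderEmbOfFin_univ W hW]
      simp [Fin.univ_succ, e]
    rw [hWe]
    exact hconv.dd_triple_nonneg (hWU (W.orderEmbOfFin_mem hW _)) (hWU (W.orderEmbOfFin_mem hW _))
      (e.strictMono (by decide)) (e.strictMono (by decide))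
  rw [dd_congr hW0, dd_polynomial, hW, coeff_iterate_derivative] at hdd
  · rw [dd_congr heq, dd_polynomial hdeg, hs]
    have : (0 : ℝ) < (3 - 1 + m).descFactorial m := by
      exact_mod_cast Nat.descFactorial_pos.2 (by omega)
    rw [nsmul_eq_mul] at hdd
    have h2 := nonneg_of_mul_nonneg_right hdd this
    rwa [show 3 - 1 + m = m + 3 - 1 by omega] at h2
  · refine lt_of_le_of_lt degree_le_natDegree ?_
    rw [hW]
    have := natDegree_iterate_derivative P m
    exact_mod_cast (by omega : (derivative^[m] P).natDegree < 3)

/-! ### Regularity from nonnegative divided differences. -/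

theorem dd_insert_le_dd_insert {U : Set ℝ} {g : ℝ → ℝ} {k : ℕ}
    (h : ∀ s : Finset ℝ, (s : Set ℝ) ⊆ U → s.card = k + 2 → 0 ≤ dd s g) {s : Finset ℝ} {a b : ℝ}
    (hs : s.card = k) (ha : a ∉ s) (hb : b ∉ s) (hab : a < b)
    (hU : ((insert a (insert b s) : Finset ℝ) : Set ℝ) ⊆ U) :
    dd (insert a s) g ≤ dd (insert b s) g := by
  have h1 := dd_recursion ha hb hab.ne g
  have h2 := h _ hU (by
    rw [Finset.card_insert_of_notMem (by simp [hab.ne, ha]), Finset.card_insert_of_notMem hb, hs])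
  nlinarith

/-- Nodes move to the right one at a time, each move increasing the difference by
`dd_insert_le_dd_insert`. The set `R` of resting nodes must vary in the induction: a node waits in
it while the others move. -/
theorem dd_union_le_dd_image_union {U : Set ℝ} {g : ℝ → ℝ} {k : ℕ}
    (h : ∀ s : Finset ℝ, (s : Set ℝ) ⊆ U → s.card = k + 2 → 0 ≤ dd s g) {τ : ℝ → ℝ}
    {A R : Finset ℝ} (hτ : ∀ a ∈ A, a < τ a) (hinj : InjOn τ A) (hAR : Disjoint A R)
    (hτR : Disjoint (A.image τ) R) (hAτ : Disjoint A (A.image τ)) (hAU : (A : Set ℝ) ⊆ U)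
    (hτU : (A.image τ : Set ℝ) ⊆ U) (hRU : (R : Set ℝ) ⊆ U) (hcard : A.card + R.card = k + 1) :
    dd (A ∪ R) g ≤ dd (A.image τ ∪ R) g := by
  classical
  induction A using Finset.induction_on generalizing R with
  | empty => simp
  | insert a A haA ih =>
    simp only [Finset.mem_insert, forall_eq_or_imp, Finset.coe_insert, Finset.disjoint_insert_left,
      Finset.image_insert, Finset.disjoint_insert_right, insert_subset_iff] at *
    rw [Finset.card_insert_of_notMem haA] at hcard
    have hτa : τ a ∉ A.image τ := by
      intro hmem
      obtain ⟨b, hb, hba⟩ := Finset.mem_image.1 hmem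
      exact haA (hinj (by simp [hb]) (by simp) hba ▸ hb)
    have hcardτ : (A.image τ).card = A.card :=
      Finset.card_image_of_injOn (hinj.mono (subset_insert _ _))
    have h1 := ih hτ.2 (hinj.mono (subset_insert _ _)) (R := insert a R)
      (by simp [haA, hAR.2]) (by
        rw [Finset.disjoint_insert_right]; exact ⟨hAτ.2.1, hτR.2⟩) hAτ.2.2 hAU.2 hτU.2
      (by simp [insert_subset_iff, hAU.1, hRU])
      (by rw [Finset.card_insert_of_notMem hAR.1]; omega)
    rw [Finset.insert_union, Finset.insert_union]
    rw [Finset.union_insert, Finset.union_insert] at h1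
    refine h1.trans (dd_insert_le_dd_insert h ?_ ?_ ?_ hτ.1 ?_)
    · rw [Finset.card_union_of_disjoint hτR.2, hcardτ]; omega
    · simp only [Finset.mem_union, not_or]; simp_all
    · simp only [Finset.mem_union, not_or]; exact ⟨hτa, hτR.1⟩
    · simp only [Finset.coe_insert, Finset.coe_union, insert_subset_iff, union_subset_iff]
      exact ⟨hAU.1, hτU.1, hτU.2, hRU⟩

theorem dd_le_dd_of_forall_lt {U : Set ℝ} {g : ℝ → ℝ} {k : ℕ}
    (h : ∀ s : Finset ℝ, (s : Set ℝ) ⊆ U → s.card = k + 2 → 0 ≤ dd s g) {A B : Finset ℝ}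
    (hAU : (A : Set ℝ) ⊆ U) (hBU : (B : Set ℝ) ⊆ U) (hA : A.card = k + 1) (hB : B.card = k + 1)
    (hAB : ∀ a ∈ A, ∀ b ∈ B, a < b) : dd A g ≤ dd B g := by
  classical
  let e := Finset.equivOfCardEq (hA.trans hB.symm)
  let τ : ℝ → ℝ := fun t => if ht : t ∈ A then (e ⟨t, ht⟩ : ℝ) else t
  have hτ : ∀ t (ht : t ∈ A), τ t = e ⟨t, ht⟩ := fun t ht => dif_pos ht
  have hinj : InjOn τ A := fun x hx y hy hxy => by
    rw [hτ x hx, hτ y hy] at hxy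
    simpa using e.injective (Subtype.ext hxy)
  have himg : A.image τ = B := by
    refine Finset.eq_of_subset_of_card_le (fun t ht => ?_) ?_
    · obtain ⟨x, hx, rfl⟩ := Finset.mem_image.1 ht
      rw [hτ x hx]; exact (e ⟨x, hx⟩).2
    · rw [Finset.card_image_of_injOn hinj, hA, hB]
  have := dd_union_le_dd_image_union h (τ := τ) (A := A) (R := ∅)
    (fun a ha => by rw [hτ a ha]; exact hAB a ha _ (e ⟨a, ha⟩).2) hinj (by simp) (by simp)
    (by rw [himg, Finset.disjoint_left]; exact fun t h1 h2 => lt_irrefl _ (hAB t h1 t h2)) hAU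
    (by rwa [himg]) (by simp) (by simpa using hA)
  simpa [himg] using this

/-- By monotonicity in the nodes, fixed node sets to the left and to the right of `[α, β]` bound
everything in between. -/
theorem exists_bound_dd {U : Set ℝ} {g : ℝ → ℝ} {k : ℕ}
    (h : ∀ s : Finset ℝ, (s : Set ℝ) ⊆ U → s.card = k + 2 → 0 ≤ dd s g) (hU : OrdConnected U)
    {α α' β β' : ℝ} (hα : α' ∈ U) (hβ : β' ∈ U) (hαα : α' < α) (hββ : β < β') :
    ∃ M, ∀ s : Finset ℝ, (s : Set ℝ) ⊆ Icc α β → s.card = k + 1 → |dd s g| ≤ M := by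
  obtain ⟨A, hA, hAc⟩ := (Ioo_infinite hαα).exists_subset_card_eq (k + 1)
  obtain ⟨B, hB, hBc⟩ := (Ioo_infinite hββ).exists_subset_card_eq (k + 1)
  refine ⟨max (dd B g) (-dd A g), fun s hs hc => ?_⟩
  have hsne : s.Nonempty := Finset.card_pos.1 (by omega)
  obtain ⟨x, hx⟩ := hsne
  have hαβ : α ≤ β := (hs hx).1.trans (hs hx).2
  have hsub : ∀ t, α' ≤ t → t ≤ β' → t ∈ U := fun t h1 h2 => hU.out hα hβ ⟨h1, h2⟩
  have hsU : (s : Set ℝ) ⊆ U := fun t ht =>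
    hsub t (hαα.le.trans (hs ht).1) ((hs ht).2.trans hββ.le)
  have h1 : dd s g ≤ dd B g := dd_le_dd_of_forall_lt h hsU
    (fun t ht => hsub t (by linarith [(hB ht).1]) (hB ht).2.le) hc hBc
    fun a ha b hb => (hs ha).2.trans_lt (hB hb).1
  have h2 : dd A g ≤ dd s g := dd_le_dd_of_forall_lt h
    (fun t ht => hsub t (hA ht).1.le (by linarith [(hA ht).2])) hsU hAc hc
    fun a ha b hb => (hA ha).2.trans_le (hs hb).1
  rw [abs_le]
  constructor
  · linarith [le_max_right (dd B g) (-dd A g)]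
  · exact h1.trans (le_max_left _ _)

/-- Induction on the order through `slope g c` on `S \ {c}`, for which `dd_insert_slope` provides
the bound. Bounded diameter makes that slope bounded, and `g t = g c + (t - c) * slope g c t`
carries the estimate back to `g`. -/
theorem exists_lipschitz_of_dd_bounded {k : ℕ} {S : Set ℝ} {L : ℝ}
    (hL : ∀ x ∈ S, ∀ y ∈ S, |x - y| ≤ L) {g : ℝ → ℝ} {M : ℝ}
    (hM : ∀ s : Finset ℝ, (s : Set ℝ) ⊆ S → s.card = k + 2 → |dd s g| ≤ M) :
    ∃ C, ∀ x ∈ S, ∀ y ∈ S, |g x - g y| ≤ C * |x - y| := by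
  induction k generalizing S g with
  | zero =>
    refine ⟨M, fun x hx y hy => ?_⟩
    rcases eq_or_ne x y with rfl | hxy
    · simp
    have h1 := hM {x, y} (by simp [insert_subset_iff, hx, hy]) (Finset.card_pair hxy)
    rw [dd_pair hxy, slope_def_field, abs_div, div_le_iff₀ (abs_pos.2 (sub_ne_zero.2 hxy.symm))] at h1
    rwa [abs_sub_comm (g y), abs_sub_comm y] at h1
  | succ k ih =>
    rcases S.eq_empty_or_nonempty with rfl | ⟨c, hc⟩
    · simp
    obtain ⟨C, hC⟩ := ih (S := S \ {c}) (g := slope g c)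
      (fun x hx y hy => hL x hx.1 y hy.1) (fun s hs hcard => by
        have hcs : c ∉ s := fun h => (hs h).2 rfl
        rw [← dd_insert_slope hcs (Finset.card_pos.1 (by omega))]
        refine hM _ ?_ (by rw [Finset.card_insert_of_notMem hcs, hcard])
        rw [Finset.coe_insert, insert_subset_iff]
        exact ⟨hc, hs.trans sdiff_subset⟩)
    have hbd : ∃ B, 0 ≤ B ∧ ∀ x ∈ S, |slope g c x| ≤ B := by
      rcases (S \ {c}).eq_empty_or_nonempty with he | ⟨d, hd⟩
      · refine ⟨0, le_rfl, fun x hx => ?_⟩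
        have : x = c := by
          by_contra hne
          exact (he ▸ (show x ∈ S \ {c} from ⟨hx, hne⟩) : x ∈ (∅ : Set ℝ))
        simp [this]
      · refine ⟨|C| * L + |slope g c d|, add_nonneg (mul_nonneg (abs_nonneg _)
          ((abs_nonneg _).trans (hL c hc c hc))) (abs_nonneg _), fun x hx => ?_⟩
        rcases eq_or_ne x c with rfl | hne
        · rw [slope_same, abs_zero]
          exact add_nonneg (mul_nonneg (abs_nonneg _)
            ((abs_nonneg _).trans (hL x hx x hx))) (abs_nonneg _)
        have h1 := hC x ⟨hx, hne⟩ d hd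
        have h2 : C * |x - d| ≤ |C| * L :=
          mul_le_mul (le_abs_self C) (hL x hx d hd.1) (abs_nonneg _) (abs_nonneg _)
        have h3 := abs_sub_abs_le_abs_sub (slope g c x) (slope g c d)
        linarith
    obtain ⟨B, hB0, hB⟩ := hbd
    have hg : ∀ t, g t = g c + (t - c) * slope g c t := fun t => by
      have := sub_smul_slope g c t
      simp only [smul_eq_mul, vsub_eq_sub] at this
      linarith
    have hL0 : 0 ≤ L := (abs_nonneg _).trans (hL c hc c hc)
    refine ⟨B + L * |C|, fun x hx y hy => ?_⟩
    rcases eq_or_ne y c with rfl | hy'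
    · rw [hg x, add_sub_cancel_left, abs_mul, mul_comm]
      refine mul_le_mul_of_nonneg_right ?_ (abs_nonneg _)
      nlinarith [hB x hx, abs_nonneg C]
    rcases eq_or_ne x c with rfl | hx'
    · rw [abs_sub_comm, hg y, add_sub_cancel_left, abs_mul, mul_comm, abs_sub_comm x y]
      refine mul_le_mul_of_nonneg_right ?_ (abs_nonneg _)
      nlinarith [hB y hy, abs_nonneg C]
    have h1 : g x - g y = (x - y) * slope g c x + (y - c) * (slope g c x - slope g c y) := by
      rw [hg x, hg y]; ring
    rw [h1]
    refine (abs_add_le _ _).trans ?_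
    rw [abs_mul, abs_mul]
    have h2 := hC x ⟨hx, hx'⟩ y ⟨hy, hy'⟩
    have h3 : |y - c| * |slope g c x - slope g c y| ≤ L * (|C| * |x - y|) :=
      mul_le_mul (hL y hy c hc) (h2.trans (mul_le_mul_of_nonneg_right (le_abs_self C)
        (abs_nonneg _))) (abs_nonneg _) hL0
    nlinarith [hB x hx, abs_nonneg (x - y)]

/-- A Lipschitz slope extends continuously to `c`, and the value of the extension there is the
derivative. -/
theorem differentiableAt_of_slope_lipschitz {g : ℝ → ℝ} {c : ℝ} {S : Set ℝ} (hS : S ∈ 𝓝 c) {C : ℝ}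
    (hC : ∀ x ∈ S \ {c}, ∀ y ∈ S \ {c}, |slope g c x - slope g c y| ≤ C * |x - y|) :
    DifferentiableAt ℝ g c := by
  have hlip : LipschitzOnWith (Real.toNNReal |C|) (slope g c) (S \ {c}) := by
    refine LipschitzOnWith.of_dist_le_mul fun x hx y hy => ?_
    rw [Real.dist_eq, Real.dist_eq, Real.coe_toNNReal _ (abs_nonneg C)]
    exact (hC x hx y hy).trans (mul_le_mul_of_nonneg_right (le_abs_self C) (abs_nonneg _))
  obtain ⟨G, hG, hGe⟩ := hlip.extend_real
  have h1 : Tendsto (slope g c) (𝓝[≠] c) (𝓝 (G c)) := by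
    refine ((hG.continuous.tendsto c).mono_left nhdsWithin_le_nhds).congr' ?_
    filter_upwards [self_mem_nhdsWithin, mem_nhdsWithin_of_mem_nhds hS] with t ht hts
    exact (hGe ⟨hts, ht⟩).symm
  exact (hasDerivAt_iff_tendsto_slope.2 h1).differentiableAt

theorem dd_image_add (s : Finset ℝ) (h : ℝ) (g : ℝ → ℝ) :
    dd (s.image (· + h)) g = dd s (fun t => g (t + h)) := by
  have hinj : Function.Injective (· + h) := add_left_injective h
  rw [dd, Finset.sum_image hinj.injOn, dd]
  refine Finset.sum_congr rfl fun a _ => ?_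
  rw [← Finset.image_erase hinj, Finset.prod_image hinj.injOn]
  simp

/-- Shifting all nodes by a small `r > 0` does not decrease the difference, and the derivative at `r
= 0` of the shifted difference is `dd s (deriv g)`. -/
theorem dd_deriv_nonneg {U : Set ℝ} (hUo : IsOpen U) {g : ℝ → ℝ} {k : ℕ}
    (h : ∀ s : Finset ℝ, (s : Set ℝ) ⊆ U → s.card = k + 2 → 0 ≤ dd s g)
    (hd : ∀ t ∈ U, DifferentiableAt ℝ g t) {s : Finset ℝ} (hs : (s : Set ℝ) ⊆ U)
    (hc : s.card = k + 1) : 0 ≤ dd s (deriv g) := by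
  have h1 : HasDerivAt (fun r => dd s (fun t => g (t + r))) (dd s (deriv g)) 0 := by
    refine HasDerivAt.fun_sum fun a ha => HasDerivAt.div_const ?_ _
    have := (hd a (hs ha)).hasDerivAt
    have h2 : HasDerivAt g (deriv g a) (a + 0) := by simpa using this
    exact h2.comp_const_add a 0
  have h2 : ∀ᶠ r in 𝓝[>] (0 : ℝ), dd s g ≤ dd s (fun t => g (t + r)) := by
    have e1 : ∀ᶠ r in 𝓝[>] (0 : ℝ), ∀ a ∈ s, a + r ∈ U := by
      rw [eventually_all_finset]
      intro a ha
      have : Tendsto (fun r => a + r) (𝓝 0) (𝓝 a) := by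
        simpa using (continuous_const.add continuous_id).tendsto (0 : ℝ) (f := fun r => a + r)
      exact nhdsWithin_le_nhds (this (hUo.mem_nhds (hs ha)))
    -- The comparison of node sets needs the shifted nodes to avoid the old ones.
    have e2 : ∀ᶠ r in 𝓝[>] (0 : ℝ), ∀ a ∈ s, ∀ b ∈ s, a + r ≠ b := by
      rw [eventually_all_finset]
      intro a ha
      rw [eventually_all_finset]
      intro b hb
      rcases eq_or_ne a b with rfl | hab
      · filter_upwards [self_mem_nhdsWithin] with r hr h0
        have : (0 : ℝ) < r := hr
        linarith
      · have : ∀ᶠ r in 𝓝 (0 : ℝ), r ≠ b - a :=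
          isOpen_ne.mem_nhds (sub_ne_zero.2 hab.symm).symm
        filter_upwards [nhdsWithin_le_nhds this] with r hr h0
        exact hr (by linarith)
    filter_upwards [e1, e2, self_mem_nhdsWithin] with r hr1 hr2 hr
    have hr0 : (0 : ℝ) < r := hr
    rw [← dd_image_add]
    have := dd_union_le_dd_image_union h (τ := (· + r)) (A := s) (R := ∅)
      (fun a _ => by simpa using hr0) (add_left_injective r).injOn (by simp) (by simp)
      (by
        rw [Finset.disjoint_left]
        intro b hb hmem
        obtain ⟨a, ha, hab⟩ := Finset.mem_image.1 hmem
        exact hr2 a ha b hb hab) hs (by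
        intro t ht
        simp only [Finset.coe_image, mem_image] at ht
        obtain ⟨a, ha, rfl⟩ := ht
        exact hr1 a ha) (by simp) (by simpa using hc)
    simpa using this
  have h3 : Tendsto (slope (fun r => dd s (fun t => g (t + r))) 0) (𝓝[>] 0)
      (𝓝 (dd s (deriv g))) :=
    (hasDerivAt_iff_tendsto_slope.1 h1).mono_left (nhdsWithin_mono _ fun r hr => ne_of_gt hr)
  refine ge_of_tendsto h3 ?_
  filter_upwards [h2, self_mem_nhdsWithin] with r hr hr0
  rw [slope_def_field]
  refine div_nonneg ?_ (by simpa using (le_of_lt hr0))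
  simpa using hr

/-- A function with nonnegative divided differences of order `m + 2` is `C^m` with convex `m`-th
derivative. -/
theorem contDiffOn_and_convexOn_of_dd_nonneg {U : Set ℝ} (hU : OrdConnected U) (hUo : IsOpen U)
    {g : ℝ → ℝ} {m : ℕ}
    (h : ∀ s : Finset ℝ, (s : Set ℝ) ⊆ U → s.card = m + 3 → 0 ≤ dd s g) :
    ContDiffOn ℝ m g U ∧ ConvexOn ℝ U (iteratedDeriv m g) := by
  induction m generalizing g with
  | zero =>
    have hconv : ConvexOn ℝ U g := by
      refine convexOn_of_slope_mono_adjacent hU.convex fun {x y z} hx hz hxy hyz => ?_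
      have h1 := h {x, y, z} (by
        simp only [Finset.coe_insert, Finset.coe_singleton, insert_subset_iff,
          singleton_subset_iff]
        exact ⟨hx, hU.out hx hz ⟨hxy.le, hyz.le⟩, hz⟩) (by
          rw [Finset.card_insert_of_notMem (by simp [hxy.ne, (hxy.trans hyz).ne]),
            Finset.card_pair hyz.ne])
      have h2 := dd_triple hxy hyz g
      rw [slope_def_field, slope_def_field] at h2
      nlinarith
    exact ⟨by simpa using hconv.continuousOn hUo, by simpa using hconv⟩
  | succ m ih =>
    have hd : ∀ t ∈ U, DifferentiableAt ℝ g t := by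
      intro c hc
      obtain ⟨ε, hε, hball⟩ := Metric.isOpen_iff.1 hUo c hc
      have hin : ∀ t, |t - c| < ε → t ∈ U := fun t ht => hball (by rwa [Metric.mem_ball, Real.dist_eq])
      -- Differences of `g` of order `m + 2` are bounded near `c`, so those of `slope g c` of order
      -- `m + 1` are too, and the slope is Lipschitz near `c`.
      obtain ⟨M, hM⟩ := exists_bound_dd (k := m + 2) (α := c - ε / 4) (β := c + ε / 4)
        (α' := c - ε / 2) (β' := c + ε / 2) h hU
        (hin _ (by rw [abs_lt]; constructor <;> linarith))
        (hin _ (by rw [abs_lt]; constructor <;> linarith)) (by linarith) (by linarith)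
      obtain ⟨C, hC⟩ := exists_lipschitz_of_dd_bounded (k := m) (g := slope g c) (M := M)
        (S := Icc (c - ε / 4) (c + ε / 4) \ {c}) (L := ε)
        (fun x hx y hy => by
          rw [abs_le]; constructor <;> linarith [hx.1.1, hx.1.2, hy.1.1, hy.1.2])
        (fun s hs hcard => by
          have hcs : c ∉ s := fun h => (hs h).2 rfl
          rw [← dd_insert_slope hcs (Finset.card_pos.1 (by omega))]
          refine hM _ ?_ (by rw [Finset.card_insert_of_notMem hcs, hcard])
          rw [Finset.coe_insert, insert_subset_iff]
          exact ⟨⟨by linarith, by linarith⟩, hs.trans sdiff_subset⟩)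
      exact differentiableAt_of_slope_lipschitz
        (Icc_mem_nhds (by linarith) (by linarith)) hC
    obtain ⟨h1, h2⟩ := ih (g := deriv g) fun s hs hc => dd_deriv_nonneg hUo h hd hs hc
    refine ⟨?_, by rwa [iteratedDeriv_succ']⟩
    push_cast
    rw [contDiffOn_succ_iff_deriv_of_isOpen hUo]
    exact ⟨fun t ht => (hd t ht).differentiableWithinAt, by simp, h1⟩

/-! ### The Leibniz rule and jets. -/

/-- The `j`-th derivative of `f N` given by the Leibniz rule, where `F k` stands for `f⁽ᵏ⁾`. -/
noncomputable def leibniz : ℕ → (ℕ → ℝ → ℝ) → ℝ[X] → ℝ → ℝ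
  | 0, F, N => fun t => F 0 t * N.eval t
  | j + 1, F, N => fun t => leibniz j (fun k => F (k + 1)) N t + leibniz j F (derivative N) t

/-- The functions `F k` need to be successive derivatives only at `t` and only within `S`, so one
formula serves ordinary, right and almost everywhere derivatives. -/
theorem hasDerivWithinAt_leibniz {S : Set ℝ} {t : ℝ} {j : ℕ} {F : ℕ → ℝ → ℝ} (N : ℝ[X])
    (h : ∀ k ≤ j, HasDerivWithinAt (F k) (F (k + 1) t) S t) :
    HasDerivWithinAt (leibniz j F N) (leibniz (j + 1) F N t) S t := by
  induction j generalizing F N with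
  | zero => exact (h 0 le_rfl).mul (N.hasDerivWithinAt t S)
  | succ j ih =>
    exact (ih (F := fun k => F (k + 1)) N fun k hk => h (k + 1) (by omega)).add
      (ih (derivative N) fun k hk => h k (by omega))

theorem iteratedDeriv_mul_eq_leibniz {U : Set ℝ} (hU : IsOpen U) {f : ℝ → ℝ} {m : ℕ}
    (hf : ContDiffOn ℝ m f U) {F : ℕ → ℝ → ℝ} (hF : ∀ k ≤ m, F k = iteratedDeriv k f) (N : ℝ[X])
    {j : ℕ} (hj : j ≤ m) :
    EqOn (iteratedDeriv j (fun t => f t * N.eval t)) (leibniz j F N) U := by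
  induction j with
  | zero => intro t _; simp [leibniz, hF 0 hj]
  | succ j ih =>
    intro t ht
    rw [iteratedDeriv_succ, (ih (by omega)).eventuallyEq_of_mem (hU.mem_nhds ht) |>.deriv_eq]
    rw [← hasDerivWithinAt_univ.1 (hasDerivWithinAt_leibniz N fun k hk => ?_) |>.deriv]
    rw [hF k (by omega), hF (k + 1) (by omega), iteratedDeriv_succ]
    exact (ContDiffOn.differentiableAt_iteratedDeriv hU hf (by omega) ht).hasDerivAt.hasDerivWithinAt

theorem leibniz_congr {t : ℝ} {j : ℕ} {F G : ℕ → ℝ → ℝ} (h : ∀ k ≤ j, F k t = G k t) (N : ℝ[X]) :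
    leibniz j F N t = leibniz j G N t := by
  induction j generalizing F G N with
  | zero => simp [leibniz, h]
  | succ j ih =>
    simp only [leibniz]
    rw [ih (F := fun k => F (k + 1)) (G := fun k => G (k + 1)) fun k hk => h (k + 1) (by omega),
      ih (F := F) (G := G) fun k hk => h k (by omega)]

/-- With `leibniz_congr`, which sees only the values `F k t`, this reduces identities for `leibniz`
at a point to polynomials with the same jet. -/
theorem leibniz_polynomial (j : ℕ) (p N : ℝ[X]) (t : ℝ) :
    leibniz j (fun k s => (derivative^[k] p).eval s) N t = (derivative^[j] (p * N)).eval t := by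
  induction j generalizing p N with
  | zero => simp [leibniz]
  | succ j ih =>
    simp only [leibniz, Function.iterate_succ_apply, derivative_mul, iterate_map_add, eval_add]
    rw [ih (derivative p) N, ← ih p (derivative N)]

theorem leibniz_zero (j : ℕ) (F : ℕ → ℝ → ℝ) (t : ℝ) : leibniz j F 0 t = 0 := by
  induction j generalizing F with
  | zero => simp [leibniz]
  | succ j ih => simp [leibniz, ih]

theorem leibniz_one (j : ℕ) (F : ℕ → ℝ → ℝ) (t : ℝ) : leibniz j F 1 t = F j t := by
  induction j generalizing F with
  | zero => simp [leibniz]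
  | succ j ih => simp [leibniz, ih, leibniz_zero]

theorem eval_iterate_derivative_eq_taylor_coeff (p : ℝ[X]) (k : ℕ) (t : ℝ) :
    (derivative^[k] p).eval t = k.factorial * (taylor t p).coeff k := by
  rw [taylor_coeff, ← factorial_smul_hasseDeriv]
  simp

/-- The polynomial with prescribed derivatives `c k`, `k ≤ j`, at `t`. -/
noncomputable def jetPolynomial (j : ℕ) (c : ℕ → ℝ) (t : ℝ) : ℝ[X] :=
  taylor (-t) (∑ k ∈ Finset.range (j + 1), monomial k (c k / k.factorial))

theorem taylor_jetPolynomial (j : ℕ) (c : ℕ → ℝ) (t : ℝ) :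
    taylor t (jetPolynomial j c t) =
      ∑ k ∈ Finset.range (j + 1), monomial k (c k / k.factorial) := by
  rw [jetPolynomial, taylor_taylor]; simp

theorem taylor_jetPolynomial_coeff {j k : ℕ} (c : ℕ → ℝ) (t : ℝ) (hk : k ≤ j) :
    (taylor t (jetPolynomial j c t)).coeff k = c k / k.factorial := by
  rw [taylor_jetPolynomial, finsetSum_coeff]
  simp only [coeff_monomial, Finset.sum_ite_eq', Finset.mem_range]
  rw [if_pos (by omega)]

theorem eval_iterate_derivative_jetPolynomial {j k : ℕ} (c : ℕ → ℝ) (t : ℝ) (hk : k ≤ j) :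
    (derivative^[k] (jetPolynomial j c t)).eval t = c k := by
  rw [eval_iterate_derivative_eq_taylor_coeff, taylor_jetPolynomial_coeff c t hk]
  field_simp

/-- Replacing the jet of `F` by a polynomial `p`, the left side is `(2 n)!` times the Taylor
coefficient of order `2 n` of `p * q ^ 2`. The reversal of indices is what makes the orders add up:
`(i + 1) + (j + 1) + (n - 1 - i) + (n - 1 - j) = 2 n`. -/
theorem leibniz_sq_eq_sum {n : ℕ} (hn : 1 ≤ n) (F : ℕ → ℝ → ℝ) {q : ℝ[X]}
    (hq : q.natDegree ≤ n - 1) (t : ℝ) :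
    leibniz (2 * n) F (q ^ 2) t = (2 * n).factorial * ∑ i : Fin n, ∑ j : Fin n,
      (taylor t q).coeff (i.rev : ℕ) * (taylor t q).coeff (j.rev : ℕ) *
        (F ((i + 1) + (j + 1)) t / (((i : ℕ) + 1) + ((j : ℕ) + 1)).factorial) := by
  set p := jetPolynomial (2 * n) (fun k => F k t) t with hp
  rw [leibniz_congr (G := fun k s => (derivative^[k] p).eval s) (fun k hk =>
    (eval_iterate_derivative_jetPolynomial (fun k => F k t) t hk).symm), leibniz_polynomial,
    eval_iterate_derivative_eq_taylor_coeff, taylor_mul]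
  congr 1
  have hr : taylor t q = ∑ i : Fin n, monomial (i.rev : ℕ) ((taylor t q).coeff (i.rev : ℕ)) := by
    rw [show ∑ i : Fin n, monomial (i.rev : ℕ) ((taylor t q).coeff (i.rev : ℕ)) =
      ∑ i : Fin n, monomial (i : ℕ) ((taylor t q).coeff (i : ℕ)) from
      Equiv.sum_comp Fin.revPerm (fun i : Fin n => monomial (i : ℕ) ((taylor t q).coeff i))]
    conv_lhs => rw [(taylor t q).as_sum_range' n (by rw [natDegree_taylor]; omega)]
    rw [Finset.sum_range]
  set r := taylor t q with hrdef
  have hqq : taylor t (q ^ 2) = r * r := by rw [sq, taylor_mul]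
  rw [hqq]
  conv_lhs => rw [hr]
  rw [Finset.sum_mul_sum, Finset.mul_sum, finsetSum_coeff]
  refine Finset.sum_congr rfl fun i _ => ?_
  rw [Finset.mul_sum, finsetSum_coeff]
  refine Finset.sum_congr rfl fun j _ => ?_
  rw [monomial_mul_monomial, mul_comm (taylor t p),
    show 2 * n = ((i : ℕ) + 1 + (j + 1)) + ((i.rev : ℕ) + j.rev) by
      simp only [Fin.val_rev]; omega, coeff_monomial_mul,
    hp, taylor_jetPolynomial_coeff _ _ (by omega)]

/-! ### Derivatives of order `m + 1` and `m + 2` when `f⁽ᵐ⁾` is convex. -/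

/-- The derivatives `f, f', …, f⁽ᵐ⁾`, followed by the right derivative of `f⁽ᵐ⁾` and its
derivative. -/
noncomputable def rightJet (m : ℕ) (f : ℝ → ℝ) (k : ℕ) : ℝ → ℝ :=
  if k ≤ m then iteratedDeriv k f
  else if k = m + 1 then fun t => derivWithin (iteratedDeriv m f) (Ioi t) t
  else deriv fun t => derivWithin (iteratedDeriv m f) (Ioi t) t

theorem rightJet_of_le {m k : ℕ} (f : ℝ → ℝ) (h : k ≤ m) : rightJet m f k = iteratedDeriv k f :=
  if_pos h

theorem rightJet_succ (m : ℕ) (f : ℝ → ℝ) :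
    rightJet m f (m + 1) = fun t => derivWithin (iteratedDeriv m f) (Ioi t) t := by
  simp [rightJet]

theorem rightJet_add_two (m : ℕ) (f : ℝ → ℝ) :
    rightJet m f (m + 2) = deriv fun t => derivWithin (iteratedDeriv m f) (Ioi t) t := by
  simp [rightJet]

/-- The slope between `s` and `t` lies between the right derivatives at `s` and at `t`. -/
theorem ConvexOn.hasDerivAt_of_continuousAt_rightDeriv {U : Set ℝ} (hU : IsOpen U) {g : ℝ → ℝ}
    (hg : ConvexOn ℝ U g) {t : ℝ} (ht : t ∈ U)
    (hc : ContinuousAt (fun s => derivWithin g (Ioi s) s) t) :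
    HasDerivAt g (derivWithin g (Ioi t) t) t := by
  rw [hasDerivAt_iff_tendsto_slope]
  have hin : ∀ s ∈ U, s ∈ interior U := fun s hs => by rwa [hU.interior_eq]
  have hb : ∀ᶠ s in 𝓝[≠] t, |slope g t s - derivWithin g (Ioi t) t| ≤
      |derivWithin g (Ioi s) s - derivWithin g (Ioi t) t| := by
    filter_upwards [mem_nhdsWithin_of_mem_nhds (hU.mem_nhds ht), self_mem_nhdsWithin] with s hs hne
    rcases lt_or_gt_of_ne (show s ≠ t from hne) with hst | hst
    · have h1 := hg.rightDeriv_le_slope_of_mem_interior (hin s hs) ht hst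
      have h2 := hg.slope_le_leftDeriv_of_mem_interior hs (hin t ht) hst
      have h3 := hg.leftDeriv_le_rightDeriv_of_mem_interior (hin t ht)
      rw [slope_comm, abs_of_nonpos (by linarith), abs_of_nonpos (by linarith)]
      linarith
    · have h1 := hg.rightDeriv_le_slope_of_mem_interior (hin t ht) hs hst
      have h2 := hg.slope_le_leftDeriv_of_mem_interior ht (hin s hs) hst
      have h3 := hg.leftDeriv_le_rightDeriv_of_mem_interior (hin s hs)
      rw [abs_of_nonneg (by linarith), abs_of_nonneg (by linarith)]
      linarith
  have hc' : Tendsto (fun s => |derivWithin g (Ioi s) s - derivWithin g (Ioi t) t|) (𝓝[≠] t)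
      (𝓝 0) := by
    have := ((hc.tendsto.mono_left (nhdsWithin_le_nhds (s := {t}ᶜ))).sub_const
      (derivWithin g (Ioi t) t)).abs
    simpa using this
  rw [← tendsto_sub_nhds_zero_iff]
  exact squeeze_zero_norm' (by simpa [Real.norm_eq_abs] using hb) hc'

theorem hasDerivWithinAt_rightJet {U : Set ℝ} (hU : IsOpen U) {f : ℝ → ℝ} {m : ℕ}
    (hf : ContDiffOn ℝ m f U) (hconv : ConvexOn ℝ U (iteratedDeriv m f)) {t : ℝ} (ht : t ∈ U)
    {k : ℕ} (hk : k ≤ m) : HasDerivWithinAt (rightJet m f k) (rightJet m f (k + 1) t) (Ioi t) t := by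
  rcases hk.lt_or_eq with hk | rfl
  · rw [rightJet_of_le f hk.le, rightJet_of_le f hk, iteratedDeriv_succ]
    exact (ContDiffOn.differentiableAt_iteratedDeriv hU hf hk ht).hasDerivAt.hasDerivWithinAt
  · rw [rightJet_of_le f le_rfl, rightJet_succ]
    exact hconv.hasDerivWithinAt_rightDeriv_of_mem_interior (by rwa [hU.interior_eq])

/-- The right derivative of `f⁽ᵐ⁾` is monotone, hence differentiable almost everywhere. At such
points it is continuous, so `f⁽ᵐ⁾` has a two-sided derivative there. -/
theorem ae_hasDerivAt_rightJet {U : Set ℝ} (hU : IsOpen U) {f : ℝ → ℝ} {m : ℕ}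
    (hf : ContDiffOn ℝ m f U) (hconv : ConvexOn ℝ U (iteratedDeriv m f)) :
    ∀ᵐ t : ℝ, t ∈ U → ∀ k ≤ m + 1, HasDerivAt (rightJet m f k) (rightJet m f (k + 1) t) t := by
  have hmono := hconv.monotoneOn_rightDeriv
  rw [hU.interior_eq] at hmono
  filter_upwards [hmono.ae_differentiableWithinAt_of_mem] with t h ht k hk
  have hd := (h ht).differentiableAt (hU.mem_nhds ht)
  rcases hk.lt_or_eq with hk | rfl
  · rcases (Nat.lt_succ_iff.1 hk).lt_or_eq with hk | rfl
    · rw [rightJet_of_le f hk.le, rightJet_of_le f hk, iteratedDeriv_succ]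
      exact (ContDiffOn.differentiableAt_iteratedDeriv hU hf hk ht).hasDerivAt
    · rw [rightJet_of_le f le_rfl, rightJet_succ]
      exact hconv.hasDerivAt_of_continuousAt_rightDeriv hU ht hd.continuousAt
  · rw [rightJet_succ, rightJet_add_two]
    exact hd.hasDerivAt

/-- The derivative of `G` lives on a conull subset of `U`, where it agrees with the right derivative
`ρ`; it inherits the derivative of `ρ` within that set. Conull sets meet every interval in `U`,
which gives the accumulation points required by `partialDeriv`. -/
theorem ae_hasDerivWithinAt_deriv {U : Set ℝ} (hU : IsOpen U) {G ρ ρ' : ℝ → ℝ}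
    (h1 : ∀ t ∈ U, HasDerivWithinAt G (ρ t) (Ioi t) t)
    (h2 : ∀ᵐ t : ℝ, t ∈ U → DifferentiableAt ℝ G t)
    (h3 : ∀ᵐ t : ℝ, t ∈ U → HasDerivAt ρ (ρ' t) t) :
    ∀ᵐ t : ℝ, t ∈ U → DifferentiableAt ℝ G t ∧ deriv G t = ρ t ∧
      AccPt t (𝓟 {s | s ∈ U ∧ DifferentiableAt ℝ G s}) ∧
      HasDerivWithinAt (deriv G) (ρ' t) {s | s ∈ U ∧ DifferentiableAt ℝ G s} t := by
  have heq : ∀ s ∈ {s | s ∈ U ∧ DifferentiableAt ℝ G s}, deriv G s = ρ s := fun s hs =>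
    (uniqueDiffWithinAt_Ioi s).eq_deriv _ hs.2.hasDerivAt.hasDerivWithinAt (h1 s hs.1)
  filter_upwards [h2, h3] with t ht2 ht3 ht
  refine ⟨ht2 ht, heq t ⟨ht, ht2 ht⟩, ?_, ?_⟩
  · rw [accPt_iff_nhds]
    intro V hV
    obtain ⟨l, u, htlu, hsub⟩ := mem_nhds_iff_exists_Ioo_subset.1 (inter_mem hV (hU.mem_nhds ht))
    have hpos : volume (Ioo t u) ≠ 0 := by
      rw [Real.volume_Ioo]; simpa using htlu.2
    obtain ⟨s, hs, hsd⟩ := nonempty_of_measure_ne_zero (μ := volume)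
      (s := Ioo t u ∩ {s | s ∈ U → DifferentiableAt ℝ G s}) (by
        rwa [measure_inter_conull (by simpa [ae_iff, compl_def] using h2)])
    have hsV := hsub ⟨htlu.1.trans hs.1, hs.2⟩
    exact ⟨s, ⟨hsV.1, hsV.2, hsd hsV.2⟩, hs.1.ne'⟩
  · exact ((ht3 ht).hasDerivWithinAt).congr heq (heq t ⟨ht, ht2 ht⟩)

theorem partialDeriv_of_contDiffOn {U : Set ℝ} (hU : IsOpen U) {g : ℝ → ℝ} {m k : ℕ}
    (hg : ContDiffOn ℝ m g U) (hk : k ≤ m) :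
    (partialDeriv U g k).1 = U ∧ EqOn (partialDeriv U g k).2 (iteratedDeriv k g) U := by
  induction k with
  | zero => simp [partialDeriv, EqOn]
  | succ k ih =>
    obtain ⟨h1, h2⟩ := ih (by omega)
    have hd : ∀ t ∈ U, DifferentiableAt ℝ (partialDeriv U g k).2 t := fun t ht =>
      (ContDiffOn.differentiableAt_iteratedDeriv hU hg hk ht).congr_of_eventuallyEq
        (h2.eventuallyEq_of_mem (hU.mem_nhds ht))
    constructor
    · simp only [partialDeriv, h1]
      ext t
      simp only [mem_ofPred_eq, and_iff_left_iff_imp]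
      exact fun ht => ⟨uniqueDiffWithinAt_iff_accPt.1 (hU.uniqueDiffWithinAt ht),
        (hd t ht).differentiableWithinAt⟩
    · intro t ht
      simp only [partialDeriv, h1]
      rw [derivWithin_of_isOpen hU ht, iteratedDeriv_succ,
        (h2.eventuallyEq_of_mem (hU.mem_nhds ht)).deriv_eq]

theorem ae_derivDomain_and_nthDerivOn {U : Set ℝ} (hU : IsOpen U) {g : ℝ → ℝ} {m : ℕ}
    (hg : ContDiffOn ℝ m g U) {ρ ρ' : ℝ → ℝ}
    (h1 : ∀ t ∈ U, HasDerivWithinAt (iteratedDeriv m g) (ρ t) (Ioi t) t)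
    (h2 : ∀ᵐ t : ℝ, t ∈ U → DifferentiableAt ℝ (iteratedDeriv m g) t)
    (h3 : ∀ᵐ t : ℝ, t ∈ U → HasDerivAt ρ (ρ' t) t) :
    ∀ᵐ t : ℝ, t ∈ U → (∀ k ≤ m + 2, t ∈ derivDomain U g k) ∧
      nthDerivOn U g (m + 1) t = ρ t ∧ nthDerivOn U g (m + 2) t = ρ' t := by
  obtain ⟨e1, e2⟩ := partialDeriv_of_contDiffOn hU hg le_rfl
  have hdiff : ∀ t ∈ U, DifferentiableWithinAt ℝ (partialDeriv U g m).2 U t ↔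
      DifferentiableAt ℝ (iteratedDeriv m g) t := fun t ht => by
    exact ⟨fun h => (h.congr e2.symm (e2.symm ht)).differentiableAt (hU.mem_nhds ht),
      fun h => h.differentiableWithinAt.congr e2 (e2 ht)⟩
  have e3 : (partialDeriv U g (m + 1)).1 =
      {s | s ∈ U ∧ DifferentiableAt ℝ (iteratedDeriv m g) s} := by
    simp only [partialDeriv, e1]
    ext t
    simp only [mem_ofPred_eq]
    constructor
    · rintro ⟨ht, -, hd⟩
      exact ⟨ht, (hdiff t ht).1 hd⟩
    · rintro ⟨ht, hd⟩
      exact ⟨ht, uniqueDiffWithinAt_iff_accPt.1 (hU.uniqueDiffWithinAt ht), (hdiff t ht).2 hd⟩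
  have e4 : EqOn (partialDeriv U g (m + 1)).2 (deriv (iteratedDeriv m g)) U := by
    intro t ht
    simp only [partialDeriv, e1]
    rw [derivWithin_of_isOpen hU ht, (e2.eventuallyEq_of_mem (hU.mem_nhds ht)).deriv_eq]
  filter_upwards [ae_hasDerivWithinAt_deriv hU h1 h2 h3] with t h ht
  obtain ⟨hd, heq, hacc, hder⟩ := h ht
  have hder' : HasDerivWithinAt (partialDeriv U g (m + 1)).2 (ρ' t)
      (partialDeriv U g (m + 1)).1 t := by
    rw [e3]
    exact hder.congr (fun s hs => e4 hs.1) (e4 ht)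
  refine ⟨fun k hk => ?_, ?_, ?_⟩
  · rcases Nat.lt_or_ge m k with hmk | hmk
    · obtain rfl | rfl : k = m + 1 ∨ k = m + 2 := by omega
      · rw [derivDomain, e3]; exact ⟨ht, hd⟩
      · rw [derivDomain, partialDeriv]
        exact ⟨by rw [e3]; exact ⟨ht, hd⟩, by rw [e3]; exact hacc, hder'.differentiableWithinAt⟩
    · rw [derivDomain, (partialDeriv_of_contDiffOn hU hg hmk).1]; exact ht
  · rw [nthDerivOn, e4 ht, heq]
  · rw [nthDerivOn, partialDeriv]
    exact hder'.derivWithin (uniqueDiffWithinAt_iff_accPt.2 (by rw [e3]; exact hacc))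

theorem hasDerivWithinAt_iteratedDeriv_mul {U : Set ℝ} (hU : IsOpen U) {f : ℝ → ℝ} {m : ℕ}
    (hf : ContDiffOn ℝ m f U) (hconv : ConvexOn ℝ U (iteratedDeriv m f)) (N : ℝ[X]) {t : ℝ}
    (ht : t ∈ U) : HasDerivWithinAt (iteratedDeriv m fun t => f t * N.eval t)
      (leibniz (m + 1) (rightJet m f) N t) (Ioi t) t := by
  have heq := iteratedDeriv_mul_eq_leibniz hU hf (fun k hk => rightJet_of_le f hk) N le_rfl
  have h1 := hasDerivWithinAt_leibniz N (F := rightJet m f)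
    fun k hk => hasDerivWithinAt_rightJet hU hf hconv ht hk
  exact h1.congr_of_eventuallyEq
    ((heq.eventuallyEq_of_mem (hU.mem_nhds ht)).filter_mono nhdsWithin_le_nhds) (heq ht)

/-- Translates conditions 8 and 9, phrased with partially defined derivatives, into statements about
`leibniz` and `rightJet`. -/
theorem ae_nthDerivOn_mul {U : Set ℝ} (hU : IsOpen U) {f : ℝ → ℝ} {m : ℕ}
    (hf : ContDiffOn ℝ m f U) (hconv : ConvexOn ℝ U (iteratedDeriv m f)) (N : ℝ[X]) :
    ∀ᵐ t : ℝ, t ∈ U → ∀ k ≤ m + 2, t ∈ derivDomain U (fun t => f t * N.eval t) k ∧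
      nthDerivOn U (fun t => f t * N.eval t) k t = leibniz k (rightJet m f) N t := by
  have hg : ContDiffOn ℝ m (fun t => f t * N.eval t) U := hf.mul (contDiff_polynomial N).contDiffOn
  have heq := fun {k} (hk : k ≤ m) =>
    iteratedDeriv_mul_eq_leibniz hU hf (fun k hk => rightJet_of_le f hk) N hk
  have h0 := ae_hasDerivAt_rightJet hU hf hconv
  filter_upwards [ae_derivDomain_and_nthDerivOn hU hg (ρ := leibniz (m + 1) (rightJet m f) N)
    (ρ' := leibniz (m + 2) (rightJet m f) N)
    (fun t ht => hasDerivWithinAt_iteratedDeriv_mul hU hf hconv N ht)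
    (by
      filter_upwards [h0] with t h ht
      have := hasDerivWithinAt_univ.1 (hasDerivWithinAt_leibniz N (j := m) (S := univ) (t := t)
        fun k hk => (h ht k (by omega)).hasDerivWithinAt)
      exact this.differentiableAt.congr_of_eventuallyEq
        ((heq le_rfl).eventuallyEq_of_mem (hU.mem_nhds ht)))
    (by
      filter_upwards [h0] with t h ht
      exact hasDerivWithinAt_univ.1 (hasDerivWithinAt_leibniz N
        fun k hk => (h ht k hk).hasDerivWithinAt))] with t h ht k hk
  obtain ⟨ha, hb, hc⟩ := h ht
  refine ⟨ha k hk, ?_⟩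
  rcases Nat.lt_or_ge m k with hmk | hmk
  · obtain rfl | rfl : k = m + 1 ∨ k = m + 2 := by omega
    · exact hb
    · exact hc
  · rw [nthDerivOn, (partialDeriv_of_contDiffOn hU hg hmk).2 ht, heq hmk ht]

/-! ### Convexity of `(f N)⁽ᵐ⁾` against the almost everywhere sign. -/

theorem exists_lipschitzOnWith_mul {S : Set ℝ} (hS : IsCompact S) {g h : ℝ → ℝ}
    (hg : ∃ K, LipschitzOnWith K g S) (hh : ∃ K, LipschitzOnWith K h S) :
    ∃ K, LipschitzOnWith K (fun t => g t * h t) S := by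
  obtain ⟨K, hK⟩ := hg
  obtain ⟨L, hL⟩ := hh
  obtain ⟨A, hA⟩ := hS.exists_bound_of_continuousOn hK.continuousOn
  obtain ⟨B, hB⟩ := hS.exists_bound_of_continuousOn hL.continuousOn
  refine ⟨Real.toNNReal (|A| * L + |B| * K), LipschitzOnWith.of_dist_le_mul fun x hx y hy => ?_⟩
  rw [Real.coe_toNNReal _ (by positivity), Real.dist_eq, Real.dist_eq]
  have h1 := hK.dist_le_mul x hx y hy
  have h2 := hL.dist_le_mul x hx y hy
  rw [Real.dist_eq, Real.dist_eq] at h1 h2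
  have h3 : |g x| ≤ |A| := (hA x hx).trans (le_abs_self A)
  have h4 : |h y| ≤ |B| := (hB y hy).trans (le_abs_self B)
  calc |g x * h x - g y * h y| = |g x * (h x - h y) + h y * (g x - g y)| := by congr 1; ring
    _ ≤ |g x| * |h x - h y| + |h y| * |g x - g y| := by
      rw [← abs_mul, ← abs_mul]; exact abs_add_le _ _
    _ ≤ |A| * (L * |x - y|) + |B| * (K * |x - y|) := by gcongr
    _ = _ := by ring

theorem exists_lipschitzOnWith_polynomial (N : ℝ[X]) (x y : ℝ) :
    ∃ K, LipschitzOnWith K (fun t => N.eval t) (Icc x y) :=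
  (contDiff_polynomial N (k := 1)).contDiffOn.exists_lipschitzOnWith (by simp) (convex_Icc x y)
    isCompact_Icc

theorem exists_lipschitzOnWith_leibniz {x y : ℝ} {j : ℕ} {F : ℕ → ℝ → ℝ} (N : ℝ[X])
    (hF : ∀ k ≤ j, ∃ K, LipschitzOnWith K (F k) (Icc x y)) :
    ∃ K, LipschitzOnWith K (leibniz j F N) (Icc x y) := by
  induction j generalizing F N with
  | zero =>
    exact exists_lipschitzOnWith_mul isCompact_Icc (hF 0 le_rfl)
      (exists_lipschitzOnWith_polynomial N x y)
  | succ j ih =>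
    obtain ⟨K, hK⟩ := ih (F := fun k => F (k + 1)) N fun k hk => hF (k + 1) (by omega)
    obtain ⟨L, hL⟩ := ih (derivative N) fun k hk => hF k (by omega)
    exact ⟨_, hK.add hL⟩

/-- The top function `F j` enters only through `F j * N`. In the application it is the right
derivative of `f⁽ᵐ⁾`, which may jump, while the lower ones are Lipschitz. -/
theorem exists_lipschitzOnWith_leibniz_sub {x y : ℝ} {j : ℕ} {F : ℕ → ℝ → ℝ} (N : ℝ[X])
    (hF : ∀ k < j, ∃ K, LipschitzOnWith K (F k) (Icc x y)) :
    ∃ K, LipschitzOnWith K (fun t => leibniz j F N t - F j t * N.eval t) (Icc x y) := by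
  induction j generalizing F N with
  | zero => exact ⟨0, by simp [leibniz]⟩
  | succ j ih =>
    obtain ⟨K, hK⟩ := ih (F := fun k => F (k + 1)) N fun k hk => hF (k + 1) (by omega)
    obtain ⟨L, hL⟩ := exists_lipschitzOnWith_leibniz (j := j) (F := F) (derivative N)
      fun k hk => hF k (by omega)
    refine ⟨K + L, ?_⟩
    have h : (fun t => leibniz (j + 1) F N t - F (j + 1) t * N.eval t) = fun t =>
        leibniz j (fun k => F (k + 1)) N t - F (j + 1) t * N.eval t +
          leibniz j F (derivative N) t := by
      funext t; simp only [leibniz]; ring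
    rw [h]
    exact hK.add hL

theorem exists_lipschitzOnWith_rightJet {U : Set ℝ} (hU : IsOpen U) {f : ℝ → ℝ} {m : ℕ}
    (hf : ContDiffOn ℝ m f U) (hconv : ConvexOn ℝ U (iteratedDeriv m f)) {x y : ℝ}
    (hxy : Icc x y ⊆ U) {k : ℕ} (hk : k ≤ m) :
    ∃ K, LipschitzOnWith K (rightJet m f k) (Icc x y) := by
  rw [rightJet_of_le f hk]
  rcases hk.lt_or_eq with hk | rfl
  · have h1 : ContDiffOn ℝ (1 : ℕ) (iteratedDeriv k f) U :=
      ContDiffOn.iteratedDeriv_of_isOpen hU (hf.of_le (by norm_cast; omega))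
    exact (h1.mono hxy).exists_lipschitzOnWith (by simp) (convex_Icc x y) isCompact_Icc
  · exact ((hconv.locallyLipschitzOn hU).mono hxy).exists_lipschitzOnWith_of_compact isCompact_Icc

/-- `G` is the integral of its monotone right derivative, so `ρ y` separates the slopes to the left
of `y` from those to the right. -/
theorem convexOn_of_monotoneOn_rightDeriv {U : Set ℝ} (hU : OrdConnected U) {G ρ : ℝ → ℝ}
    (hG : ContinuousOn G U) (hρ : MonotoneOn ρ U)
    (h : ∀ t ∈ U, HasDerivWithinAt G (ρ t) (Ioi t) t) : ConvexOn ℝ U G := by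
  have hint : ∀ x ∈ U, ∀ y ∈ U, x ≤ y →
      IntervalIntegrable ρ volume x y ∧ ∫ t in x..y, ρ t = G y - G x := by
    intro x hx y hy hxy
    have hsub : Icc x y ⊆ U := hU.out hx hy
    have hi : IntervalIntegrable ρ volume x y :=
      (hρ.mono (by rwa [uIcc_of_le hxy])).intervalIntegrable
    exact ⟨hi, intervalIntegral.integral_eq_sub_of_hasDeriv_right_of_le hxy (hG.mono hsub)
      (fun t ht => h t (hsub (Ioo_subset_Icc_self ht))) hi⟩
  refine convexOn_of_slope_mono_adjacent hU.convex fun {x y z} hx hz hxy hyz => ?_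
  have hy : y ∈ U := hU.out hx hz ⟨hxy.le, hyz.le⟩
  obtain ⟨i1, e1⟩ := hint x hx y hy hxy.le
  obtain ⟨i2, e2⟩ := hint y hy z hz hyz.le
  have h1 : G y - G x ≤ ρ y * (y - x) := by
    rw [← e1]
    refine (intervalIntegral.integral_mono_on hxy.le i1 intervalIntegrable_const
      fun t ht => hρ (hU.out hx hy ht) hy ht.2).trans ?_
    simp [mul_comm]
  have h2 : ρ y * (z - y) ≤ G z - G y := by
    rw [← e2]
    refine le_trans ?_ (intervalIntegral.integral_mono_on hyz.le intervalIntegrable_const i2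
      fun t ht => hρ hy (hU.out hy hz ht) ht.1)
    simp [mul_comm]
  have h3 : (G y - G x) / (y - x) ≤ ρ y := by rwa [div_le_iff₀ (by linarith)]
  exact h3.trans (by rwa [le_div_iff₀ (by linarith)])

/-- A monotone function grows at least by the integral of its derivative. Adding `C * t` makes `ρ`
monotone, that is, rules out a negative singular part; the added growth `C * (y - x)` then cancels.
-/
theorem le_of_monotoneOn_add_mul {x y C : ℝ} (hxy : x ≤ y) {ρ ρ' : ℝ → ℝ}
    (hm : MonotoneOn (fun t => ρ t + C * t) (Icc x y))
    (hd : ∀ᵐ t : ℝ, t ∈ Icc x y → HasDerivAt ρ (ρ' t) t ∧ 0 ≤ ρ' t) : ρ x ≤ ρ y := by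
  rw [← uIcc_of_le hxy] at hm
  have h1 := hm.intervalIntegral_deriv_mem_uIcc
  have hle : ρ x + C * x ≤ ρ y + C * y := hm (by simp) (by simp) hxy
  rw [uIcc_of_le (by linarith)] at h1
  have h2 : C * (y - x) ≤ ∫ t in x..y, deriv (fun t => ρ t + C * t) t := by
    have h3 : ∫ t in x..y, C ≤ ∫ t in x..y, deriv (fun t => ρ t + C * t) t := by
      refine intervalIntegral.integral_mono_ae_restrict hxy intervalIntegrable_const
        hm.intervalIntegrable_deriv ?_
      rw [Filter.EventuallyLE, ae_restrict_iff' measurableSet_Icc]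
      filter_upwards [hd] with t ht hmem
      obtain ⟨h4, h5⟩ := ht hmem
      rw [(h4.fun_add ((hasDerivAt_id' t).const_mul C)).deriv]
      linarith
    simpa [mul_comm] using h3
  linarith [h1.2]

/-- If `f⁽ᵐ⁾` is convex and the second derivative of `(f N)⁽ᵐ⁾`, with `N ≥ 0`, is nonnegative almost
everywhere, then `(f N)⁽ᵐ⁾` is convex. -/
theorem convexOn_iteratedDeriv_mul {U : Set ℝ} (hU : IsOpen U) (hUc : OrdConnected U) {f : ℝ → ℝ}
    {m : ℕ} (hf : ContDiffOn ℝ m f U) (hconv : ConvexOn ℝ U (iteratedDeriv m f)) {N : ℝ[X]}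
    (hN : ∀ t, 0 ≤ N.eval t)
    (hpos : ∀ᵐ t : ℝ, t ∈ U → 0 ≤ leibniz (m + 2) (rightJet m f) N t) :
    ConvexOn ℝ U (iteratedDeriv m fun t => f t * N.eval t) := by
  have hg : ContDiffOn ℝ m (fun t => f t * N.eval t) U := hf.mul (contDiff_polynomial N).contDiffOn
  have hρm : MonotoneOn (rightJet m f (m + 1)) U := by
    have := hconv.monotoneOn_rightDeriv
    rwa [hU.interior_eq, ← rightJet_succ] at this
  refine convexOn_of_monotoneOn_rightDeriv hUc (ρ := leibniz (m + 1) (rightJet m f) N) ?_ ?_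
    fun t ht => hasDerivWithinAt_iteratedDeriv_mul hU hf hconv N ht
  · have h1 : ContDiffOn ℝ (0 : ℕ) (iteratedDeriv m fun t => f t * N.eval t) U :=
      ContDiffOn.iteratedDeriv_of_isOpen hU (by simpa using hg)
    exact h1.continuousOn
  · intro x hx y hy hxy
    have hsub : Icc x y ⊆ U := hUc.out hx hy
    obtain ⟨K, hK⟩ := exists_lipschitzOnWith_leibniz_sub (j := m + 1) N
      fun k hk => exists_lipschitzOnWith_rightJet hU hf hconv hsub (Nat.lt_succ_iff.1 hk)
    obtain ⟨L, hL⟩ := exists_lipschitzOnWith_polynomial N x y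
    set ρ := rightJet m f (m + 1)
    set B := max |ρ x| |ρ y|
    -- The increment of `ρ * N` from `s` to `t` is `N t * (ρ t - ρ s) ≥ 0` plus `ρ s * (N t - N s)`,
    -- which is at least `-B * L * (t - s)`; the other Leibniz terms cost `K * (t - s)`.
    refine le_of_monotoneOn_add_mul hxy (C := K + B * L)
      (ρ' := leibniz (m + 2) (rightJet m f) N) ?_ ?_
    · intro s hs t ht hst
      have h1 := hK.dist_le_mul t ht s hs
      have h2 := hL.dist_le_mul t ht s hs
      rw [Real.dist_eq, Real.dist_eq, abs_of_nonneg (sub_nonneg.2 hst)] at h1 h2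
      have hB : |ρ s| ≤ B := by
        have h3 := hρm hx (hsub hs) hs.1
        have h4 := hρm (hsub hs) hy hs.2
        rw [abs_le]
        constructor
        · linarith [neg_abs_le (ρ x), le_max_left |ρ x| |ρ y|]
        · linarith [le_abs_self (ρ y), le_max_right |ρ x| |ρ y|]
      have h5 : 0 ≤ N.eval t * (ρ t - ρ s) :=
        mul_nonneg (hN t) (sub_nonneg.2 (hρm (hsub hs) (hsub ht) hst))
      have h6 : |ρ s * (N.eval t - N.eval s)| ≤ B * (L * (t - s)) := by
        rw [abs_mul]
        exact mul_le_mul hB h2 (abs_nonneg _) ((abs_nonneg _).trans hB)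
      have h7 := (abs_le.1 h1).1
      have h8 := (abs_le.1 h6).1
      simp only
      nlinarith
    · filter_upwards [ae_hasDerivAt_rightJet hU hf hconv, hpos] with t h1 h2 ht
      exact ⟨hasDerivWithinAt_univ.1 (hasDerivWithinAt_leibniz N
        fun k hk => (h1 (hsub ht) k hk).hasDerivWithinAt), h2 (hsub ht)⟩

theorem ae_leibniz_nonneg_of_convexOn {U : Set ℝ} (hU : IsOpen U) {f : ℝ → ℝ} {m : ℕ}
    (hf : ContDiffOn ℝ m f U) (hconv : ConvexOn ℝ U (iteratedDeriv m f)) {N : ℝ[X]}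
    (hN : ConvexOn ℝ U (iteratedDeriv m fun t => f t * N.eval t)) :
    ∀ᵐ t : ℝ, t ∈ U → 0 ≤ leibniz (m + 2) (rightJet m f) N t := by
  have hm := hN.monotoneOn_rightDeriv
  rw [hU.interior_eq] at hm
  filter_upwards [ae_hasDerivAt_rightJet hU hf hconv] with t h ht
  have h1 : HasDerivAt (leibniz (m + 1) (rightJet m f) N)
      (leibniz (m + 2) (rightJet m f) N t) t := hasDerivWithinAt_univ.1
    (hasDerivWithinAt_leibniz N fun k hk => (h ht k hk).hasDerivWithinAt)
  have h2 : MonotoneOn (leibniz (m + 1) (rightJet m f) N) U := hm.congr fun s hs =>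
    (hasDerivWithinAt_iteratedDeriv_mul hU hf hconv N hs).derivWithin (uniqueDiffWithinAt_Ioi s)
  rw [← h1.deriv, ← derivWithin_of_isOpen hU ht]
  exact h2.derivWithin_nonneg

/-! ### Ordered tuples against finite sets, and complex against real `q`. -/

theorem divDiffSorted_of_strictMono {k : ℕ} {x : Fin (k + 1) → ℝ} (hx : StrictMono x)
    (g : ℝ → ℝ) : divDiffSorted g k x = dd (Finset.univ.image x) g := by
  induction k with
  | zero => simp [divDiffSorted, dd]
  | succ k ih =>
    have h0 : x 0 ≠ x (Fin.last (k + 1)) := (hx (Fin.last_pos)).ne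
    set mid := Finset.univ.image fun i : Fin k => x i.succ.castSucc with hmid
    have e1 : Finset.univ.image (fun i : Fin (k + 1) => x i.castSucc) = insert (x 0) mid := by
      ext t; simp [hmid, Fin.exists_fin_succ, eq_comm]
    have e2 : Finset.univ.image (fun i : Fin (k + 1) => x i.succ) =
        insert (x (Fin.last (k + 1))) mid := by
      ext t
      simp [hmid, Fin.exists_fin_succ', or_comm, eq_comm]
    have e3 : Finset.univ.image x = insert (x 0) (insert (x (Fin.last (k + 1))) mid) := by
      rw [← e2]; ext t; simp [Fin.exists_fin_succ, eq_comm]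
    have n1 : x 0 ∉ mid := by
      simp only [hmid, Finset.mem_image, Finset.mem_univ, true_and, not_exists]
      intro i h
      have := hx.injective h
      simp [Fin.ext_iff] at this
    have n2 : x (Fin.last (k + 1)) ∉ mid := by
      simp only [hmid, Finset.mem_image, Finset.mem_univ, true_and, not_exists]
      intro i h
      have := congrArg Fin.val (hx.injective h)
      simp at this
      omega
    rw [divDiffSorted, if_neg h0, ih (fun i j hij => hx (Fin.castSucc_lt_castSucc_iff.2 hij)),
      ih (fun i j hij => hx (Fin.succ_lt_succ_iff.2 hij)), e1, e2, ← dd_recursion n1 n2 h0, e3,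
      mul_div_cancel_left₀ _ (sub_ne_zero.2 h0)]

theorem divDiff_of_injective {k : ℕ} {x : Fin (k + 1) → ℝ} (hx : Function.Injective x)
    (g : ℝ → ℝ) : divDiff g x = dd (Finset.univ.image x) g := by
  rw [divDiff, divDiffSorted_of_strictMono
    ((Tuple.monotone_sort x).strictMono_of_injective (hx.comp (Equiv.injective _)))]
  congr 1
  ext t
  simp only [Finset.mem_image, Finset.mem_univ, true_and, Function.comp_apply]
  exact ((Tuple.sort x).surjective.exists (p := fun i => x i = t)).symm

/-- Divided differences of order `2 n` of `f q²` at distinct nodes are nonnegative. -/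
def DivDiffSqNonneg (n : ℕ) (U : Set ℝ) (f : ℝ → ℝ) : Prop :=
  ∀ s : Finset ℝ, (s : Set ℝ) ⊆ U → s.card = 2 * n + 1 → ∀ q : ℝ[X], q.natDegree ≤ n - 1 →
    0 ≤ dd s fun t => f t * (q.eval t) ^ 2

theorem forall_strictMono_divDiff_nonneg_iff (n : ℕ) (U : Set ℝ) (g : ℝ → ℝ) :
    (∀ x : Fin (2 * n + 1) → ℝ, StrictMono x → (∀ i, x i ∈ U) → 0 ≤ divDiff g x) ↔
      ∀ s : Finset ℝ, (s : Set ℝ) ⊆ U → s.card = 2 * n + 1 → 0 ≤ dd s g := by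
  constructor
  · intro h s hs hc
    have h1 := h (s.orderEmbOfFin hc) (s.orderEmbOfFin hc).strictMono
      fun i => hs (s.orderEmbOfFin_mem hc i)
    rwa [divDiff_of_injective (s.orderEmbOfFin hc).injective, Finset.image_orderEmbOfFin_univ] at h1
  · intro h x hx hxU
    rw [divDiff_of_injective hx.injective]
    refine h _ ?_ (by rw [Finset.card_image_of_injective _ hx.injective]; simp)
    intro t ht
    simp only [Finset.coe_image, Finset.coe_univ, image_univ, mem_range] at ht
    obtain ⟨i, rfl⟩ := ht
    exact hxU i

theorem forall_divDiff_sq_nonneg_iff (n : ℕ) (U : Set ℝ) (f : ℝ → ℝ) :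
    (∀ x : Fin (2 * n + 1) → ℝ, StrictMono x → (∀ i, x i ∈ U) → ∀ q : ℝ[X], q.natDegree ≤ n - 1 →
      0 ≤ divDiff (fun t => f t * (q.eval t) ^ 2) x) ↔ DivDiffSqNonneg n U f := by
  constructor
  · intro h s hs hc q hq
    exact (forall_strictMono_divDiff_nonneg_iff n U _).1 (fun x hx hxU => h x hx hxU q hq) s hs hc
  · intro h x hx hxU q hq
    exact (forall_strictMono_divDiff_nonneg_iff n U _).2 (fun s hs hc => h s hs hc q hq) x hx hxU

/-- The real part of a complex polynomial, as a real polynomial. -/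
noncomputable def rePart (q : ℂ[X]) : ℝ[X] :=
  ∑ i ∈ Finset.range (q.natDegree + 1), monomial i (q.coeff i).re

/-- The imaginary part of a complex polynomial, as a real polynomial. -/
noncomputable def imPart (q : ℂ[X]) : ℝ[X] :=
  ∑ i ∈ Finset.range (q.natDegree + 1), monomial i (q.coeff i).im

theorem natDegree_rePart_le (q : ℂ[X]) : (rePart q).natDegree ≤ q.natDegree :=
  natDegree_sum_le_of_forall_le _ _ fun _ hi =>
    (natDegree_monomial_le _).trans (Nat.lt_succ_iff.1 (Finset.mem_range.1 hi))

theorem natDegree_imPart_le (q : ℂ[X]) : (imPart q).natDegree ≤ q.natDegree :=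
  natDegree_sum_le_of_forall_le _ _ fun _ hi =>
    (natDegree_monomial_le _).trans (Nat.lt_succ_iff.1 (Finset.mem_range.1 hi))

theorem eval_rePart (q : ℂ[X]) (t : ℝ) : (rePart q).eval t = (q.eval (t : ℂ)).re := by
  rw [rePart, eval_finsetSum]
  conv_rhs => rw [eval_eq_sum_range, Complex.re_sum]
  refine Finset.sum_congr rfl fun i _ => ?_
  rw [eval_monomial, ← Complex.ofReal_pow, Complex.re_mul_ofReal]

theorem eval_imPart (q : ℂ[X]) (t : ℝ) : (imPart q).eval t = (q.eval (t : ℂ)).im := by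
  rw [imPart, eval_finsetSum]
  conv_rhs => rw [eval_eq_sum_range, Complex.im_sum]
  refine Finset.sum_congr rfl fun i _ => ?_
  rw [eval_monomial, ← Complex.ofReal_pow, Complex.im_mul_ofReal]

theorem mulNorm_eq (f : ℝ → ℝ) (q : ℂ[X]) :
    mulNorm f q = fun t => f t * (rePart q ^ 2 + imPart q ^ 2).eval t := by
  funext t
  rw [mulNorm, normPoly_eval_ofReal, Complex.ofReal_re, eval_add, eval_pow, eval_pow, eval_rePart,
    eval_imPart, ← Complex.normSq_eq_norm_sq, Complex.normSq_apply]
  ring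

theorem mulNorm_map_ofReal (f : ℝ → ℝ) (q : ℝ[X]) :
    mulNorm f (q.map Complex.ofRealHom) = fun t => f t * (q ^ 2).eval t := by
  funext t
  have h : (q.map Complex.ofRealHom).eval (t : ℂ) = ((q.eval t : ℝ) : ℂ) := by
    rw [eval_map]
    exact eval₂_at_apply Complex.ofRealHom t
  rw [mulNorm, normPoly_eval_ofReal, Complex.ofReal_re, h, Complex.norm_real, Real.norm_eq_abs,
    sq_abs, eval_pow]

/-- Real polynomials are complex ones; conversely `N(q)` is the sum of the squares of `rePart q` and
`imPart q`, and divided differences are additive. -/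
theorem forall_divDiff_mulNorm_nonneg_iff (n : ℕ) (U : Set ℝ) (f : ℝ → ℝ) :
    (∀ x : Fin (2 * n + 1) → ℝ, StrictMono x → (∀ i, x i ∈ U) → ∀ q : ℂ[X], q.natDegree ≤ n - 1 →
      0 ≤ divDiff (mulNorm f q) x) ↔ DivDiffSqNonneg n U f := by
  constructor
  · intro h s hs hc q hq
    have h1 := (forall_strictMono_divDiff_nonneg_iff n U _).1 (fun x hx hxU =>
      h x hx hxU (q.map Complex.ofRealHom) (natDegree_map_le.trans hq)) s hs hc
    rw [mulNorm_map_ofReal] at h1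
    simpa using h1
  · intro h x hx hxU q hq
    refine (forall_strictMono_divDiff_nonneg_iff n U _).2 (fun s hs hc => ?_) x hx hxU
    rw [mulNorm_eq]
    have h1 := h s hs hc (rePart q) ((natDegree_rePart_le q).trans hq)
    have h2 := h s hs hc (imPart q) ((natDegree_imPart_le q).trans hq)
    have h3 := add_nonneg h1 h2
    rw [← dd_add] at h3
    simpa [mul_add] using h3

theorem DivDiffSqNonneg.contDiffOn_and_convexOn {n : ℕ} (hn : 1 ≤ n) {U : Set ℝ} (hU : IsOpen U)
    (hUc : OrdConnected U) {f : ℝ → ℝ} (h : DivDiffSqNonneg n U f) :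
    ContDiffOn ℝ (2 * n - 2 : ℕ) f U ∧ ConvexOn ℝ U (iteratedDeriv (2 * n - 2) f) := by
  refine contDiffOn_and_convexOn_of_dd_nonneg hUc hU fun s hs hc => ?_
  simpa using h s hs (by omega) 1 (by simp)

theorem DivDiffSqNonneg.convexOn_iteratedDeriv_mulNorm {n : ℕ} (hn : 1 ≤ n) {U : Set ℝ}
    (hU : IsOpen U) (hUc : OrdConnected U) {f : ℝ → ℝ} (h : DivDiffSqNonneg n U f) {q : ℂ[X]}
    (hq : q.natDegree ≤ n - 1) : ConvexOn ℝ U (iteratedDeriv (2 * n - 2) (mulNorm f q)) := by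
  refine (contDiffOn_and_convexOn_of_dd_nonneg hUc hU fun s hs hc => ?_).2
  exact (forall_strictMono_divDiff_nonneg_iff n U _).1 (fun x hx hxU =>
    (forall_divDiff_mulNorm_nonneg_iff n U f).2 h x hx hxU q hq) s hs (by omega)

/-! ### Hankel matrices. -/

theorem posSemidef_real_iff {n : ℕ} {M : Matrix (Fin n) (Fin n) ℝ} (hM : ∀ i j, M i j = M j i) :
    M.PosSemidef ↔ ∀ v : Fin n → ℝ, 0 ≤ ∑ i, ∑ j, v i * v j * M i j := by
  have hH : M.IsHermitian := by
    ext i j; simp [Matrix.conjTranspose_apply, hM i j]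
  have h : ∀ v : Fin n → ℝ, star v ⬝ᵥ M.mulVec v = ∑ i, ∑ j, v i * v j * M i j := fun v => by
    simp only [dotProduct, Matrix.mulVec, Finset.mul_sum, Pi.star_apply, star_trivial]
    exact Finset.sum_congr rfl fun i _ => Finset.sum_congr rfl fun j _ => by ring
  rw [Matrix.posSemidef_iff_dotProduct_mulVec]
  simp only [h, hH, true_and]

/-- The Hankel quadratic form is nonnegative iff it is so on squares of rational polynomials. -/
theorem forall_leibniz_sq_nonneg_iff {n : ℕ} (hn : 1 ≤ n) (F : ℕ → ℝ → ℝ) (t : ℝ) :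
    (Matrix.of fun i j : Fin n => F ((i + 1) + (j + 1)) t /
      (((i : ℕ) + 1) + ((j : ℕ) + 1)).factorial).PosSemidef ↔
    ∀ q : ℝ[X], q.natDegree ≤ n - 1 → 0 ≤ leibniz (2 * n) F (q ^ 2) t := by
  rw [posSemidef_real_iff fun i j => by
    simp only [Matrix.of_apply]; rw [add_comm ((i : ℕ) + 1)]]
  constructor
  · intro h q hq
    rw [leibniz_sq_eq_sum hn F hq]
    exact mul_nonneg (by positivity) (h fun i => (taylor t q).coeff (i.rev : ℕ))
  · intro h v
    set r : ℝ[X] := ∑ i : Fin n, monomial (i.rev : ℕ) (v i) with hr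
    have hdeg : r.natDegree ≤ n - 1 := natDegree_sum_le_of_forall_le _ _ fun i _ =>
      (natDegree_monomial_le _).trans (by omega)
    have hcoeff : ∀ i : Fin n, r.coeff (i.rev : ℕ) = v i := by
      intro i
      rw [hr, finsetSum_coeff, Finset.sum_eq_single i]
      · simp
      · intro j _ hji
        rw [coeff_monomial, if_neg]
        intro h
        exact hji (Fin.rev_injective (Fin.ext h))
      · simp
    -- Shifting by `-t` yields a polynomial whose Taylor expansion at `t` is `r`, with the
    -- prescribed vector as reversed coefficients.
    have h1 := h (taylor (-t) r) (by rwa [natDegree_taylor])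
    rw [leibniz_sq_eq_sum hn F (by rwa [natDegree_taylor]), taylor_taylor, add_neg_cancel,
      taylor_zero] at h1
    simp only [hcoeff] at h1
    exact nonneg_of_mul_nonneg_right h1 (by positivity)

/-- The form is continuous in the coefficients of `q`, and rational vectors are dense. -/
theorem forall_leibniz_sq_nonneg_of_rat {n : ℕ} (hn : 1 ≤ n) (F : ℕ → ℝ → ℝ) (t : ℝ)
    (h : ∀ q : ℚ[X], q.natDegree ≤ n - 1 →
      0 ≤ leibniz (2 * n) F ((q.map (algebraMap ℚ ℝ)) ^ 2) t) (q : ℝ[X]) (hq : q.natDegree ≤ n - 1) :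
    0 ≤ leibniz (2 * n) F (q ^ 2) t := by
  have hdeg : ∀ {R : Type} [CommRing R] (c : Fin n → R),
      (∑ i : Fin n, monomial (i : ℕ) (c i)).natDegree ≤ n - 1 := fun c =>
    natDegree_sum_le_of_forall_le _ _ fun i _ => (natDegree_monomial_le _).trans (by omega)
  have key : ∀ c : Fin n → ℝ, 0 ≤ leibniz (2 * n) F ((∑ i : Fin n, monomial (i : ℕ) (c i)) ^ 2) t := by
    have hd : DenseRange (fun (c : Fin n → ℚ) (i : Fin n) => ((c i : ℚ) : ℝ)) :=
      DenseRange.piMap fun _ => Rat.denseRange_cast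
    have hcont : Continuous fun c : Fin n → ℝ =>
        leibniz (2 * n) F ((∑ i : Fin n, monomial (i : ℕ) (c i)) ^ 2) t := by
      have hc : ∀ k : ℕ, Continuous fun c : Fin n → ℝ =>
          (taylor t (∑ i : Fin n, monomial (i : ℕ) (c i))).coeff k := by
        intro k
        have : ∀ c : Fin n → ℝ, (taylor t (∑ i : Fin n, monomial (i : ℕ) (c i))).coeff k =
            ∑ i : Fin n, c i * (taylor t (X ^ (i : ℕ) : ℝ[X])).coeff k := by
          intro c
          rw [map_sum, finsetSum_coeff]
          refine Finset.sum_congr rfl fun i _ => ?_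
          rw [← C_mul_X_pow_eq_monomial, taylor_mul, taylor_C, coeff_C_mul]
        simp only [this]
        fun_prop
      simp only [leibniz_sq_eq_sum hn F (hdeg _)]
      fun_prop
    refine fun c => isClosed_property hd (isClosed_le continuous_const hcont) (fun c => ?_) c
    have h1 := h (∑ i : Fin n, monomial (i : ℕ) (c i)) (hdeg c)
    simpa [Polynomial.map_sum] using h1
  have h2 := key fun i => q.coeff i
  rw [← Finset.sum_range fun i => monomial i (q.coeff i),
    ← q.as_sum_range' n (by omega)] at h2
  exact h2

theorem ae_derivDomain_rightJet {U : Set ℝ} (hU : IsOpen U) {f : ℝ → ℝ} {m : ℕ}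
    (hf : ContDiffOn ℝ m f U) (hconv : ConvexOn ℝ U (iteratedDeriv m f)) :
    ∀ᵐ t : ℝ, t ∈ U → ∀ k ≤ m + 2, t ∈ derivDomain U f k ∧
      nthDerivOn U f k t = rightJet m f k t := by
  simpa [leibniz_one] using ae_nthDerivOn_mul hU hf hconv 1

theorem DivDiffSqNonneg.ae_nthDerivOn_mulNorm_nonneg {n : ℕ} (hn : 1 ≤ n) {U : Set ℝ}
    (hU : IsOpen U) (hUc : OrdConnected U) {f : ℝ → ℝ} (h : DivDiffSqNonneg n U f) {q : ℂ[X]}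
    (hq : q.natDegree ≤ n - 1) :
    ∀ᵐ t : ℝ, t ∈ U → t ∈ derivDomain U (mulNorm f q) (2 * n) ∧
      0 ≤ nthDerivOn U (mulNorm f q) (2 * n) t := by
  obtain ⟨hf, hconv⟩ := h.contDiffOn_and_convexOn hn hU hUc
  have h1 := h.convexOn_iteratedDeriv_mulNorm hn hU hUc hq
  rw [mulNorm_eq] at h1 ⊢
  filter_upwards [ae_nthDerivOn_mul hU hf hconv (rePart q ^ 2 + imPart q ^ 2),
    ae_leibniz_nonneg_of_convexOn hU hf hconv h1] with t h2 h3 ht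
  have h4 := h2 ht (2 * n) (by omega)
  refine ⟨h4.1, ?_⟩
  rw [h4.2]
  simpa [show 2 * n - 2 + 2 = 2 * n by omega] using h3 ht

/-- The null set in the hypothesis depends on `q`. Restricting to the countably many rational
polynomials gives one null set, and density recovers all real `q` off it. -/
theorem ae_hankel_posSemidef {n : ℕ} (hn : 1 ≤ n) {U : Set ℝ} (hU : IsOpen U) {f : ℝ → ℝ}
    (hf : ContDiffOn ℝ (2 * n - 2 : ℕ) f U) (hconv : ConvexOn ℝ U (iteratedDeriv (2 * n - 2) f))
    (h : ∀ q : ℂ[X], q.natDegree ≤ n - 1 → ∀ᵐ t : ℝ, t ∈ U →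
      t ∈ derivDomain U (mulNorm f q) (2 * n) ∧ 0 ≤ nthDerivOn U (mulNorm f q) (2 * n) t) :
    ∀ᵐ t : ℝ, t ∈ U → (∀ i j : Fin n, t ∈ derivDomain U f (((i : ℕ) + 1) + ((j : ℕ) + 1))) ∧
      (Matrix.of fun i j : Fin n => nthDerivOn U f (((i : ℕ) + 1) + ((j : ℕ) + 1)) t /
        ((((i : ℕ) + 1) + ((j : ℕ) + 1)).factorial : ℝ)).PosSemidef := by
  have h1 : ∀ᵐ t : ℝ, ∀ q : ℚ[X], q.natDegree ≤ n - 1 → t ∈ U →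
      0 ≤ leibniz (2 * n) (rightJet (2 * n - 2) f) ((q.map (algebraMap ℚ ℝ)) ^ 2) t := by
    have : Countable ℚ[X] := by
      rw [← Cardinal.mk_le_aleph0_iff]
      exact Polynomial.cardinalMk_le_max.trans (by simp)
    rw [ae_all_iff]
    intro q
    by_cases hq : q.natDegree ≤ n - 1
    · have h2 := h ((q.map (algebraMap ℚ ℝ)).map Complex.ofRealHom)
        (natDegree_map_le.trans (natDegree_map_le.trans hq))
      rw [mulNorm_map_ofReal] at h2
      filter_upwards [h2, ae_nthDerivOn_mul hU hf hconv ((q.map (algebraMap ℚ ℝ)) ^ 2)]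
        with t h3 h4 _ ht
      rw [← (h4 ht (2 * n) (by omega)).2]
      exact (h3 ht).2
    · exact Eventually.of_forall fun t h => absurd h hq
  filter_upwards [h1, ae_derivDomain_rightJet hU hf hconv] with t h2 h3 ht
  refine ⟨fun i j => (h3 ht _ (by omega)).1, ?_⟩
  have h4 := (forall_leibniz_sq_nonneg_iff hn (rightJet (2 * n - 2) f) t).2
    fun q hq => forall_leibniz_sq_nonneg_of_rat hn _ t (fun q hq => h2 q hq ht) q hq
  convert h4 using 4 with i j
  rw [(h3 ht ((i : ℕ) + 1 + (j + 1)) (by omega)).2]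

theorem divDiffSqNonneg_of_ae_hankel {n : ℕ} (hn : 1 ≤ n) {U : Set ℝ} (hU : IsOpen U)
    (hUc : OrdConnected U) {f : ℝ → ℝ}
    (hf : ContDiffOn ℝ (2 * n - 2 : ℕ) f U) (hconv : ConvexOn ℝ U (iteratedDeriv (2 * n - 2) f))
    (h : ∀ᵐ t : ℝ, t ∈ U →
      (Matrix.of fun i j : Fin n => nthDerivOn U f (((i : ℕ) + 1) + ((j : ℕ) + 1)) t /
        ((((i : ℕ) + 1) + ((j : ℕ) + 1)).factorial : ℝ)).PosSemidef) :
    DivDiffSqNonneg n U f := by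
  intro s hs hc q hq
  have h1 : ConvexOn ℝ U (iteratedDeriv (2 * n - 2) fun t => f t * (q ^ 2).eval t) := by
    refine convexOn_iteratedDeriv_mul hU hUc hf hconv (fun t => by rw [eval_pow]; positivity) ?_
    filter_upwards [h, ae_derivDomain_rightJet hU hf hconv] with t h2 h3 ht
    rw [show 2 * n - 2 + 2 = 2 * n by omega]
    refine (forall_leibniz_sq_nonneg_iff hn (rightJet (2 * n - 2) f) t).1 ?_ q hq
    convert h2 ht using 4 with i j
    rw [(h3 ht ((i : ℕ) + 1 + (j + 1)) (by omega)).2]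
  have h2 := dd_nonneg_of_convexOn_iteratedDeriv hUc hU
    (hf.mul (contDiff_polynomial (q ^ 2)).contDiffOn) h1 hs (by omega)
  simpa using h2

/-! ### Repeated nodes: divided differences of polynomials and Hermite interpolation. -/

/-- The divided difference of a polynomial at an arbitrary multiset of nodes. -/
noncomputable def polyDD (s : Multiset ℝ) (p : ℝ[X]) : ℝ :=
  (p %ₘ (s.map fun a => X - C a).prod).coeff (s.card - 1)

theorem monic_nodal (s : Multiset ℝ) : (s.map fun a => X - C a).prod.Monic :=
  monic_multisetProd_X_sub_C s

theorem natDegree_nodal (s : Multiset ℝ) : (s.map fun a => X - C a).prod.natDegree = s.card :=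
  natDegree_multiset_prod_X_sub_C_eq_card s

theorem polyDD_add (s : Multiset ℝ) (p q : ℝ[X]) : polyDD s (p + q) = polyDD s p + polyDD s q := by
  rw [polyDD, add_modByMonic, coeff_add]; rfl

theorem polyDD_C_mul (s : Multiset ℝ) (c : ℝ) (p : ℝ[X]) :
    polyDD s (C c * p) = c * polyDD s p := by
  rw [polyDD, ← smul_eq_C_mul, smul_modByMonic, coeff_smul]; rfl

theorem polyDD_sub (s : Multiset ℝ) (p q : ℝ[X]) : polyDD s (p - q) = polyDD s p - polyDD s q := by
  rw [polyDD, sub_modByMonic, coeff_sub]; rfl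

theorem polyDD_sum {ι : Type*} (s : Multiset ℝ) (u : Finset ι) (p : ι → ℝ[X]) :
    polyDD s (∑ i ∈ u, p i) = ∑ i ∈ u, polyDD s (p i) := by
  classical
  induction u using Finset.induction_on with
  | empty => simp [polyDD]
  | insert a u ha ih => rw [Finset.sum_insert ha, Finset.sum_insert ha, polyDD_add, ih]

theorem polyDD_C {s : Multiset ℝ} (hs : 2 ≤ s.card) (c : ℝ) : polyDD s (C c) = 0 := by
  rw [polyDD, (modByMonic_eq_self_iff (monic_nodal s)).2, coeff_C, if_neg (by omega)]
  refine degree_C_le.trans_lt (natDegree_pos_iff_degree_pos.1 ?_)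
  rw [natDegree_nodal]; omega

/-- Dividing `(X - a) p` by `(X - a) M` leaves `(X - a)` times the remainder of `p` modulo `M`;
compare top coefficients. This is `dd_insert_mul` for arbitrary multiplicities. -/
theorem polyDD_cons_mul (a : ℝ) {s : Multiset ℝ} (hs : s ≠ 0) (p : ℝ[X]) :
    polyDD (a ::ₘ s) ((X - C a) * p) = polyDD s p := by
  have hcard : 0 < s.card := Multiset.card_pos.2 hs
  set M := (s.map fun a => X - C a).prod with hM
  have hMm : M.Monic := monic_nodal s
  have h1 : ((X - C a) * p) %ₘ ((X - C a) * M) = (X - C a) * (p %ₘ M) := by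
    refine (div_modByMonic_unique (p /ₘ M) _ ((monic_X_sub_C a).mul hMm) ⟨?_, ?_⟩).2
    · conv_rhs => rw [← modByMonic_add_div p M]
      ring
    · rw [degree_mul, degree_mul]
      have := degree_modByMonic_lt p hMm
      rw [degree_X_sub_C]
      exact WithBot.add_lt_add_left (by simp) this
  have h2 : (p %ₘ M).coeff s.card = 0 := by
    refine coeff_eq_zero_of_degree_lt ?_
    have := degree_modByMonic_lt p hMm
    rwa [degree_eq_natDegree hMm.ne_zero, hM, natDegree_nodal] at this
  rw [polyDD, polyDD, Multiset.map_cons, Multiset.prod_cons, ← hM, h1, Multiset.card_cons,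
    Nat.add_sub_cancel]
  obtain ⟨k, hk⟩ : ∃ k, s.card = k + 1 := ⟨s.card - 1, by omega⟩
  rw [hk] at h2 ⊢
  rw [sub_mul, coeff_sub, coeff_X_mul, coeff_C_mul, h2]
  simp

theorem polyDD_add_mul {s : Multiset ℝ} (hs : s ≠ 0) (t : Multiset ℝ) (p : ℝ[X]) :
    polyDD (s + t) ((t.map fun a => X - C a).prod * p) = polyDD s p := by
  induction t using Multiset.induction_on with
  | empty => simp
  | cons a t ih =>
    rw [Multiset.map_cons, Multiset.prod_cons, Multiset.add_cons, mul_assoc, polyDD_cons_mul, ih]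
    intro h
    have := congrArg Multiset.card h
    rw [Multiset.card_add, Multiset.card_zero] at this
    exact hs (Multiset.card_eq_zero.1 (by omega))

theorem polyDD_recursion (a b : ℝ) (s : Multiset ℝ) (p : ℝ[X]) :
    (a - b) * polyDD (a ::ₘ b ::ₘ s) p = polyDD (a ::ₘ s) p - polyDD (b ::ₘ s) p := by
  have h1 := polyDD_cons_mul a (Multiset.cons_ne_zero (a := b) (m := s)) p
  have h2 := polyDD_cons_mul b (Multiset.cons_ne_zero (a := a) (m := s)) p
  rw [Multiset.cons_swap] at h2
  rw [← h1, ← h2, ← polyDD_sub, ← polyDD_C_mul]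
  congr 1
  rw [C_sub]; ring

theorem polyDD_singleton (a : ℝ) (p : ℝ[X]) : polyDD {a} p = p.eval a := by
  simp [polyDD, modByMonic_X_sub_C_eq_C_eval]

theorem polyDD_cons_X_mul (a : ℝ) {s : Multiset ℝ} (hs : s ≠ 0) (p : ℝ[X]) :
    polyDD (a ::ₘ s) (X * p) = a * polyDD (a ::ₘ s) p + polyDD s p := by
  rw [← polyDD_cons_mul a hs p, ← polyDD_C_mul, ← polyDD_add]
  congr 1; ring

theorem polyDD_replicate (k : ℕ) (a : ℝ) (p : ℝ[X]) :
    polyDD (Multiset.replicate (k + 1) a) p = (derivative^[k] p).eval a / k.factorial := by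
  rw [eval_iterate_derivative_eq_taylor_coeff, mul_div_cancel_left₀ _ (by positivity)]
  induction k generalizing p with
  | zero => simp [polyDD_singleton]
  | succ k ih =>
    have hp : p = C (p.eval a) + (X - C a) * (p /ₘ (X - C a)) := by
      conv_lhs => rw [← modByMonic_add_div p (X - C a), modByMonic_X_sub_C_eq_C_eval]
    conv_lhs => rw [hp]
    rw [polyDD_add, polyDD_C (by simp), Multiset.replicate_succ, polyDD_cons_mul _ (by simp), ih]
    conv_rhs => rw [hp]
    rw [map_add, taylor_mul, map_sub, taylor_X, taylor_C, taylor_C, add_sub_cancel_right,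
      coeff_add, coeff_X_mul, coeff_C]
    simp

/-- Both sides obey the same recursion, so it suffices that `g` and `p` agree in the derivatives
taken on runs of equal nodes. -/
theorem divDiffSorted_eq_polyDD {k : ℕ} {x : Fin (k + 1) → ℝ} (hx : Monotone x) {g : ℝ → ℝ}
    {p : ℝ[X]} (h : ∀ i j : Fin (k + 1), i ≤ j → x i = x j →
      iteratedDeriv (j - i : ℕ) g (x i) = (derivative^[(j - i : ℕ)] p).eval (x i)) :
    divDiffSorted g k x = polyDD (Finset.univ.val.map x) p := by
  induction k with
  | zero =>
    have := h 0 0 le_rfl rfl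
    simp only [Fin.val_zero, tsub_self, iteratedDeriv_zero, Function.iterate_zero, id] at this
    simp [divDiffSorted, polyDD_singleton, this]
  | succ k ih =>
    rw [divDiffSorted]
    split_ifs with heq
    · have hall : ∀ i, x i = x 0 := fun i =>
        le_antisymm (heq ▸ hx (Fin.le_last i)) (hx (Fin.zero_le i))
      have h1 := h 0 (Fin.last (k + 1)) (Fin.zero_le _) heq
      simp only [Fin.val_last, Fin.val_zero, tsub_zero] at h1
      rw [h1, ← polyDD_replicate]
      congr 1
      rw [Multiset.map_congr rfl fun i _ => hall i, Multiset.map_const']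
      simp
    · set mid := Finset.univ.val.map fun i : Fin k => x i.succ.castSucc with hmid
      have e1 : Finset.univ.val.map (fun i : Fin (k + 1) => x i.castSucc) = x 0 ::ₘ mid := by
        rw [Fin.univ_succ]; simp [hmid, Function.comp_def]
      have e2 : Finset.univ.val.map (fun i : Fin (k + 1) => x i.succ) =
          x (Fin.last (k + 1)) ::ₘ mid := by
        rw [Fin.univ_castSuccEmb]; simp [hmid, Function.comp_def]
      have e3 : Finset.univ.val.map x = x 0 ::ₘ x (Fin.last (k + 1)) ::ₘ mid := by
        rw [← e2, Fin.univ_succ]; simp [Function.comp_def]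
      rw [ih (x := fun i => x i.castSucc) (fun i j hij => hx (Fin.castSucc_le_castSucc_iff.2 hij))
          (fun i j hij hxx => h i.castSucc j.castSucc (Fin.castSucc_le_castSucc_iff.2 hij) hxx),
        ih (x := fun i => x i.succ) (fun i j hij => hx (Fin.succ_le_succ_iff.2 hij))
          (fun i j hij hxx => by
            simpa using h i.succ j.succ (Fin.succ_le_succ_iff.2 hij) hxx),
        e1, e2, e3, ← polyDD_recursion, mul_div_cancel_left₀ _ (sub_ne_zero.2 heq)]

theorem divDiff_eq_polyDD {k : ℕ} {x : Fin (k + 1) → ℝ} {g : ℝ → ℝ} {p : ℝ[X]}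
    (h : ∀ i, ∀ d < (Finset.univ.filter fun j => x j = x i).card,
      iteratedDeriv d g (x i) = (derivative^[d] p).eval (x i)) :
    divDiff g x = polyDD (Finset.univ.val.map x) p := by
  set σ := Tuple.sort x with hσ
  have hm : Monotone (x ∘ σ) := Tuple.monotone_sort x
  rw [divDiff, ← hσ, divDiffSorted_eq_polyDD hm (p := p)]
  · congr 1
    rw [← Multiset.map_map]
    congr 1
    have := Finset.map_univ_equiv σ
    exact congrArg Finset.val this
  · intro i j hij hxx
    refine h (σ i) _ ?_
    -- After sorting, equal end nodes force the whole run from `i` to `j` to coincide, so `j - i` is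
    -- less than the multiplicity.
    have h1 : (Finset.Icc i j).map σ.toEmbedding ⊆ Finset.univ.filter fun l => x l = x (σ i) := by
      intro l hl
      obtain ⟨l', hl', rfl⟩ := Finset.mem_map.1 hl
      rw [Finset.mem_Icc] at hl'
      simp only [Finset.mem_filter, Finset.mem_univ, true_and]
      exact le_antisymm ((hm hl'.2).trans_eq hxx.symm) (hm hl'.1)
    have h2 := Finset.card_le_card h1
    rw [Finset.card_map, Fin.card_Icc] at h2
    have : (i : ℕ) ≤ j := hij
    omega

theorem iterate_derivative_eval_eq_of_dvd {p q : ℝ[X]} {a : ℝ} {r d : ℕ} (hd : d ≤ r)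
    (h : (X - C a) ^ (r + 1) ∣ p - q) :
    (derivative^[d] p).eval a = (derivative^[d] q).eval a := by
  obtain ⟨s, hs⟩ := h
  have hp : p = q + (X - C a) ^ (r + 1) * s := by rw [← hs]; ring
  rw [eval_iterate_derivative_eq_taylor_coeff, eval_iterate_derivative_eq_taylor_coeff, hp, map_add,
    coeff_add, taylor_mul, taylor_pow, map_sub, taylor_X, taylor_C, add_sub_cancel_right,
    coeff_X_pow_mul', if_neg (by omega), add_zero]

/-- Hermite interpolation. -/
theorem exists_polynomial_iterate_derivative_eval (T : Finset ℝ) (r : ℕ) (c : ℕ → ℝ → ℝ) :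
    ∃ p : ℝ[X], ∀ a ∈ T, ∀ d ≤ r, (derivative^[d] p).eval a = c d a := by
  induction T using Finset.induction_on with
  | empty => exact ⟨0, by simp⟩
  | insert b T hb ih =>
    obtain ⟨p, hp⟩ := ih
    set Q : ℝ[X] := ∏ a ∈ T, (X - C a) ^ (r + 1) with hQ
    have hcop : IsCoprime Q ((X - C b) ^ (r + 1)) := by
      refine IsCoprime.prod_left fun a ha => IsCoprime.pow ?_
      exact isCoprime_X_sub_C_of_isUnit_sub
        (sub_ne_zero.2 fun h : a = b => hb (h ▸ ha)).isUnit
    obtain ⟨u, v, huv⟩ := hcop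
    set J := jetPolynomial r (fun d => c d b) b
    -- `Q` vanishes to order `r + 1` on `T`, so the correction is invisible there; near `b` the
    -- factor `u * Q` is `1` up to order `r + 1`, so `p` is replaced by `J`.
    refine ⟨p + (J - p) * (u * Q), fun a ha d hd => ?_⟩
    rcases Finset.mem_insert.1 ha with rfl | ha
    · rw [← eval_iterate_derivative_jetPolynomial (fun d => c d a) a hd]
      refine iterate_derivative_eval_eq_of_dvd hd ⟨(p - J) * v, ?_⟩
      have : u * Q = 1 - v * (X - C a) ^ (r + 1) := by rw [← huv]; ring
      rw [this]; ring
    · rw [← hp a ha d hd]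
      refine iterate_derivative_eval_eq_of_dvd hd ?_
      rw [add_sub_cancel_left]
      exact Dvd.dvd.mul_left (Dvd.dvd.mul_left (Finset.dvd_prod_of_mem _ ha) _) _

theorem iteratedDeriv_mul_eq_of_jet {U : Set ℝ} (hU : IsOpen U) {f : ℝ → ℝ} {m : ℕ}
    (hf : ContDiffOn ℝ m f U) {p : ℝ[X]} (N : ℝ[X]) {a : ℝ} (ha : a ∈ U)
    (h : ∀ d ≤ m, iteratedDeriv d f a = (derivative^[d] p).eval a) {d : ℕ} (hd : d ≤ m) :
    iteratedDeriv d (fun t => f t * N.eval t) a = (derivative^[d] (p * N)).eval a := by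
  rw [iteratedDeriv_mul_eq_leibniz hU hf (F := fun k => iteratedDeriv k f) (fun _ _ => rfl) N hd ha,
    ← leibniz_polynomial]
  exact leibniz_congr (fun k hk => h k (hk.trans hd)) N

theorem divDiff_triple_eq_polyDD {f : ℝ → ℝ} {p : ℝ[X]} {x y z : ℝ}
    (h : ∀ a ∈ ({x, y, z} : Finset ℝ), ∀ d ≤ 2,
      iteratedDeriv d f a = (derivative^[d] p).eval a) :
    divDiff f ![x, y, z] = polyDD {x, y, z} p := by
  rw [divDiff_eq_polyDD (p := p)]
  · congr 1
  · intro i d hd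
    refine h _ ?_ d ?_
    · fin_cases i <;> simp
    · have := Finset.card_filter_le (Finset.univ : Finset (Fin 3)) fun j => ![x, y, z] j = ![x, y, z] i
      simp only [Finset.card_univ, Fintype.card_fin] at this
      have h2 := hd.trans_le this
      omega

/-- The Hermite interpolant matches whatever values `iteratedDeriv` takes, so the symmetry needs no
smoothness of `f`. -/
theorem divDiff_triple_swap (f : ℝ → ℝ) (x y z : ℝ) :
    divDiff f ![x, y, z] = divDiff f ![y, x, z] := by
  obtain ⟨p, hp⟩ := exists_polynomial_iterate_derivative_eval {x, y, z} 2
    fun d a => iteratedDeriv d f a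
  rw [divDiff_triple_eq_polyDD fun a ha d hd => (hp a ha d hd).symm,
    divDiff_triple_eq_polyDD (p := p) fun a ha d hd => (hp a (by
      simp only [Finset.mem_insert, Finset.mem_singleton] at ha ⊢; tauto) d hd).symm]
  congr 1
  exact Multiset.cons_swap _ _ _

theorem map_doubledNodes {n : ℕ} (x : Fin n → ℝ) (y : ℝ) :
    Finset.univ.val.map (doubledNodes x y) =
      {y} + Finset.univ.val.map x + Finset.univ.val.map x := by
  have hsum : ∀ {k : ℕ} (v : Fin k → ℝ), Finset.univ.val.map v = ∑ i, ({v i} : Multiset ℝ) :=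
    fun v => by
      rw [Finset.sum]
      exact (Multiset.sum_map_singleton _).symm.trans (by rw [Multiset.map_map]; rfl)
  set G : ℕ → Multiset ℝ := fun k => if h : k < n then {x ⟨k, h⟩} else 0 with hG
  have h1 : ∀ k, ∑ i ∈ Finset.range (2 * k), G (i / 2) = ∑ i ∈ Finset.range k, (G i + G i) := by
    intro k
    induction k with
    | zero => simp
    | succ k ih =>
      rw [show 2 * (k + 1) = 2 * k + 1 + 1 by ring, Finset.sum_range_succ, Finset.sum_range_succ,
        ih, Finset.sum_range_succ, show (2 * k + 1) / 2 = k by omega,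
        show 2 * k / 2 = k by omega, add_assoc]
  have h2 : ∑ i : Fin (2 * n), ({doubledNodes x y i.castSucc} : Multiset ℝ) =
      ∑ i ∈ Finset.range (2 * n), G (i / 2) := by
    rw [Finset.sum_range]
    refine Finset.sum_congr rfl fun i _ => ?_
    have hi : (i : ℕ) / 2 < n := by omega
    simp [doubledNodes, hG, hi]
  have h3 : ∑ i ∈ Finset.range n, G i = ∑ i, ({x i} : Multiset ℝ) := by
    rw [Finset.sum_range]
    exact Finset.sum_congr rfl fun i _ => by simp [hG]
  rw [hsum, hsum, Fin.sum_univ_castSucc, h2, h1, Finset.sum_add_distrib, h3]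
  have : doubledNodes x y (Fin.last (2 * n)) = y := by simp [doubledNodes]
  rw [this, add_comm, add_assoc]

/-! ### Lagrange bases and second order differences. -/

/-- `∏_{k ≠ i} (X - x k)`. -/
noncomputable def nodalErase {n : ℕ} (x : Fin n → ℝ) (i : Fin n) : ℝ[X] :=
  ∏ k ∈ Finset.univ.erase i, (X - C (x k))

theorem natDegree_nodalErase {n : ℕ} (x : Fin n → ℝ) (i : Fin n) :
    (nodalErase x i).natDegree = n - 1 := by
  rw [nodalErase, natDegree_prod_of_monic _ _ fun k _ => monic_X_sub_C _]
  simp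

theorem eval_nodalErase {n : ℕ} (x : Fin n → ℝ) (i : Fin n) (t : ℝ) :
    (nodalErase x i).eval t = ∏ k ∈ Finset.univ.erase i, (t - x k) := by
  simp [nodalErase, eval_prod]

theorem eq_sum_nodalErase {n : ℕ} (hn : 1 ≤ n) {x : Fin n → ℝ} (hx : Function.Injective x)
    {q : ℝ[X]} (hq : q.natDegree ≤ n - 1) :
    q = ∑ i, C (q.eval (x i) / (nodalErase x i).eval (x i)) * nodalErase x i := by
  have hdeg : q.degree < (Finset.univ : Finset (Fin n)).card := by
    refine degree_le_natDegree.trans_lt ?_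
    simp only [Finset.card_univ, Fintype.card_fin]
    exact_mod_cast (by omega : q.natDegree < n)
  conv_lhs => rw [Lagrange.eq_interpolate (s := Finset.univ) (v := x) hx.injOn hdeg]
  rw [Lagrange.interpolate_apply]
  refine Finset.sum_congr rfl fun i _ => ?_
  rw [div_eq_mul_inv, C_mul, mul_assoc]
  congr 1
  simp only [Lagrange.basis, Lagrange.basisDivisor, Finset.prod_mul_distrib]
  rw [eval_nodalErase, ← Finset.prod_inv_distrib, nodalErase, map_prod]

theorem natDegree_sum_nodalErase_le {n : ℕ} (x c : Fin n → ℝ) :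
    (∑ i, C (c i) * nodalErase x i).natDegree ≤ n - 1 :=
  natDegree_sum_le_of_forall_le _ _ fun i _ =>
    (natDegree_C_mul_le _ _).trans (natDegree_nodalErase x i).le

/-- `nodalErase x i` deletes every node of `x` except `x i`, and likewise for `x'`, so only `x i`,
`x' j` and `y` remain. Two separate tuples are allowed so that confluent nodes can be pulled apart.
-/
theorem polyDD_mul_sum_nodalErase {n : ℕ} (x x' c c' : Fin n → ℝ) (y : ℝ) (p : ℝ[X]) :
    polyDD ({y} + Finset.univ.val.map x + Finset.univ.val.map x')
      (p * ((∑ i, C (c i) * nodalErase x i) * ∑ j, C (c' j) * nodalErase x' j)) =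
    ∑ i, ∑ j, c i * c' j * polyDD {x i, x' j, y} p := by
  have h : ∀ (x : Fin n → ℝ) i,
      Finset.univ.val.map x = x i ::ₘ (Finset.univ.erase i).val.map x := fun x i => by
    rw [← Multiset.map_cons x, ← Finset.insert_val_of_notMem (Finset.notMem_erase i _),
      Finset.insert_erase (Finset.mem_univ i)]
  have hw : ∀ (x : Fin n → ℝ) i, nodalErase x i =
      (((Finset.univ.erase i).val.map x).map fun a => X - C a).prod := fun x i => by
    rw [nodalErase, Finset.prod, Multiset.map_map]; rfl
  rw [Finset.sum_mul_sum, Finset.mul_sum, polyDD_sum]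
  refine Finset.sum_congr rfl fun i _ => ?_
  rw [Finset.mul_sum, polyDD_sum]
  refine Finset.sum_congr rfl fun j _ => ?_
  rw [show p * (C (c i) * nodalErase x i * (C (c' j) * nodalErase x' j)) =
    C (c i * c' j) * (nodalErase x' j * (nodalErase x i * p)) by rw [C_mul]; ring, polyDD_C_mul]
  congr 1
  rw [show ({y} + Finset.univ.val.map x + Finset.univ.val.map x' : Multiset ℝ) =
    {x i, x' j, y} + (Finset.univ.erase i).val.map x + (Finset.univ.erase j).val.map x' by
      rw [h x i, h x' j]
      simp only [Multiset.insert_eq_cons, ← Multiset.singleton_add]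
      abel, hw x' j, polyDD_add_mul, hw x i, polyDD_add_mul]
  · simp
  · simp

theorem dd_eq_polyDD (s : Finset ℝ) (p : ℝ[X]) :
    dd s (fun t => p.eval t) = polyDD s.val p := by
  set M := (s.val.map fun a => X - C a).prod with hM
  have h1 : ∀ a ∈ s, p.eval a = (p %ₘ M).eval a := fun a ha => by
    conv_lhs => rw [← modByMonic_add_div p M]
    have h0 : M.eval a = 0 := by
      rw [hM, eval_multiset_prod]
      refine Multiset.prod_eq_zero ?_
      rw [Multiset.map_map, Multiset.mem_map]
      exact ⟨a, ha, by simp⟩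
    rw [eval_add, eval_mul, h0, zero_mul, add_zero]
  rw [dd_congr h1, dd_polynomial, polyDD]; · rfl
  have := degree_modByMonic_lt p (monic_nodal s.val)
  rwa [degree_eq_natDegree (monic_nodal s.val).ne_zero, natDegree_nodal] at this

/-! ### Continuity of second order divided differences. -/

/-- A smooth cutoff replaces `f` by a function regular on the whole line, as the integral formulas
and convolutions require. -/
theorem exists_contDiff_eqOn_Icc {U : Set ℝ} (hU : IsOpen U) {f : ℝ → ℝ} {k : ℕ}
    (hf : ContDiffOn ℝ k f U) {α α' β β' : ℝ} (hα : α' < α) (hβ : β < β') (hsub : Icc α' β' ⊆ U) :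
    ∃ F : ℝ → ℝ, ContDiff ℝ k F ∧ EqOn F f (Icc α β) ∧ ∀ t ∉ Icc α' β', F t = 0 := by
  set χ : ℝ → ℝ := fun t => Real.smoothTransition ((t - α') / (α - α')) *
    Real.smoothTransition ((β' - t) / (β' - β)) with hχ
  have hχs : ContDiff ℝ k χ :=
    (Real.smoothTransition.contDiff.comp (by fun_prop)).mul
      (Real.smoothTransition.contDiff.comp (by fun_prop))
  have h0 : ∀ t ∉ Icc α' β', χ t = 0 := fun t ht => by
    rw [mem_Icc, not_and_or, not_le, not_le] at ht
    rcases ht with ht | ht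
    · simp only [hχ]
      rw [Real.smoothTransition.zero_of_nonpos, zero_mul]
      exact div_nonpos_of_nonpos_of_nonneg (by linarith) (by linarith)
    · simp only [hχ]
      rw [Real.smoothTransition.zero_of_nonpos (x := (β' - t) / (β' - β)), mul_zero]
      exact div_nonpos_of_nonpos_of_nonneg (by linarith) (by linarith)
  refine ⟨fun t => χ t * f t, ?_, fun t ht => ?_, fun t ht => by simp only [h0 t ht, zero_mul]⟩
  · rw [contDiff_iff_contDiffAt]
    intro t
    by_cases ht : t ∈ Icc α' β'
    · exact hχs.contDiffAt.mul (hf.contDiffAt (hU.mem_nhds (hsub ht)))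
    · refine (contDiffAt_const (c := (0 : ℝ))).congr_of_eventuallyEq ?_
      filter_upwards [isClosed_Icc.isOpen_compl.mem_nhds ht] with s hs
      rw [h0 s hs, zero_mul]
  · simp only [hχ]
    rw [Real.smoothTransition.one_of_one_le, Real.smoothTransition.one_of_one_le, one_mul, one_mul]
    · rw [one_le_div (by linarith)]; linarith [ht.2]
    · rw [one_le_div (by linarith)]; linarith [ht.1]

theorem exists_Icc_subset_of_isOpen {U : Set ℝ} (hU : IsOpen U) (hUc : OrdConnected U) {s : Finset ℝ}
    (hs : (s : Set ℝ) ⊆ U) : ∃ α' α β β', α' < α ∧ β < β' ∧ (s : Set ℝ) ⊆ Ioo α β ∧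
      (s.Nonempty → Icc α' β' ⊆ U) := by
  rcases s.eq_empty_or_nonempty with rfl | hne
  · exact ⟨0, 1, 0, 1, by norm_num, by norm_num, by simp, by simp⟩
  obtain ⟨ε, hε, h1⟩ := Metric.isOpen_iff.1 hU _ (hs (s.min'_mem hne))
  obtain ⟨δ, hδ, h2⟩ := Metric.isOpen_iff.1 hU _ (hs (s.max'_mem hne))
  refine ⟨s.min' hne - ε / 2, s.min' hne - ε / 3, s.max' hne + δ / 3, s.max' hne + δ / 2,
    by linarith, by linarith, fun t ht => ⟨?_, ?_⟩, fun _ => hUc.out (h1 ?_) (h2 ?_)⟩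
  · linarith [s.min'_le t ht]
  · linarith [s.le_max' t ht]
  · rw [Metric.mem_ball, Real.dist_eq, abs_lt]; constructor <;> linarith
  · rw [Metric.mem_ball, Real.dist_eq, abs_lt]; constructor <;> linarith

theorem mul_integral_deriv_segment {F : ℝ → ℝ} (hF : ContDiff ℝ 1 F) (y z : ℝ) :
    (z - y) * ∫ s in (0 : ℝ)..1, deriv F (y + s * (z - y)) = F z - F y := by
  have h1 : ∀ s ∈ uIcc (0 : ℝ) 1, HasDerivAt (fun s => F (y + s * (z - y)))
      ((z - y) * deriv F (y + s * (z - y))) s := fun s _ => by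
    have h2 : HasDerivAt (fun s : ℝ => y + s * (z - y)) (z - y) s := by
      simpa using ((hasDerivAt_id' s).mul_const (z - y)).const_add y
    rw [mul_comm]
    exact ((hF.differentiable (by simp)) _).hasDerivAt.comp s h2
  have hc : Continuous (deriv F) := hF.continuous_deriv le_rfl
  rw [← intervalIntegral.integral_const_mul, intervalIntegral.integral_eq_sub_of_hasDerivAt h1
    (by apply Continuous.intervalIntegrable; fun_prop)]
  simp

/-- The Hermite–Genocchi integral for a divided difference of order two. -/
noncomputable def segmentIntegral (φ : ℝ → ℝ) (x y z : ℝ) : ℝ :=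
  ∫ s in (0 : ℝ)..1, ∫ t in (0 : ℝ)..1, s * φ (y + s * ((x - y) + t * (z - x)))

theorem continuous_segmentIntegral {φ : ℝ → ℝ} (hφ : Continuous φ) :
    Continuous fun v : ℝ × ℝ × ℝ => segmentIntegral φ v.1 v.2.1 v.2.2 := by
  unfold segmentIntegral
  apply intervalIntegral.continuous_parametric_intervalIntegral_of_continuous'
  simp only [Function.uncurry_def]
  apply intervalIntegral.continuous_parametric_intervalIntegral_of_continuous'
  simp only [Function.uncurry_def]
  fun_prop

/-- The integral depends continuously on the nodes however they coalesce, which the recursive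
definition hides. For `x ≠ z` the recursion reduces it to first order; otherwise the inner integral
is trivial. -/
theorem divDiff_triple_eq_segmentIntegral {F : ℝ → ℝ} (hF : ContDiff ℝ 2 F) (x y z : ℝ) :
    divDiff F ![x, y, z] = segmentIntegral (deriv (deriv F)) x y z := by
  have hF1 : ContDiff ℝ 1 (deriv F) := ((contDiff_succ_iff_deriv (n := 1)).1 hF).2.2
  have hc1 : Continuous (deriv F) := hF1.continuous
  have hc2 : Continuous (deriv (deriv F)) := hF1.continuous_deriv le_rfl
  obtain ⟨p, hp⟩ := exists_polynomial_iterate_derivative_eval {x, y, z} 2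
    fun d a => iteratedDeriv d F a
  rw [divDiff_triple_eq_polyDD fun a ha d hd => (hp a ha d hd).symm]
  have hp0 : ∀ a ∈ ({x, y, z} : Finset ℝ), p.eval a = F a := fun a ha => by
    simpa using hp a ha 0 (by norm_num)
  have hp1 : ∀ a ∈ ({x, y, z} : Finset ℝ), (derivative p).eval a = deriv F a := fun a ha => by
    simpa [iteratedDeriv_one] using hp a ha 1 (by norm_num)
  have hp2 : ∀ a ∈ ({x, y, z} : Finset ℝ), (derivative (derivative p)).eval a =
      deriv (deriv F) a := fun a ha => by
    simpa [iteratedDeriv_succ', iteratedDeriv_one] using hp a ha 2 le_rfl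
  have hpair : ∀ a ∈ ({x, y, z} : Finset ℝ), ∀ b ∈ ({x, y, z} : Finset ℝ),
      polyDD {a, b} p = ∫ s in (0 : ℝ)..1, deriv F (b + s * (a - b)) := by
    intro a ha b hb
    rcases eq_or_ne a b with rfl | hab
    · have := polyDD_replicate 1 a p
      simp only [Function.iterate_one, hp1 a ha] at this
      simpa [Multiset.replicate_succ] using this
    · have h1 := polyDD_recursion a b 0 p
      have h2 := mul_integral_deriv_segment (hF.of_le (by norm_num)) b a
      rw [Multiset.cons_zero, Multiset.cons_zero, polyDD_singleton, polyDD_singleton, hp0 a ha,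
        hp0 b hb, ← h2] at h1
      exact mul_left_cancel₀ (sub_ne_zero.2 hab) h1
  have mx : x ∈ ({x, y, z} : Finset ℝ) := by simp
  have my : y ∈ ({x, y, z} : Finset ℝ) := by simp
  have mz : z ∈ ({x, y, z} : Finset ℝ) := by simp
  rcases eq_or_ne x z with rfl | hxz
  · have hseg : segmentIntegral (deriv (deriv F)) x y x =
        ∫ s in (0 : ℝ)..1, s * deriv (deriv F) (y + s * (x - y)) := by
      simp [segmentIntegral]
    rcases eq_or_ne y x with rfl | hyx
    · have h1 := polyDD_replicate 2 y p
      simp only [Function.iterate_succ, Function.iterate_zero, Function.comp_apply, id,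
        hp2 y my] at h1
      rw [hseg]
      simp only [sub_self, mul_zero, add_zero, intervalIntegral.integral_mul_const, integral_id]
      rw [show ({y, y, y} : Multiset ℝ) = Multiset.replicate (2 + 1) y from rfl, h1]
      norm_num [Nat.factorial]; ring
    · have h1 := polyDD_recursion y x {x} p
      have e1 := hpair y my x mx
      have e2 := hpair x mx x mx
      have e3 := hpair x mx y my
      have e4 : polyDD {y, x} p = polyDD {x, y} p := by rw [Multiset.pair_comm]
      -- Integration by parts handles `x = z ≠ y`.
      have hparts : ∀ s ∈ uIcc (0 : ℝ) 1, HasDerivAt (fun s => s * deriv F (y + s * (x - y)))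
          (deriv F (y + s * (x - y)) + (x - y) * (s * deriv (deriv F) (y + s * (x - y)))) s :=
        fun s _ => by
          have h2 : HasDerivAt (fun s : ℝ => y + s * (x - y)) (x - y) s := by
            simpa using ((hasDerivAt_id' s).mul_const (x - y)).const_add y
          have h3 := ((hF1.differentiable (by simp)) (y + s * (x - y))).hasDerivAt.comp s h2
          refine ((hasDerivAt_id' s).mul h3).congr_deriv ?_
          simp only [Function.comp_apply]
          ring
      have h2 := intervalIntegral.integral_eq_sub_of_hasDerivAt hparts
        (by apply Continuous.intervalIntegrable; fun_prop)
      rw [intervalIntegral.integral_add (by apply Continuous.intervalIntegrable; fun_prop)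
        (by apply Continuous.intervalIntegrable; fun_prop),
        intervalIntegral.integral_const_mul, ← hseg, ← e3] at h2
      simp only [sub_self, mul_zero, add_zero, intervalIntegral.integral_const, sub_zero,
        one_smul] at e2
      have e5 : (y ::ₘ x ::ₘ {x} : Multiset ℝ) = {x, y, x} := Multiset.cons_swap _ _ _
      rw [e5, show (y ::ₘ {x} : Multiset ℝ) = {y, x} from rfl,
        show (x ::ₘ {x} : Multiset ℝ) = {x, x} from rfl, e4, e2] at h1
      simp only [one_mul, zero_mul, sub_zero, add_sub_cancel] at h2
      refine mul_left_cancel₀ (sub_ne_zero.2 hyx) ?_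
      rw [h1]; linarith
  · have h1 := polyDD_recursion x z {y} p
    have e1 := hpair x mx y my
    have e2 := hpair z mz y my
    have e5 : (x ::ₘ z ::ₘ {y} : Multiset ℝ) = {x, y, z} := by
      rw [show (z ::ₘ {y} : Multiset ℝ) = {z, y} from rfl, Multiset.pair_comm]; rfl
    rw [e5, show (x ::ₘ {y} : Multiset ℝ) = {x, y} from rfl,
      show (z ::ₘ {y} : Multiset ℝ) = {z, y} from rfl, e1, e2] at h1
    have hin : ∀ s : ℝ, (z - x) * ∫ t in (0 : ℝ)..1,
        s * deriv (deriv F) (y + s * ((x - y) + t * (z - x))) =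
        deriv F (y + s * (z - y)) - deriv F (y + s * (x - y)) := by
      intro s
      have := mul_integral_deriv_segment hF1 (y + s * (x - y)) (y + s * (z - y))
      rw [← this, intervalIntegral.integral_const_mul, ← mul_assoc]
      congr 1
      · ring
      · congr 1; funext t; congr 1; ring
    have h2 : (z - x) * segmentIntegral (deriv (deriv F)) x y z =
        (∫ s in (0 : ℝ)..1, deriv F (y + s * (z - y))) -
          ∫ s in (0 : ℝ)..1, deriv F (y + s * (x - y)) := by
      rw [segmentIntegral, ← intervalIntegral.integral_const_mul, ← intervalIntegral.integral_sub
        (by apply Continuous.intervalIntegrable; fun_prop)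
        (by apply Continuous.intervalIntegrable; fun_prop)]
      exact intervalIntegral.integral_congr fun s _ => hin s
    refine mul_left_cancel₀ (sub_ne_zero.2 hxz) ?_
    rw [h1]; linarith

theorem continuousAt_divDiff_triple {U : Set ℝ} (hU : IsOpen U) (hUc : OrdConnected U) {f : ℝ → ℝ}
    (hf : ContDiffOn ℝ 2 f U) {x y z : ℝ} (hx : x ∈ U) (hy : y ∈ U) (hz : z ∈ U) :
    ContinuousAt (fun v : ℝ × ℝ × ℝ => divDiff f ![v.1, v.2.1, v.2.2]) (x, y, z) := by
  obtain ⟨α', α, β, β', hα, hβ, hs, hsub⟩ := exists_Icc_subset_of_isOpen hU hUc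
    (s := {x, y, z}) (by simp [insert_subset_iff, hx, hy, hz])
  obtain ⟨F, hF, hFf, -⟩ := exists_contDiff_eqOn_Icc hU (k := 2) (by exact_mod_cast hf) hα hβ
    (hsub (by simp))
  have hF' : ContDiff ℝ 2 F := by exact_mod_cast hF
  have hF1 : ContDiff ℝ 1 (deriv F) := ((contDiff_succ_iff_deriv (n := 1)).1 hF').2.2
  have hcont := continuous_segmentIntegral (hF1.continuous_deriv le_rfl)
  have hjet : ∀ a ∈ Ioo α β, ∀ d, iteratedDeriv d F a = iteratedDeriv d f a := fun a ha d =>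
    Filter.EventuallyEq.iteratedDeriv_eq d ((hFf.mono Ioo_subset_Icc_self).eventuallyEq_of_mem
      (isOpen_Ioo.mem_nhds ha))
  refine hcont.continuousAt.congr ?_
  have hnhds : Ioo α β ×ˢ Ioo α β ×ˢ Ioo α β ∈ 𝓝 (x, y, z) :=
    prod_mem_nhds (isOpen_Ioo.mem_nhds (hs (by simp)))
      (prod_mem_nhds (isOpen_Ioo.mem_nhds (hs (by simp))) (isOpen_Ioo.mem_nhds (hs (by simp))))
  filter_upwards [hnhds] with v hv
  obtain ⟨h1, h2, h3⟩ := hv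
  obtain ⟨p, hp⟩ := exists_polynomial_iterate_derivative_eval {v.1, v.2.1, v.2.2} 2
    fun d a => iteratedDeriv d F a
  rw [← divDiff_triple_eq_segmentIntegral hF',
    divDiff_triple_eq_polyDD fun a ha d hd => (hp a ha d hd).symm,
    divDiff_triple_eq_polyDD fun a ha d hd => by
      rw [hp a ha d hd, hjet]
      simp only [Finset.mem_insert, Finset.mem_singleton] at ha
      rcases ha with rfl | rfl | rfl <;> assumption]

/-! ### Doubled nodes and Kraus matrices. -/

theorem card_filter_doubledNodes_le {n : ℕ} {x : Fin n → ℝ} (hx : Function.Injective x) (y v : ℝ) :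
    (Finset.univ.filter fun j => doubledNodes x y j = v).card ≤ 3 := by
  have h : (Finset.univ.filter fun j => doubledNodes x y j = v).card =
      (Finset.univ.val.map (doubledNodes x y)).count v := by
    rw [Multiset.count_map]
    simp only [Finset.card, Finset.filter_val, eq_comm]
  have hnd : (Finset.univ.val.map x).count v ≤ 1 :=
    Multiset.nodup_iff_count_le_one.1 (Finset.univ.nodup.map hx) v
  have hy : ({y} : Multiset ℝ).count v ≤ 1 :=
    Multiset.nodup_iff_count_le_one.1 (Multiset.nodup_singleton y) v
  rw [h, map_doubledNodes, Multiset.count_add, Multiset.count_add]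
  omega

theorem doubledNodes_mem {n : ℕ} {U : Set ℝ} {x : Fin n → ℝ} (hx : ∀ i, x i ∈ U) {y : ℝ}
    (hy : y ∈ U) (k : Fin (2 * n + 1)) : doubledNodes x y k ∈ U := by
  unfold doubledNodes
  split_ifs
  · exact hx _
  · exact hy

/-- No node occurs more than three times, so `f` may be replaced by a polynomial with the same
2-jets, simultaneously for all factors `N`; this is why `C²` suffices. -/
theorem exists_polynomial_divDiff_doubledNodes {U : Set ℝ} (hU : IsOpen U) {f : ℝ → ℝ}
    (hf : ContDiffOn ℝ 2 f U) {n : ℕ} {x : Fin n → ℝ} (hx : Function.Injective x)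
    (hxU : ∀ i, x i ∈ U) {y : ℝ} (hy : y ∈ U) :
    ∃ p : ℝ[X], (∀ N : ℝ[X], divDiff (fun t => f t * N.eval t) (doubledNodes x y) =
      polyDD ({y} + Finset.univ.val.map x + Finset.univ.val.map x) (p * N)) ∧
      ∀ i j, divDiff f ![x i, x j, y] = polyDD {x i, x j, y} p := by
  obtain ⟨p, hp⟩ := exists_polynomial_iterate_derivative_eval (insert y (Finset.univ.image x)) 2
    fun d a => iteratedDeriv d f a
  refine ⟨p, fun N => ?_, fun i j => divDiff_triple_eq_polyDD fun a ha d hd => (hp a ?_ d hd).symm⟩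
  · rw [← map_doubledNodes]
    refine divDiff_eq_polyDD fun i d hd => ?_
    have hd2 : d ≤ 2 := Nat.lt_succ_iff.1 (hd.trans_le (card_filter_doubledNodes_le hx y _))
    refine iteratedDeriv_mul_eq_of_jet hU (m := 2) (by exact_mod_cast hf) N
      (doubledNodes_mem hxU hy i) (fun d hd => (hp _ ?_ d hd).symm) hd2
    unfold doubledNodes
    split_ifs <;> simp
  · simp only [Finset.mem_insert, Finset.mem_singleton] at ha
    rcases ha with rfl | rfl | rfl <;> simp

theorem posSemidef_divDiff_iff {n : ℕ} (f : ℝ → ℝ) (x : Fin n → ℝ) (y : ℝ) :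
    (Matrix.of fun i j : Fin n => divDiff f ![x i, x j, y]).PosSemidef ↔
      ∀ c : Fin n → ℝ, 0 ≤ ∑ i, ∑ j, c i * c j * divDiff f ![x i, x j, y] :=
  posSemidef_real_iff fun _ _ => divDiff_triple_swap f _ _ _

/-- Polynomials of degree at most `n - 1` correspond to coefficient vectors in the Lagrange basis,
and `polyDD_mul_sum_nodalErase` with `x' = x` matches the two quadratic forms. -/
theorem forall_divDiff_doubledNodes_nonneg_iff {U : Set ℝ} (hU : IsOpen U) {f : ℝ → ℝ}
    (hf : ContDiffOn ℝ 2 f U) {n : ℕ} (hn : 1 ≤ n) {x : Fin n → ℝ} (hx : Function.Injective x)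
    (hxU : ∀ i, x i ∈ U) {y : ℝ} (hy : y ∈ U) :
    (∀ q : ℂ[X], q.natDegree ≤ n - 1 → 0 ≤ divDiff (mulNorm f q) (doubledNodes x y)) ↔
      (Matrix.of fun i j : Fin n => divDiff f ![x i, x j, y]).PosSemidef := by
  obtain ⟨p, hp1, hp2⟩ := exists_polynomial_divDiff_doubledNodes hU hf hx hxU hy
  rw [posSemidef_divDiff_iff]
  have key : ∀ c : Fin n → ℝ, polyDD ({y} + Finset.univ.val.map x + Finset.univ.val.map x)
      (p * (∑ i, C (c i) * nodalErase x i) ^ 2) =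
      ∑ i, ∑ j, c i * c j * divDiff f ![x i, x j, y] := fun c => by
    rw [sq, polyDD_mul_sum_nodalErase]
    simp only [hp2]
  constructor
  · intro h c
    have h1 := h ((∑ i, C (c i) * nodalErase x i).map Complex.ofRealHom)
      (natDegree_map_le.trans (natDegree_sum_nodalErase_le x c))
    rw [mulNorm_map_ofReal, hp1, key] at h1
    simpa using h1
  · intro h q hq
    rw [mulNorm_eq, hp1, mul_add, polyDD_add,
      eq_sum_nodalErase hn hx ((natDegree_rePart_le q).trans hq),
      eq_sum_nodalErase hn hx ((natDegree_imPart_le q).trans hq), key, key]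
    exact add_nonneg (h _) (h _)

theorem eventually_ne_add_mul (a b : ℝ) {k : ℝ} (hk : k ≠ 0) :
    ∀ᶠ ε in 𝓝[>] (0 : ℝ), a ≠ b + k * ε := by
  rcases eq_or_ne a b with rfl | hab
  · filter_upwards [self_mem_nhdsWithin] with ε hε h
    have : ε ≠ 0 := (show (0 : ℝ) < ε from hε).ne'
    have h2 : k * ε = 0 := by linarith
    simp_all
  · have hc : ContinuousAt (fun ε => b + k * ε) 0 := by fun_prop
    have : ∀ᶠ ε in 𝓝 (0 : ℝ), b + k * ε ∈ ({a}ᶜ : Set ℝ) :=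
      hc (isOpen_compl_singleton.mem_nhds (by simpa using hab.symm))
    filter_upwards [nhdsWithin_le_nhds this] with ε hε h
    exact hε (by simpa using h.symm)

theorem dd_mul_sum_nodalErase {n : ℕ} {x x' : Fin n → ℝ} {y : ℝ}
    (h : ({y} + Finset.univ.val.map x + Finset.univ.val.map x').Nodup) (f : ℝ → ℝ)
    (c c' : Fin n → ℝ) :
    dd ⟨{y} + Finset.univ.val.map x + Finset.univ.val.map x', h⟩
      (fun t => f t * ((∑ i, C (c i) * nodalErase x i) * ∑ j, C (c' j) * nodalErase x' j).eval t) =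
    ∑ i, ∑ j, c i * c' j * divDiff f ![x i, x' j, y] := by
  set Z : Finset ℝ := ⟨{y} + Finset.univ.val.map x + Finset.univ.val.map x', h⟩ with hZ
  set p := Lagrange.interpolate Z id f
  have heq : ∀ a ∈ Z, p.eval a = f a := fun a ha =>
    Lagrange.eval_interpolate_at_node f (v := id) Function.injective_id.injOn ha
  have hmem : ∀ a, a ∈ Z ↔ a = y ∨ (∃ i, x i = a) ∨ ∃ i, x' i = a := fun a => by
    rw [hZ, Finset.mem_mk, Multiset.mem_add, Multiset.mem_add]
    simp [or_assoc]
  set N := (∑ i, C (c i) * nodalErase x i) * ∑ j, C (c' j) * nodalErase x' j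
  have h1 : dd Z (fun t => f t * N.eval t) = dd Z fun t => (p * N).eval t :=
    dd_congr fun a ha => by rw [← heq a ha]; exact eval_mul.symm
  rw [h1, dd_eq_polyDD, polyDD_mul_sum_nodalErase]
  refine Finset.sum_congr rfl fun i _ => Finset.sum_congr rfl fun j _ => ?_
  congr 1
  have hdist : x i ≠ x' j ∧ x i ≠ y ∧ x' j ≠ y := by
    rw [Multiset.nodup_add, Multiset.nodup_add] at h
    obtain ⟨⟨-, -, h1⟩, -, h2⟩ := h
    rw [Multiset.disjoint_left] at h1 h2
    refine ⟨fun he => ?_, fun he => ?_, fun he => ?_⟩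
    · refine h2 (a := x i) (by simp) ?_
      rw [he]; simp
    · refine h1 (a := y) (by simp) ?_
      rw [← he]; simp
    · refine h2 (a := y) (by simp) ?_
      rw [← he]; simp
  have hinj : Function.Injective ![x i, x' j, y] := by
    intro a b hab
    obtain ⟨h1, h2, h3⟩ := hdist
    fin_cases a <;> fin_cases b <;>
      simp [h1, h2, h3, h1.symm, h2.symm, h3.symm] at hab ⊢
  rw [divDiff_eq_polyDD (p := p)]
  · rfl
  · intro k d hd
    have hcard : (Finset.univ.filter fun j' => ![x i, x' j, y] j' = ![x i, x' j, y] k).card ≤ 1 :=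
      Finset.card_le_one.2 fun a ha b hb =>
        hinj ((Finset.mem_filter.1 ha).2.trans (Finset.mem_filter.1 hb).2.symm)
    obtain rfl : d = 0 := Nat.lt_one_iff.1 (hd.trans_le (by convert hcard))
    rw [iteratedDeriv_zero, Function.iterate_zero, id, heq]
    rw [hmem]
    fin_cases k <;> simp

/-- Quadratic forms of confluent divided differences are limits of divided differences with distinct
nodes. -/
theorem exists_dd_near_sum_divDiff {U : Set ℝ} (hU : IsOpen U) (hUc : OrdConnected U) {f : ℝ → ℝ}
    (hf : ContDiffOn ℝ 2 f U) {V : Set ℝ} (hV : IsOpen V) (hVU : V ⊆ U) {n : ℕ} (hn : 1 ≤ n)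
    {x : Fin n → ℝ} (hx : Function.Injective x) (hxV : ∀ i, x i ∈ V) {y : ℝ} (hy : y ∈ V) {q : ℝ[X]}
    (hq : q.natDegree ≤ n - 1) {δ : ℝ} (hδ : 0 < δ) :
    ∃ Z : Finset ℝ, (Z : Set ℝ) ⊆ V ∧ Z.card = 2 * n + 1 ∧
      |dd Z (fun t => f t * (q.eval t) ^ 2) -
        ∑ i, ∑ j, (q.eval (x i) / (nodalErase x i).eval (x i)) *
          (q.eval (x j) / (nodalErase x j).eval (x j)) * divDiff f ![x i, x j, y]| < δ := by
  set c : Fin n → ℝ := fun i => q.eval (x i) / (nodalErase x i).eval (x i) with hc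
  set c' : ℝ → Fin n → ℝ := fun ε j => q.eval (x j + ε) / (nodalErase x j).eval (x j) with hc'
  have hlim : Tendsto (fun ε => ∑ i, ∑ j, c i * c' ε j * divDiff f ![x i, x j + ε, y + 2 * ε])
      (𝓝[>] 0) (𝓝 (∑ i, ∑ j, c i * c j * divDiff f ![x i, x j, y])) := by
    refine tendsto_finsetSum _ fun i _ => tendsto_finsetSum _ fun j _ => ?_
    refine Tendsto.mul (Tendsto.mul tendsto_const_nhds ?_) ?_
    · have h1 : ContinuousAt (fun ε => c' ε j) 0 := by
        simp only [hc']
        have := (q.continuous.comp (continuous_const.add continuous_id) :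
          Continuous fun ε : ℝ => q.eval (x j + ε))
        exact (this.div_const _).continuousAt
      have h2 : c' 0 j = c j := by simp [hc', hc]
      rw [← h2]
      exact h1.tendsto.mono_left nhdsWithin_le_nhds
    · have h1 := continuousAt_divDiff_triple hU hUc hf (hVU (hxV i)) (hVU (hxV j)) (hVU hy)
      have h2 : Tendsto (fun ε : ℝ => (x i, x j + ε, y + 2 * ε)) (𝓝[>] 0) (𝓝 (x i, x j, y)) := by
        have : ContinuousAt (fun ε : ℝ => (x i, x j + ε, y + 2 * ε)) 0 := by fun_prop
        have h3 := this.tendsto.mono_left (nhdsWithin_le_nhds (s := Ioi (0 : ℝ)))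
        simpa using h3
      exact h1.tendsto.comp h2
  -- The shifts `0`, `ε` and `2 ε` separate the two copies of `x` and `y`, even when `y` is one of
  -- the `x i`.
  have hev : ∀ᶠ ε in 𝓝[>] (0 : ℝ), (∀ i, x i + ε ∈ V) ∧ y + 2 * ε ∈ V ∧
      (∀ i j, x i ≠ x j + 1 * ε) ∧ (∀ i, x i ≠ y + 2 * ε) ∧ (∀ i, x i ≠ y + 1 * ε) := by
    refine Eventually.and ?_ (Eventually.and ?_ (Eventually.and ?_ (Eventually.and ?_ ?_)))
    · refine eventually_all.2 fun i => nhdsWithin_le_nhds ?_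
      have : ContinuousAt (fun ε => x i + ε) 0 := by fun_prop
      exact this (hV.mem_nhds (by simpa using hxV i))
    · refine nhdsWithin_le_nhds ?_
      have : ContinuousAt (fun ε => y + 2 * ε) 0 := by fun_prop
      exact this (hV.mem_nhds (by simpa using hy))
    · exact eventually_all.2 fun i => eventually_all.2 fun j =>
        eventually_ne_add_mul _ _ one_ne_zero
    · exact eventually_all.2 fun i => eventually_ne_add_mul _ _ two_ne_zero
    · exact eventually_all.2 fun i => eventually_ne_add_mul _ _ one_ne_zero
  obtain ⟨ε, ⟨h1, h2, h3, h4, h5⟩, hlt⟩ :=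
    (hev.and (Metric.tendsto_nhds.1 hlim δ hδ)).exists
  have hx' : Function.Injective fun j => x j + ε := fun i j hij => hx (add_right_cancel hij)
  have hnd : ({y + 2 * ε} + Finset.univ.val.map x +
      Finset.univ.val.map fun j => x j + ε : Multiset ℝ).Nodup := by
    rw [Multiset.nodup_add, Multiset.nodup_add]
    refine ⟨⟨Multiset.nodup_singleton _, Finset.univ.nodup.map hx, ?_⟩, Finset.univ.nodup.map hx',
      ?_⟩
    · rw [Multiset.disjoint_left]
      intro a ha hax
      rw [Multiset.mem_singleton] at ha
      obtain ⟨i, -, hi⟩ := Multiset.mem_map.1 hax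
      exact h4 i (hi.trans ha)
    · rw [Multiset.disjoint_left]
      intro a ha hax
      obtain ⟨i, -, hi⟩ := Multiset.mem_map.1 hax
      rw [Multiset.mem_add, Multiset.mem_singleton] at ha
      rcases ha with ha | ha
      · exact h5 i (by linarith)
      · obtain ⟨j, -, hj⟩ := Multiset.mem_map.1 ha
        exact h3 j i (by linarith)
  refine ⟨⟨_, hnd⟩, ?_, ?_, ?_⟩
  · intro a ha
    rw [Finset.mem_coe, Finset.mem_mk, Multiset.mem_add, Multiset.mem_add,
      Multiset.mem_singleton] at ha
    rcases ha with (rfl | ha) | ha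
    · exact h2
    · obtain ⟨i, -, rfl⟩ := Multiset.mem_map.1 ha
      exact hxV i
    · obtain ⟨i, -, rfl⟩ := Multiset.mem_map.1 ha
      exact h1 i
  · rw [Finset.card_mk]
    simp; omega
  · have h6 : (nodalErase fun j => x j + ε) = fun j => (nodalErase x j).comp (X - C ε) := by
      funext j
      simp only [nodalErase, prod_comp, sub_comp, X_comp, C_comp, C_add]
      exact Finset.prod_congr rfl fun k _ => by ring
    have h7 := dd_mul_sum_nodalErase hnd f c (c' ε)
    have h8 : (∑ i, C (c i) * nodalErase x i) = q := (eq_sum_nodalErase hn hx hq).symm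
    have h9 : (∑ j, C (c' ε j) * nodalErase (fun j => x j + ε) j) = q := by
      conv_rhs => rw [eq_sum_nodalErase hn hx' hq]
      refine Finset.sum_congr rfl fun j _ => ?_
      simp only [hc', h6, eval_comp]
      simp
    rw [h8, h9] at h7
    have h10 : dd ⟨_, hnd⟩ (fun t => f t * (q.eval t) ^ 2) =
        ∑ i, ∑ j, c i * c' ε j * divDiff f ![x i, x j + ε, y + 2 * ε] := by
      rw [← h7]
      exact dd_congr fun t _ => by rw [eval_mul, sq]
    rw [h10, ← Real.dist_eq]
    exact hlt

theorem DivDiffSqNonneg.posSemidef {n : ℕ} (hn : 1 ≤ n) {U : Set ℝ} (hU : IsOpen U)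
    (hUc : OrdConnected U) {f : ℝ → ℝ} (h : DivDiffSqNonneg n U f) (hf : ContDiffOn ℝ 2 f U)
    {x : Fin n → ℝ} (hx : Function.Injective x) (hxU : ∀ i, x i ∈ U) {y : ℝ} (hy : y ∈ U) :
    (Matrix.of fun i j : Fin n => divDiff f ![x i, x j, y]).PosSemidef := by
  rw [posSemidef_divDiff_iff]
  intro c
  set q := ∑ i, C (c i) * nodalErase x i with hq
  have hqc : ∀ i, q.eval (x i) / (nodalErase x i).eval (x i) = c i := by
    intro i
    have h0 : (nodalErase x i).eval (x i) ≠ 0 := by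
      rw [eval_nodalErase, Finset.prod_ne_zero_iff]
      exact fun k hk => sub_ne_zero.2 fun he => (Finset.ne_of_mem_erase hk) (hx he).symm
    rw [hq, eval_finsetSum, Finset.sum_eq_single i]
    · simp [h0]
    · intro j _ hji
      rw [eval_mul, eval_nodalErase x j, Finset.prod_eq_zero (i := i)]
      · simp
      · simp [hji.symm]
      · simp
    · simp
  refine le_of_forall_pos_le_add fun δ hδ => ?_
  obtain ⟨Z, hZU, hZ, hlt⟩ := exists_dd_near_sum_divDiff hU hUc hf hU Subset.rfl hn hx hxU hy
    (natDegree_sum_nodalErase_le x c) hδ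
  have h1 := h Z hZU hZ q (natDegree_sum_nodalErase_le x c)
  simp only [← hq, hqc] at hlt
  have h2 := (abs_lt.1 hlt).2
  linarith

/-- A smooth function whose Kraus matrices are positive satisfies the divided difference
inequalities. -/
theorem divDiffSqNonneg_of_posSemidef {n : ℕ} (hn : 1 ≤ n) {U : Set ℝ} (hU : IsOpen U)
    (hUc : OrdConnected U) {f : ℝ → ℝ} (hf : ContDiffOn ℝ (2 * n : ℕ) f U)
    (h : ∀ x : Fin n → ℝ, StrictMono x → (∀ i, x i ∈ U) → ∀ l : Fin n,
      (Matrix.of fun i j : Fin n => divDiff f ![x i, x j, x l]).PosSemidef) :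
    DivDiffSqNonneg n U f := by
  intro s hs hcard q hq
  have hf2 : ContDiffOn ℝ 2 f U := hf.of_le (by exact_mod_cast (by omega : 2 ≤ 2 * n))
  set g : ℝ → ℝ := fun t => f t * (q ^ 2).eval t with hgdef
  have hg : ContDiffOn ℝ (2 * n : ℕ) g U := hf.mul (contDiff_polynomial (q ^ 2)).contDiffOn
  have hpos : ∀ t ∈ U, 0 ≤ iteratedDeriv (2 * n) g t := by
    intro t ht
    by_contra! hneg
    have hcont : ContinuousOn (iteratedDeriv (2 * n) g) U :=
      (ContDiffOn.iteratedDeriv_of_isOpen (j := 0) hU (by simpa using hg)).continuousOn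
    -- Near `t` the mean value theorem puts every difference of `g` below `-δ`, whereas the
    -- differences approximating a nonnegative Kraus form within `δ` exceed `-δ`.
    set δ := -iteratedDeriv (2 * n) g t / 2 / (2 * n).factorial with hδ
    have hδ0 : 0 < δ := by rw [hδ]; apply div_pos <;> [linarith; positivity]
    have hev : ∀ᶠ s in 𝓝 t, s ∈ U ∧ iteratedDeriv (2 * n) g s < iteratedDeriv (2 * n) g t / 2 :=
      (hU.eventually_mem ht).and
        ((hcont.continuousAt (hU.mem_nhds ht)).eventually_lt_const (by linarith))
    obtain ⟨l, u, htlu, hlu⟩ := mem_nhds_iff_exists_Ioo_subset.1 hev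
    obtain ⟨T, hTsub, hTc⟩ := (Ioo_infinite (htlu.1.trans htlu.2)).exists_subset_card_eq n
    set x := T.orderEmbOfFin hTc
    have hxV : ∀ i, x i ∈ Ioo l u := fun i => hTsub (T.orderEmbOfFin_mem hTc i)
    obtain ⟨Z, hZV, hZ, hlt⟩ := exists_dd_near_sum_divDiff hU hUc hf2 isOpen_Ioo
      (fun s hs => (hlu hs).1) hn x.injective hxV (hxV ⟨0, hn⟩) hq hδ0
    have h1 := (posSemidef_divDiff_iff f _ _).1
      (h x x.strictMono (fun i => (hlu (hxV i)).1) ⟨0, hn⟩)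
      fun i => q.eval (x i) / (nodalErase x i).eval (x i)
    obtain ⟨ξ, hξ, heq⟩ := exists_dd_eq_iteratedDeriv ordConnected_Ioo isOpen_Ioo
      (hg.mono fun s hs => (hlu hs).1) hZV hZ
    have h2 : dd Z (fun t => f t * (q.eval t) ^ 2) = dd Z g :=
      dd_congr fun t _ => by simp only [hgdef, eval_pow]
    have h3 : iteratedDeriv (2 * n) g ξ / (2 * n).factorial < -δ := by
      rw [hδ, neg_div, neg_div, neg_neg]
      gcongr
      exact (hlu hξ).2
    rw [h2, heq] at hlt
    have h4 := (abs_lt.1 hlt).1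
    linarith
  obtain ⟨ξ, hξ, heq⟩ := exists_dd_eq_iteratedDeriv hUc hU hg hs hcard
  have h2 : dd s (fun t => f t * (q.eval t) ^ 2) = dd s g :=
    dd_congr fun t _ => by simp only [hgdef, eval_pow]
  rw [h2, heq]
  exact div_nonneg (hpos ξ hξ) (by positivity)

/-! ### Quadratic forms and the functional calculus. -/

open scoped Matrix in
/-- The real part of the quadratic form of a matrix at the vector `w`, as a function of the
matrix. -/
noncomputable def quadForm {n : ℕ} (w : Fin n → ℂ) : Matrix (Fin n) (Fin n) ℂ →ₗ[ℝ] ℝ where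
  toFun M := (star w ⬝ᵥ M *ᵥ w).re
  map_add' M N := by simp [Matrix.add_mulVec, dotProduct_add]
  map_smul' c M := by simp [Matrix.smul_mulVec, dotProduct_smul]

open scoped Matrix in
theorem quadForm_apply {n : ℕ} (w : Fin n → ℂ) (M : Matrix (Fin n) (Fin n) ℂ) :
    quadForm w M = (star w ⬝ᵥ M *ᵥ w).re := rfl

theorem continuous_quadForm {n : ℕ} (w : Fin n → ℂ) : Continuous (quadForm w) :=
  LinearMap.continuous_of_finiteDimensional _

open scoped Matrix in
/-- The weights of the spectral measure of a Hermitian matrix at the vector `w`. -/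
noncomputable def spectralWeight {n : ℕ} {A : Matrix (Fin n) (Fin n) ℂ} (hA : A.IsHermitian)
    (w : Fin n → ℂ) (k : Fin n) : ℝ :=
  ‖((star (hA.eigenvectorUnitary : Matrix (Fin n) (Fin n) ℂ)) *ᵥ w) k‖ ^ 2

theorem spectralWeight_nonneg {n : ℕ} {A : Matrix (Fin n) (Fin n) ℂ} (hA : A.IsHermitian)
    (w : Fin n → ℂ) (k : Fin n) : 0 ≤ spectralWeight hA w k := by
  unfold spectralWeight; positivity

open scoped Matrix in
theorem quadForm_conj {n : ℕ} (V M : Matrix (Fin n) (Fin n) ℂ) (w : Fin n → ℂ) :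
    quadForm w (V * M * star V) = quadForm (star V *ᵥ w) M := by
  rw [quadForm_apply, quadForm_apply, Matrix.star_mulVec, Matrix.star_eq_conjTranspose,
    Matrix.conjTranspose_conjTranspose, ← Matrix.dotProduct_mulVec, Matrix.mulVec_mulVec,
    Matrix.mulVec_mulVec, Matrix.mul_assoc]

theorem quadForm_diagonal {n : ℕ} (d : Fin n → ℝ) (w : Fin n → ℂ) :
    quadForm w (Matrix.diagonal fun i => (d i : ℂ)) = ∑ i, d i * ‖w i‖ ^ 2 := by
  rw [quadForm_apply, dotProduct, Complex.re_sum]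
  refine Finset.sum_congr rfl fun i _ => ?_
  have h := Complex.mul_conj (w i)
  rw [Complex.normSq_eq_norm_sq] at h
  rw [Matrix.mulVec_diagonal, Pi.star_apply, mul_left_comm, Complex.star_def,
    mul_comm _ (w i), h, ← Complex.ofReal_mul, Complex.ofReal_re]

theorem quadForm_cfc {n : ℕ} {A : Matrix (Fin n) (Fin n) ℂ} (hA : A.IsHermitian) (f : ℝ → ℝ)
    (w : Fin n → ℂ) :
    quadForm w (cfc f A) = ∑ k, f (hA.eigenvalues k) * spectralWeight hA w k := by
  rw [hA.cfc_eq, Matrix.IsHermitian.cfc, Unitary.conjStarAlgAut_apply]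
  exact (quadForm_conj _ _ w).trans (quadForm_diagonal _ _)

theorem abs_quadForm_cfc_sub_le {n : ℕ} {A : Matrix (Fin n) (Fin n) ℂ} (hA : A.IsHermitian)
    {f g e : ℝ → ℝ} (h : ∀ t ∈ spectrum ℝ A, |f t - g t| ≤ e t) (w : Fin n → ℂ) :
    |quadForm w (cfc f A) - quadForm w (cfc g A)| ≤ quadForm w (cfc e A) := by
  simp only [quadForm_cfc hA]
  rw [← Finset.sum_sub_distrib]
  refine (Finset.abs_sum_le_sum_abs _ _).trans (Finset.sum_le_sum fun k _ => ?_)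
  rw [← sub_mul, abs_mul, abs_of_nonneg (spectralWeight_nonneg hA w k)]
  exact mul_le_mul_of_nonneg_right (h _ (hA.eigenvalues_mem_spectrum_real k))
    (spectralWeight_nonneg hA w k)

open scoped Matrix.Norms.L2Operator in
theorem eventually_spectrum_subset {n : ℕ} (A : Matrix (Fin n) (Fin n) ℂ) {V : Set ℝ}
    (hV : IsOpen V) (h : spectrum ℝ A ⊆ V) :
    ∀ᶠ A' in 𝓝 A, spectrum ℝ A' ⊆ V :=
  (upperHemicontinuous_iff_forall_isOpen.1 (upperHemicontinuous_spectrum ℝ (Matrix (Fin n) (Fin n) ℂ)) A V hV h)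

/-! ### Second order perturbation of `f(A)`. -/

/-- Second order expansion of a polynomial at a diagonal matrix. -/
theorem exists_aeval_diagonal_add {n : ℕ} (x : Fin n → ℝ) (B : Matrix (Fin n) (Fin n) ℂ)
    (p : ℝ[X]) :
    ∃ R : ℝ → Matrix (Fin n) (Fin n) ℂ, Continuous R ∧ ∀ h : ℝ,
      aeval (Matrix.diagonal (fun i => (x i : ℂ)) + h • B) p =
        Matrix.diagonal (fun i => ((p.eval (x i) : ℝ) : ℂ)) +
        h • (Matrix.of fun i j => B i j * (polyDD {x i, x j} p : ℝ)) +
        h ^ 2 • (Matrix.of fun i j => ∑ l, B i l * B l j * (polyDD {x i, x l, x j} p : ℝ)) +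
        h ^ 3 • R h := by
  -- By linearity only multiplication by `X` matters. Expanding `(D + h B) p(D + h B)` in powers of
  -- `h` reproduces `[a, s]_{X p} = a [a, s]_p + [s]_p`.
  have hX : ∀ p : ℝ[X], (∃ R : ℝ → Matrix (Fin n) (Fin n) ℂ, Continuous R ∧ ∀ h : ℝ,
      aeval (Matrix.diagonal (fun i => (x i : ℂ)) + h • B) p =
        Matrix.diagonal (fun i => ((p.eval (x i) : ℝ) : ℂ)) +
        h • (Matrix.of fun i j => B i j * (polyDD {x i, x j} p : ℝ)) +
        h ^ 2 • (Matrix.of fun i j => ∑ l, B i l * B l j * (polyDD {x i, x l, x j} p : ℝ)) +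
        h ^ 3 • R h) → ∃ R : ℝ → Matrix (Fin n) (Fin n) ℂ, Continuous R ∧ ∀ h : ℝ,
      aeval (Matrix.diagonal (fun i => (x i : ℂ)) + h • B) (X * p) =
        Matrix.diagonal (fun i => (((X * p).eval (x i) : ℝ) : ℂ)) +
        h • (Matrix.of fun i j => B i j * (polyDD {x i, x j} (X * p) : ℝ)) +
        h ^ 2 • (Matrix.of fun i j =>
          ∑ l, B i l * B l j * (polyDD {x i, x l, x j} (X * p) : ℝ)) +
        h ^ 3 • R h := by
    rintro p ⟨R, hR, h⟩
    set D := Matrix.diagonal fun i => (x i : ℂ) with hD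
    set P0 := Matrix.diagonal fun i => ((p.eval (x i) : ℝ) : ℂ) with hP0
    set P1 : Matrix (Fin n) (Fin n) ℂ := Matrix.of fun i j => B i j * (polyDD {x i, x j} p : ℝ)
      with hP1
    set P2 : Matrix (Fin n) (Fin n) ℂ :=
      Matrix.of fun i j => ∑ l, B i l * B l j * (polyDD {x i, x l, x j} p : ℝ) with hP2
    have k1 : ∀ a b, polyDD {a, b} (X * p) = a * polyDD {a, b} p + p.eval b := fun a b => by
      rw [← polyDD_singleton b p]
      exact polyDD_cons_X_mul a (s := {b}) (by simp) p
    have k2 : ∀ a b d, polyDD {a, b, d} (X * p) = a * polyDD {a, b, d} p + polyDD {b, d} p :=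
      fun a b d => polyDD_cons_X_mul a (s := {b, d}) (by simp) p
    have e0 : Matrix.diagonal (fun i => (((X * p).eval (x i) : ℝ) : ℂ)) = D * P0 := by
      rw [hD, hP0, Matrix.diagonal_mul_diagonal]
      simp
    have e1 : (Matrix.of fun i j => B i j * (polyDD {x i, x j} (X * p) : ℝ)) =
        D * P1 + B * P0 := by
      ext i j
      rw [Matrix.add_apply, hD, hP0, Matrix.diagonal_mul, Matrix.mul_diagonal, hP1]
      simp only [Matrix.of_apply, k1]
      push_cast; ring
    have e2 : (Matrix.of fun i j => ∑ l, B i l * B l j * (polyDD {x i, x l, x j} (X * p) : ℝ)) =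
        D * P2 + B * P1 := by
      ext i j
      rw [Matrix.add_apply, hD, Matrix.diagonal_mul, Matrix.mul_apply, hP1, hP2]
      simp only [Matrix.of_apply, k2]
      rw [Finset.mul_sum, ← Finset.sum_add_distrib]
      refine Finset.sum_congr rfl fun l _ => ?_
      push_cast; ring
    refine ⟨fun h => D * R h + B * P2 + h • (B * R h), by fun_prop, fun t => ?_⟩
    rw [map_mul, aeval_X, h, e0, e1, e2]
    simp only [add_mul, mul_add, smul_add, Matrix.smul_mul, Matrix.mul_smul, smul_smul]
    module
  induction p using Polynomial.induction_on' with
  | add p q hp hq =>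
    obtain ⟨R, hR, h⟩ := hp
    obtain ⟨S, hS, k⟩ := hq
    refine ⟨fun t => R t + S t, hR.add hS, fun t => ?_⟩
    rw [map_add, h, k]
    have e0 : Matrix.diagonal (fun i => (((p + q).eval (x i) : ℝ) : ℂ)) =
        Matrix.diagonal (fun i => ((p.eval (x i) : ℝ) : ℂ)) +
        Matrix.diagonal (fun i => ((q.eval (x i) : ℝ) : ℂ)) := by
      rw [Matrix.diagonal_add]; simp
    have e1 : (Matrix.of fun i j => B i j * (polyDD {x i, x j} (p + q) : ℝ)) =
        (Matrix.of fun i j => B i j * (polyDD {x i, x j} p : ℝ)) +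
        (Matrix.of fun i j => B i j * (polyDD {x i, x j} q : ℝ)) := by
      ext i j
      simp [polyDD_add, mul_add]
    have e2 : (Matrix.of fun i j => ∑ l, B i l * B l j * (polyDD {x i, x l, x j} (p + q) : ℝ)) =
        (Matrix.of fun i j => ∑ l, B i l * B l j * (polyDD {x i, x l, x j} p : ℝ)) +
        (Matrix.of fun i j => ∑ l, B i l * B l j * (polyDD {x i, x l, x j} q : ℝ)) := by
      ext i j
      simp [polyDD_add, mul_add, Finset.sum_add_distrib]
    rw [e0, e1, e2]
    module
  | monomial k c =>
    induction k with
    | zero =>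
      refine ⟨fun _ => 0, continuous_const, fun t => ?_⟩
      have h1 : ∀ a b, polyDD {a, b} (C c) = 0 := fun a b => polyDD_C (by simp) c
      have h2 : ∀ a b d, polyDD {a, b, d} (C c) = 0 := fun a b d => polyDD_C (by simp) c
      have h3 : (Matrix.of fun _ _ => 0 : Matrix (Fin n) (Fin n) ℂ) = 0 := rfl
      simp only [monomial_zero_left, h1, h2, aeval_C, eval_C, Complex.ofReal_zero, mul_zero,
        Finset.sum_const_zero, h3, smul_zero, add_zero]
      rfl
    | succ k ih =>
      rw [← X_mul_monomial]
      exact hX _ ih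

/-- Near a finite set of nodes, a `C²` function is close to a polynomial with the same `2`-jets. -/
theorem exists_isOpen_abs_sub_eval_le {U : Set ℝ} (hU : IsOpen U) (hUc : OrdConnected U)
    {f : ℝ → ℝ} (hf : ContDiffOn ℝ 2 f U) {T : Finset ℝ} (hT : (T : Set ℝ) ⊆ U) {p : ℝ[X]}
    (hp : ∀ a ∈ T, ∀ d ≤ 2, (derivative^[d] p).eval a = iteratedDeriv d f a) {η : ℝ}
    (hη : 0 < η) :
    ∃ V : Set ℝ, IsOpen V ∧ (T : Set ℝ) ⊆ V ∧
      ∀ t ∈ V, |f t - p.eval t| ≤ η * ((∏ a ∈ T, (X - C a)).eval t) ^ 2 := by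
  suffices h : ∀ a ∈ T, ∀ᶠ t in 𝓝 a, |f t - p.eval t| ≤ η * ((∏ a ∈ T, (X - C a)).eval t) ^ 2 by
    refine ⟨interior {t | |f t - p.eval t| ≤ η * ((∏ a ∈ T, (X - C a)).eval t) ^ 2},
      isOpen_interior, fun a ha => ?_, fun t ht => ?_⟩
    swap
    · have ht' := interior_subset ht
      exact ht'
    exact mem_interior_iff_mem_nhds.2 (h a ha)
  intro a ha
  have haU := hT ha
  set g : ℝ → ℝ := fun t => f t - p.eval t with hg
  have hgc : ContDiffOn ℝ (2 : ℕ) g U := by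
    exact_mod_cast hf.sub (contDiff_polynomial p).contDiffOn
  have hjet : ∀ d ≤ 2, iteratedDerivWithin d g U a = 0 := fun d hd => by
    have hd' : (d : WithTop ℕ∞) ≤ 2 := by exact_mod_cast hd
    have h1 : ContDiffAt ℝ d f a := (hf.contDiffAt (hU.mem_nhds haU)).of_le hd'
    have h2 : ContDiffAt ℝ d (fun t => p.eval t) a := (contDiff_polynomial p).contDiffAt
    rw [iteratedDerivWithin_of_isOpen hU haU, hg]
    have h3 := iteratedDeriv_fun_sub h1 h2
    rw [h3, iteratedDeriv_polynomial, ← hp a ha d hd]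
    exact sub_self _
  have hT0 := taylor_isLittleO hUc.convex haU hgc
  have hz : ∀ t, taylorWithinEval g 2 U a t = 0 := fun t => by
    rw [taylorWithinEval_succ, taylorWithinEval_succ, taylor_within_zero_eval]
    have h0 := hjet 0 (by norm_num)
    rw [iteratedDerivWithin_zero] at h0
    rw [h0, hjet _ (by norm_num), hjet _ (by norm_num)]
    simp
  simp only [hz, sub_zero, hU.nhdsWithin_eq haU] at hT0
  set Q : ℝ[X] := ∏ b ∈ T.erase a, (X - C b) with hQ
  have hPQ : ∏ b ∈ T, (X - C b) = (X - C a) * Q := (Finset.mul_prod_erase T _ ha).symm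
  have hQa : 0 < (Q.eval a) ^ 2 := by
    have : Q.eval a ≠ 0 := by
      rw [hQ, eval_prod, Finset.prod_ne_zero_iff]
      intro b hb
      simpa [sub_ne_zero] using (Finset.ne_of_mem_erase hb).symm
    positivity
  -- The Taylor error is `o((t - a) ^ 2)`, and the other factors of the product stay away from zero
  -- near `a`.
  have hQc : ∀ᶠ t in 𝓝 a, (Q.eval a) ^ 2 / 2 < (Q.eval t) ^ 2 :=
    ((Q.continuous.pow 2).continuousAt (x := a)).eventually_const_lt (by simpa using hQa)
  filter_upwards [hT0.def (c := η * ((Q.eval a) ^ 2 / 2)) (by positivity), hQc] with t h1 h2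
  rw [Real.norm_eq_abs, Real.norm_eq_abs, abs_of_nonneg (sq_nonneg (t - a))] at h1
  refine h1.trans ?_
  rw [hPQ, eval_mul, mul_pow, mul_assoc]
  refine mul_le_mul_of_nonneg_left ?_ hη.le
  rw [mul_comm]
  simp only [eval_sub, eval_X, eval_C]
  exact mul_le_mul_of_nonneg_left h2.le (sq_nonneg _)

/-- The coefficient of the second order term of `⟨f(diag(x) + h B) w, w⟩`. -/
noncomputable def krausForm {n : ℕ} (f : ℝ → ℝ) (x : Fin n → ℝ) (B : Matrix (Fin n) (Fin n) ℂ)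
    (w : Fin n → ℂ) : ℝ :=
  ∑ l, ∑ i, ∑ j, ((B l i * w i).re * (B l j * w j).re + (B l i * w i).im * (B l j * w j).im) *
    divDiff f ![x i, x j, x l]

theorem quadForm_eq_krausForm {n : ℕ} {f : ℝ → ℝ} {x : Fin n → ℝ} {B : Matrix (Fin n) (Fin n) ℂ}
    (hB : B.IsHermitian) (w : Fin n → ℂ) {p : ℝ[X]}
    (h : ∀ i j l, divDiff f ![x i, x j, x l] = polyDD {x i, x j, x l} p) :
    quadForm w (Matrix.of fun i j => ∑ l, B i l * B l j * (polyDD {x i, x l, x j} p : ℝ)) =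
      krausForm f x B w := by
  rw [quadForm_apply, krausForm, Finset.sum_comm]
  simp only [dotProduct, Matrix.mulVec, Complex.re_sum, Finset.mul_sum, Finset.sum_mul,
    Matrix.of_apply, Pi.star_apply]
  refine Finset.sum_congr rfl fun i _ => ?_
  rw [Finset.sum_comm]
  refine Finset.sum_congr rfl fun l _ => Finset.sum_congr rfl fun j _ => ?_
  have h1 : ({x i, x l, x j} : Multiset ℝ) = {x i, x j, x l} := by
    simp only [Multiset.insert_eq_cons]
    rw [← Multiset.cons_zero (x j), ← Multiset.cons_zero (x l), Multiset.cons_swap (x l)]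
  have h2 : B i l = star (B l i) := (hB.apply i l).symm
  rw [h, h1, h2]
  simp only [Complex.star_def, Complex.mul_re, Complex.mul_im, Complex.conj_re, Complex.conj_im,
    Complex.ofReal_re, Complex.ofReal_im]
  ring

theorem isHermitian_diagonal_add {n : ℕ} (x : Fin n → ℝ) {B : Matrix (Fin n) (Fin n) ℂ}
    (hB : B.IsHermitian) (h : ℝ) :
    (Matrix.diagonal (fun i => (x i : ℂ)) + h • B).IsHermitian := by
  refine Matrix.IsHermitian.add ?_ ?_
  · exact Matrix.isHermitian_diagonal_of_self_adjoint _ (by ext i; simp)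
  · exact (IsSelfAdjoint.smul (by simp [isSelfAdjoint_iff]) hB.isSelfAdjoint)

theorem spectrum_real_diagonal {n : ℕ} (x : Fin n → ℝ) :
    spectrum ℝ (Matrix.diagonal fun i => (x i : ℂ)) ⊆ range x := by
  intro t ht
  rw [← spectrum.algebraMap_mem_iff ℂ, spectrum_diagonal] at ht
  obtain ⟨i, hi⟩ := ht
  exact ⟨i, by simpa using hi⟩

/-- Let `p` share the 2-jets of `f` at the eigenvalues and let `P` vanish there. Near the spectrum
`|f - p| ≤ η' P²`, and `P(D + h B) = h W(h)`, so replacing `f` by `p` costs only `η' h²` times a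
bounded quantity. For `p` the expansion is exact, the odd terms cancel, and the second order term is
`krausForm`. -/
theorem eventually_abs_secondDifference_le {U : Set ℝ} (hU : IsOpen U) (hUc : OrdConnected U)
    {f : ℝ → ℝ} (hf : ContDiffOn ℝ 2 f U) {n : ℕ} {x : Fin n → ℝ} (hx : ∀ i, x i ∈ U)
    {B : Matrix (Fin n) (Fin n) ℂ} (hB : B.IsHermitian) (w : Fin n → ℂ) {η : ℝ} (hη : 0 < η) :
    ∀ᶠ h in 𝓝 (0 : ℝ),
      |quadForm w (cfc f (Matrix.diagonal (fun i => (x i : ℂ)) + h • B)) +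
        quadForm w (cfc f (Matrix.diagonal (fun i => (x i : ℂ)) + (-h) • B)) -
        2 * quadForm w (cfc f (Matrix.diagonal fun i => (x i : ℂ))) -
        2 * h ^ 2 * krausForm f x B w| ≤ η * h ^ 2 := by
  set D := Matrix.diagonal fun i => (x i : ℂ) with hD
  set T : Finset ℝ := Finset.univ.image x with hT
  have hTU : (T : Set ℝ) ⊆ U := by
    intro a ha
    simp only [hT, Finset.coe_image, Finset.coe_univ, image_univ, mem_range] at ha
    obtain ⟨i, rfl⟩ := ha
    exact hx i
  have hxT : ∀ i, x i ∈ T := fun i => Finset.mem_image_of_mem x (Finset.mem_univ i)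
  obtain ⟨p, hp⟩ := exists_polynomial_iterate_derivative_eval T 2 fun d a => iteratedDeriv d f a
  have hdd : ∀ i j l, divDiff f ![x i, x j, x l] = polyDD {x i, x j, x l} p := fun i j l =>
    divDiff_triple_eq_polyDD fun a ha d hd => (hp a (by
      simp only [Finset.mem_insert, Finset.mem_singleton] at ha
      rcases ha with rfl | rfl | rfl <;> exact hxT _) d hd).symm
  set P : ℝ[X] := ∏ a ∈ T, (X - C a) with hP
  have hPx : ∀ i, P.eval (x i) = 0 := fun i => by
    rw [hP, eval_prod]
    exact Finset.prod_eq_zero (hxT i) (by simp)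
  obtain ⟨R, hR, hRe⟩ := exists_aeval_diagonal_add x B p
  obtain ⟨S, hS, hSe⟩ := exists_aeval_diagonal_add x B P
  rw [← hD] at hRe hSe
  simp only [hPx, Complex.ofReal_zero, Matrix.diagonal_zero, zero_add] at hSe
  set W : ℝ → Matrix (Fin n) (Fin n) ℂ := fun h =>
    (Matrix.of fun i j => B i j * (polyDD {x i, x j} P : ℝ)) +
      h • (Matrix.of fun i j => ∑ l, B i l * B l j * (polyDD {x i, x l, x j} P : ℝ)) +
      h ^ 2 • S h with hW
  have hWc : Continuous W := by fun_prop
  have hWe : ∀ h : ℝ, aeval (D + h • B) P = h • W h := fun h => by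
    rw [hSe, hW]; module
  set E : ℝ → ℝ := fun h => quadForm w (W h * W h) with hE
  have hEc : Continuous E := (continuous_quadForm w).comp (hWc.mul hWc)
  -- The errors at `h` and `-h` each get `η / 4`, and the cubic remainder gets `η / 2`.
  set η' := η / (4 * (|E 0| + 1)) with hη'
  have hη'0 : 0 < η' := by positivity
  obtain ⟨V, hV, hTV, hVe⟩ := exists_isOpen_abs_sub_eval_le hU hUc hf hTU hp hη'0
  have hherm : ∀ h : ℝ, (D + h • B).IsHermitian := isHermitian_diagonal_add x hB
  have hspec0 : spectrum ℝ D ⊆ V := (spectrum_real_diagonal x).trans (by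
    rintro _ ⟨i, rfl⟩; exact hTV (hxT i))
  have hDc : Continuous fun h : ℝ => D + h • B := by fun_prop
  have hspec : ∀ᶠ h in 𝓝 (0 : ℝ), spectrum ℝ (D + h • B) ⊆ V := by
    have h1 := hDc.tendsto 0
    simp only [zero_smul, add_zero] at h1
    exact h1.eventually (eventually_spectrum_subset D hV hspec0)
  have hEb : ∀ᶠ h in 𝓝 (0 : ℝ), E h ≤ |E 0| + 1 :=
    (hEc.tendsto 0).eventually (Iic_mem_nhds (by linarith [le_abs_self (E 0)]))
  have hbound : ∀ h : ℝ, spectrum ℝ (D + h • B) ⊆ V → E h ≤ |E 0| + 1 →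
      |quadForm w (cfc f (D + h • B)) - quadForm w (aeval (D + h • B) p)| ≤ η / 4 * h ^ 2 := by
    intro h hs hEh
    have h1 := abs_quadForm_cfc_sub_le (hherm h) (f := f) (g := p.eval)
      (e := (C η' * (P * P)).eval) (fun t ht => by
        refine (hVe t (hs ht)).trans_eq ?_
        simp only [eval_mul, eval_C, ← hP]; ring) w
    rw [cfc_polynomial p _ (hherm h).isSelfAdjoint,
      cfc_polynomial _ _ (hherm h).isSelfAdjoint, aeval_mul, aeval_mul, hWe, aeval_C,
      ← Algebra.smul_def, smul_mul_smul_comm, map_smul, map_smul] at h1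
    refine h1.trans ?_
    simp only [smul_eq_mul]
    calc η' * (h * h * E h) = (η' * E h) * h ^ 2 := by ring
      _ ≤ (η' * (|E 0| + 1)) * h ^ 2 := by gcongr
      _ = η / 4 * h ^ 2 := by rw [hη']; field_simp
  have hR3 : ∀ᶠ h in 𝓝 (0 : ℝ), |h * (quadForm w (R h) - quadForm w (R (-h)))| ≤ η / 2 := by
    have hc : Continuous fun h : ℝ => |h * (quadForm w (R h) - quadForm w (R (-h)))| :=
      (continuous_id.mul (((continuous_quadForm w).comp hR).sub
        ((continuous_quadForm w).comp (hR.comp continuous_neg)))).abs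
    exact (hc.tendsto 0).eventually (Iic_mem_nhds (by simpa using hη))
  have hneg : Tendsto (fun h : ℝ => -h) (𝓝 0) (𝓝 0) := by
    simpa using (continuous_neg (G := ℝ)).tendsto 0
  filter_upwards [hspec, hEb, hneg.eventually hspec, hneg.eventually hEb, hR3] with h a1 a2 a3 a4 a5
  have b1 := hbound h a1 a2
  have b2 := hbound (-h) a3 a4
  -- At `h = 0` the error bound is zero, so `f` and `p` give the same value at the centre.
  have b0 := hbound 0 (by simpa using hspec0) (by linarith [le_abs_self (E 0)])
  simp only [hRe, map_add, map_smul, smul_eq_mul, quadForm_eq_krausForm hB w hdd] at b0 b1 b2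
  simp only [zero_smul, add_zero, ne_eq, OfNat.ofNat_ne_zero, not_false_eq_true, zero_pow,
    zero_mul, mul_zero, abs_nonpos_iff, sub_eq_zero] at b0
  rw [b0]
  have b3 : |h ^ 2 * (h * (quadForm w (R h) - quadForm w (R (-h))))| ≤ η / 2 * h ^ 2 := by
    rw [abs_mul, abs_of_nonneg (sq_nonneg h), mul_comm]
    exact mul_le_mul_of_nonneg_right a5 (sq_nonneg h)
  rw [abs_le] at b1 b2 b3 ⊢
  constructor <;> nlinarith

/-! ### From positive Kraus matrices to matrix convexity. -/

/-- Positivity of the quadratic forms of `([xᵢ, xⱼ, x_l]_f)` extends from strictly increasing tuples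
to arbitrary tuples. -/
theorem sum_divDiff_nonneg_of_forall_strictMono {n : ℕ} {U : Set ℝ} (hU : IsOpen U)
    (hUc : OrdConnected U) {f : ℝ → ℝ} (hf : ContDiffOn ℝ 2 f U)
    (h : ∀ x : Fin n → ℝ, StrictMono x → (∀ i, x i ∈ U) → ∀ l : Fin n,
      (Matrix.of fun i j : Fin n => divDiff f ![x i, x j, x l]).PosSemidef)
    {x : Fin n → ℝ} (hx : ∀ i, x i ∈ U) (l : Fin n) (c : Fin n → ℝ) :
    0 ≤ ∑ i, ∑ j, c i * c j * divDiff f ![x i, x j, x l] := by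
  have hinj : ∀ x : Fin n → ℝ, Function.Injective x → (∀ i, x i ∈ U) →
      0 ≤ ∑ i, ∑ j, c i * c j * divDiff f ![x i, x j, x l] := by
    intro x hxi hxU
    set σ := Tuple.sort x
    have hs : StrictMono (x ∘ σ) :=
      (Tuple.monotone_sort x).strictMono_of_injective (hxi.comp σ.injective)
    have h1 := (posSemidef_divDiff_iff f _ _).1
      (h (x ∘ σ) hs (fun i => hxU _) (σ.symm l)) (c ∘ σ)
    simp only [Function.comp_apply, Equiv.apply_symm_apply] at h1
    rw [← Equiv.sum_comp σ]
    refine h1.trans_eq (Finset.sum_congr rfl fun i _ => ?_)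
    exact Equiv.sum_comp σ fun j => c (σ i) * c j * divDiff f ![x (σ i), x j, x l]
  -- Eigenvalues may be repeated; distinct speeds separate them for all small `ε > 0`.
  set y : ℝ → Fin n → ℝ := fun ε i => x i + (i : ℝ) * ε with hy
  have hev : ∀ᶠ ε in 𝓝[>] (0 : ℝ), Function.Injective (y ε) ∧ ∀ i, y ε i ∈ U := by
    refine Eventually.and ?_ ?_
    · have : ∀ᶠ ε in 𝓝[>] (0 : ℝ), ∀ i j : Fin n, i ≠ j →
          x i ≠ x j + (((j : ℝ) - (i : ℝ)) * ε) := by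
        refine eventually_all.2 fun i => eventually_all.2 fun j => ?_
        by_cases hij : i = j
        · exact Eventually.of_forall fun _ h => (h hij).elim
        · have hne : ((j : ℝ) - (i : ℝ)) ≠ 0 := by
            rw [sub_ne_zero]
            exact fun h => hij (Fin.ext (by exact_mod_cast h.symm))
          exact (eventually_ne_add_mul _ _ hne).mono fun _ h _ => h
      filter_upwards [this] with ε hε i j hij
      by_contra hne
      exact hε i j hne (by simp only [hy] at hij; linarith)
    · refine eventually_all.2 fun i => nhdsWithin_le_nhds ?_
      have : ContinuousAt (fun ε => y ε i) 0 := by simp only [hy]; fun_prop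
      exact this (hU.mem_nhds (by simpa [hy] using hx i))
  have hlim : Tendsto (fun ε => ∑ i, ∑ j, c i * c j * divDiff f ![y ε i, y ε j, y ε l])
      (𝓝[>] 0) (𝓝 (∑ i, ∑ j, c i * c j * divDiff f ![x i, x j, x l])) := by
    refine tendsto_finsetSum _ fun i _ => tendsto_finsetSum _ fun j _ => ?_
    refine tendsto_const_nhds.mul ?_
    have h1 := continuousAt_divDiff_triple hU hUc hf (hx i) (hx j) (hx l)
    have h2 : Tendsto (fun ε : ℝ => (y ε i, y ε j, y ε l)) (𝓝[>] 0) (𝓝 (x i, x j, x l)) := by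
      have : ContinuousAt (fun ε : ℝ => (y ε i, y ε j, y ε l)) 0 := by simp only [hy]; fun_prop
      have h3 := this.tendsto.mono_left (nhdsWithin_le_nhds (s := Ioi (0 : ℝ)))
      simpa [hy] using h3
    exact h1.tendsto.comp h2
  exact ge_of_tendsto hlim (hev.mono fun ε hε => hinj _ hε.1 hε.2)

theorem krausForm_nonneg {n : ℕ} {f : ℝ → ℝ} {x : Fin n → ℝ}
    (h : ∀ (l : Fin n) (c : Fin n → ℝ), 0 ≤ ∑ i, ∑ j, c i * c j * divDiff f ![x i, x j, x l])
    (B : Matrix (Fin n) (Fin n) ℂ) (w : Fin n → ℂ) : 0 ≤ krausForm f x B w := by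
  refine Finset.sum_nonneg fun l _ => ?_
  simp only [add_mul, Finset.sum_add_distrib]
  exact add_nonneg (h l _) (h l _)

open scoped Matrix in
theorem quadForm_cfc_conj {n : ℕ} (V : Matrix.unitaryGroup (Fin n) ℂ)
    {M : Matrix (Fin n) (Fin n) ℂ} (hM : M.IsHermitian) (f : ℝ → ℝ) (w : Fin n → ℂ) :
    quadForm w (cfc f (Unitary.conjStarAlgAut ℂ _ V M)) =
      quadForm ((star (V : Matrix (Fin n) (Fin n) ℂ)) *ᵥ w) (cfc f M) := by
  have hsa : IsSelfAdjoint (Unitary.conjStarAlgAut ℂ _ V M) := by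
    rw [IsSelfAdjoint, ← map_star, hM.isSelfAdjoint.star_eq]
  have hc : Continuous (Unitary.conjStarAlgAut ℂ (Matrix (Fin n) (Fin n) ℂ) V) := by
    simp only [funext_iff.2 fun x => Unitary.conjStarAlgAut_apply (S := ℂ) V x]
    fun_prop
  rw [← StarAlgHomClass.map_cfc (S := ℂ) (Unitary.conjStarAlgAut ℂ _ V) f M
    (Matrix.finite_real_spectrum.continuousOn f) hc hM.isSelfAdjoint hsa,
    Unitary.conjStarAlgAut_apply]
  exact quadForm_conj _ _ w

open scoped Matrix in
-- Diagonalising `A` by a unitary reduces to `eventually_abs_secondDifference_le`, with `B` and `w`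
-- transported.
theorem eventually_secondDifference_nonneg {n : ℕ} {U : Set ℝ} (hU : IsOpen U)
    (hUc : OrdConnected U) {f : ℝ → ℝ} (hf : ContDiffOn ℝ 2 f U)
    (h : ∀ x : Fin n → ℝ, (∀ i, x i ∈ U) → ∀ (l : Fin n) (c : Fin n → ℝ),
      0 ≤ ∑ i, ∑ j, c i * c j * divDiff f ![x i, x j, x l])
    {A B : Matrix (Fin n) (Fin n) ℂ} (hA : A.IsHermitian) (hB : B.IsHermitian)
    (hAU : spectrum ℝ A ⊆ U) (w : Fin n → ℂ) {η : ℝ} (hη : 0 < η) :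
    ∀ᶠ s in 𝓝 (0 : ℝ), -(η * s ^ 2) ≤
      quadForm w (cfc f (A + s • B)) + quadForm w (cfc f (A + (-s) • B)) -
        2 * quadForm w (cfc f A) := by
  set V := hA.eigenvectorUnitary
  set x := hA.eigenvalues
  set φ := Unitary.conjStarAlgAut ℂ (Matrix (Fin n) (Fin n) ℂ) V with hφ
  set B' := φ.symm B with hB'
  have hBH : B'.IsHermitian := by
    change star B' = B'
    rw [hB', ← map_star, hB.isSelfAdjoint.star_eq]
  have hAe : A = φ (Matrix.diagonal fun i => (x i : ℂ)) := hA.spectral_theorem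
  have hx : ∀ i, x i ∈ U := fun i => hAU (hA.eigenvalues_mem_spectrum_real i)
  have hs : ∀ s : ℝ, A + s • B = φ (Matrix.diagonal (fun i => (x i : ℂ)) + s • B') := fun s => by
    have h1 : s • B' = (s : ℂ) • B' := (Complex.coe_smul s B').symm
    rw [map_add, ← hAe, h1, map_smul, hB', StarAlgEquiv.apply_symm_apply, Complex.coe_smul]
  have h0 := hs 0
  simp only [zero_smul, add_zero] at h0
  filter_upwards [eventually_abs_secondDifference_le hU hUc hf hx hBH
    ((star (V : Matrix (Fin n) (Fin n) ℂ)) *ᵥ w) hη] with s hs1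
  rw [hs, hs, h0, hφ, quadForm_cfc_conj _ (isHermitian_diagonal_add x hBH s),
    quadForm_cfc_conj _ (isHermitian_diagonal_add x hBH (-s)), quadForm_cfc_conj]
  · have h2 := krausForm_nonneg (f := f) (h x hx) B' ((star (V : Matrix (Fin n) (Fin n) ℂ)) *ᵥ w)
    have h3 := (abs_le.1 hs1).1
    nlinarith [mul_nonneg (sq_nonneg s) h2]
  · simpa using isHermitian_diagonal_add x hBH 0

/-- A continuous function on `[0, 1]` with asymptotically nonnegative second differences is
convex. -/
theorem le_of_eventually_secondDifference {φ : ℝ → ℝ} (hc : ContinuousOn φ (Icc 0 1))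
    (h : ∀ s ∈ Ioo (0 : ℝ) 1, ∀ η > 0, ∀ᶠ k in 𝓝 (0 : ℝ),
      -(η * k ^ 2) ≤ φ (s + k) + φ (s - k) - 2 * φ s) {t : ℝ} (ht : t ∈ Icc (0 : ℝ) 1) :
    φ t ≤ t * φ 1 + (1 - t) * φ 0 := by
  by_contra! hlt
  set e := φ t - (t * φ 1 + (1 - t) * φ 0) with he
  have he0 : 0 < e := by linarith
  -- `ψ` vanishes at both ends and is positive at `t`, so it has an interior maximum. The quadratic
  -- term contributes `2 e k²` to second differences, beating the allowed loss `e k²`.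
  set ψ : ℝ → ℝ := fun s => φ s - (s * φ 1 + (1 - s) * φ 0) - e * (s * (1 - s)) with hψ
  have hψc : ContinuousOn ψ (Icc 0 1) := by
    refine (hc.sub ?_).sub ?_ <;> exact Continuous.continuousOn (by fun_prop)
  obtain ⟨m, hm, hmax⟩ := isCompact_Icc.exists_isMaxOn ⟨t, ht⟩ hψc
  have hψt : 0 < ψ t := by
    have : t * (1 - t) < 1 := by nlinarith [sq_nonneg (t - 1 / 2)]
    have : e * (t * (1 - t)) < e * 1 := mul_lt_mul_of_pos_left this he0
    simp only [hψ]; linarith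
  have hψm : 0 < ψ m := hψt.trans_le (hmax ht)
  have hm0 : m ≠ 0 := by rintro rfl; simp [hψ] at hψm
  have hm1 : m ≠ 1 := by rintro rfl; simp [hψ] at hψm
  have hmI : m ∈ Ioo (0 : ℝ) 1 := ⟨hm.1.lt_of_ne' hm0, hm.2.lt_of_ne hm1⟩
  have h1 : ∀ᶠ k in 𝓝[>] (0 : ℝ), 0 < k ∧ m + k ∈ Icc (0 : ℝ) 1 ∧ m - k ∈ Icc (0 : ℝ) 1 := by
    refine Eventually.and self_mem_nhdsWithin (Eventually.and ?_ ?_) <;>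
      refine nhdsWithin_le_nhds ?_
    · have : ContinuousAt (fun k : ℝ => m + k) 0 := by fun_prop
      exact this (Icc_mem_nhds (by simpa using hmI.1) (by simpa using hmI.2))
    · have : ContinuousAt (fun k : ℝ => m - k) 0 := by fun_prop
      exact this (Icc_mem_nhds (by simpa using hmI.1) (by simpa using hmI.2))
  obtain ⟨k, ⟨hk, hp, hn⟩, hk2⟩ := (h1.and (nhdsWithin_le_nhds (h m hmI e he0))).exists
  have h2 : ψ (m + k) ≤ ψ m := hmax hp
  have h3 : ψ (m - k) ≤ ψ m := hmax hn
  simp only [hψ] at h2 h3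
  have : 0 < e * k ^ 2 := by positivity
  nlinarith

theorem quadForm_one {n : ℕ} (w : Fin n → ℂ) : quadForm w 1 = ∑ i, ‖w i‖ ^ 2 := by
  have := quadForm_diagonal (fun _ => 1) w
  simpa using this

theorem quadForm_mem {n : ℕ} {U : Set ℝ} (hU : Convex ℝ U) {A : Matrix (Fin n) (Fin n) ℂ}
    (hA : A.IsHermitian) (hAU : spectrum ℝ A ⊆ U) {w : Fin n → ℂ} (hw : quadForm w 1 = 1) :
    quadForm w A ∈ U := by
  have h1 := quadForm_cfc hA (fun _ => 1) w
  rw [cfc_const_one ℝ A hA.isSelfAdjoint, hw] at h1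
  have h2 := quadForm_cfc hA (fun t => t) w
  rw [cfc_id' ℝ A hA.isSelfAdjoint] at h2
  rw [h2]
  simp only [one_mul] at h1
  have := hU.sum_mem (t := Finset.univ) (w := spectralWeight hA w) (z := hA.eigenvalues)
    (fun k _ => spectralWeight_nonneg hA w k) h1.symm
    fun k _ => hAU (hA.eigenvalues_mem_spectrum_real k)
  simpa [mul_comm] using this

theorem exists_quadForm_eq_of_mem_spectrum {n : ℕ} {A : Matrix (Fin n) (Fin n) ℂ}
    (hA : A.IsHermitian) {t : ℝ} (ht : t ∈ spectrum ℝ A) :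
    ∃ w : Fin n → ℂ, quadForm w 1 = 1 ∧ quadForm w A = t := by
  rw [hA.spectrum_real_eq_range_eigenvalues] at ht
  obtain ⟨k, rfl⟩ := ht
  refine ⟨hA.eigenvectorBasis k, ?_, (hA.eigenvalues_eq k).symm⟩
  rw [quadForm_one, ← EuclideanSpace.norm_sq_eq, hA.eigenvectorBasis.orthonormal.1 k, one_pow]

/-- Every eigenvalue is a quadratic form at a unit vector, and at unit vectors the forms of `A` and
`B` take values in the convex set `U`. -/
theorem spectrum_segment_subset {n : ℕ} {U : Set ℝ} (hU : Convex ℝ U)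
    {A B : Matrix (Fin n) (Fin n) ℂ} (hA : A.IsHermitian) (hB : B.IsHermitian)
    (hAU : spectrum ℝ A ⊆ U) (hBU : spectrum ℝ B ⊆ U) {t : ℝ} (ht : t ∈ Icc (0 : ℝ) 1)
    (hM : (t • A + (1 - t) • B).IsHermitian) :
    spectrum ℝ (t • A + (1 - t) • B) ⊆ U := by
  intro s hs
  obtain ⟨w, hw, rfl⟩ := exists_quadForm_eq_of_mem_spectrum hM hs
  rw [map_add, map_smul, map_smul]
  exact hU (quadForm_mem hU hA hAU hw) (quadForm_mem hU hB hBU hw) ht.1 (sub_nonneg.2 ht.2)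
    (by ring)

theorem isHermitian_segment {n : ℕ} {A B : Matrix (Fin n) (Fin n) ℂ} (hA : A.IsHermitian)
    (hB : B.IsHermitian) (s t : ℝ) : (s • A + t • B).IsHermitian :=
  (IsSelfAdjoint.smul (by simp [isSelfAdjoint_iff]) hA.isSelfAdjoint).add
    (IsSelfAdjoint.smul (by simp [isSelfAdjoint_iff]) hB.isSelfAdjoint)

theorem posSemidef_of_forall_quadForm_nonneg {n : ℕ} {M : Matrix (Fin n) (Fin n) ℂ}
    (hM : M.IsHermitian) (h : ∀ w, 0 ≤ quadForm w M) : M.PosSemidef := by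
  refine Matrix.PosSemidef.of_dotProduct_mulVec_nonneg hM fun w => ?_
  rw [RCLike.nonneg_iff]
  exact ⟨h w, hM.im_star_dotProduct_mulVec_self w⟩

/-- All spectra along the segment lie in one compact interval, where `f` is a uniform limit of
polynomials. -/
theorem continuousOn_quadForm_cfc_segment {n : ℕ} (hn : 1 ≤ n) {U : Set ℝ} (hU : IsOpen U)
    (hUc : OrdConnected U) {f : ℝ → ℝ} (hf : ContinuousOn f U)
    {A B : Matrix (Fin n) (Fin n) ℂ} (hA : A.IsHermitian) (hB : B.IsHermitian)
    (hAU : spectrum ℝ A ⊆ U) (hBU : spectrum ℝ B ⊆ U) (w : Fin n → ℂ) :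
    ContinuousOn (fun s : ℝ => quadForm w (cfc f (s • A + (1 - s) • B))) (Icc 0 1) := by
  set S : Finset ℝ := Finset.univ.image hA.eigenvalues ∪ Finset.univ.image hB.eigenvalues with hS
  have hAS : spectrum ℝ A ⊆ S := by
    rw [hA.spectrum_real_eq_range_eigenvalues]; simp [hS]
  have hBS : spectrum ℝ B ⊆ S := by
    rw [hB.spectrum_real_eq_range_eigenvalues]; simp [hS]
  have hSU : (S : Set ℝ) ⊆ U := by
    rw [hA.spectrum_real_eq_range_eigenvalues] at hAU
    rw [hB.spectrum_real_eq_range_eigenvalues] at hBU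
    simp only [hS, Finset.coe_union, Finset.coe_image, Finset.coe_univ, image_univ]
    exact union_subset hAU hBU
  have hSne : S.Nonempty := ⟨hA.eigenvalues ⟨0, hn⟩, by simp [hS]⟩
  obtain ⟨α', α, β, β', hα, hβ, hs, hsub⟩ := exists_Icc_subset_of_isOpen hU hUc hSU
  have hsI : (S : Set ℝ) ⊆ Icc α' β' := fun t ht =>
    ⟨hα.le.trans (hs ht).1.le, (hs ht).2.le.trans hβ.le⟩
  refine continuousOn_of_uniform_approx_of_continuousOn fun u hu => ?_
  obtain ⟨ε, hε, hεu⟩ := Metric.mem_uniformity_dist.1 hu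
  set q := quadForm w 1 with hq
  have hq0 : 0 ≤ q := by rw [hq, quadForm_one]; positivity
  set δ := ε / (q + 1) / 2 with hδ
  have hδ0 : 0 < δ := by positivity
  obtain ⟨p, hp⟩ := exists_polynomial_near_of_continuousOn α' β' f (hf.mono (hsub hSne)) δ hδ0
  refine ⟨fun s => quadForm w (aeval (s • A + (1 - s) • B) p),
    ((continuous_quadForm w).comp (p.continuous_aeval.comp (by fun_prop))).continuousOn,
    fun s hs => hεu ?_⟩
  have hM := isHermitian_segment hA hB s (1 - s)
  have h1 := abs_quadForm_cfc_sub_le hM (f := f) (g := p.eval) (e := fun _ => δ)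
    (fun t ht => by
      rw [abs_sub_comm]
      exact (hp t (spectrum_segment_subset (convex_Icc α' β') hA hB (hAS.trans hsI)
        (hBS.trans hsI) hs hM ht)).le) w
  rw [cfc_polynomial p _ hM.isSelfAdjoint, cfc_const δ _ hM.isSelfAdjoint,
    Algebra.algebraMap_eq_smul_one, map_smul, ← hq, smul_eq_mul] at h1
  rw [Real.dist_eq]
  refine h1.trans_lt ?_
  calc δ * q ≤ δ * (q + 1) := by gcongr; linarith
    _ = ε / 2 := by rw [hδ]; field_simp
    _ < ε := by linarith

/-- A `C²` function whose Kraus matrices are positive is matrix convex. -/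
theorem matrixConvexOn_of_posSemidef {n : ℕ} (hn : 1 ≤ n) {U : Set ℝ} (hU : IsOpen U)
    (hUc : OrdConnected U) {f : ℝ → ℝ} (hf : ContDiffOn ℝ 2 f U)
    (h : ∀ x : Fin n → ℝ, StrictMono x → (∀ i, x i ∈ U) → ∀ l : Fin n,
      (Matrix.of fun i j : Fin n => divDiff f ![x i, x j, x l]).PosSemidef) :
    MatrixConvexOn n U f := by
  intro A B hA hB hAU hBU t ht
  have hsa : ∀ M : Matrix (Fin n) (Fin n) ℂ, (cfc f M).IsHermitian := fun M => cfc_predicate f M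
  refine posSemidef_of_forall_quadForm_nonneg
    (Matrix.IsHermitian.sub (isHermitian_segment (hsa A) (hsa B) t (1 - t)) (hsa _)) fun w => ?_
  set φ : ℝ → ℝ := fun s => quadForm w (cfc f (s • A + (1 - s) • B)) with hφ
  have hle : φ t ≤ t * φ 1 + (1 - t) * φ 0 := by
    refine le_of_eventually_secondDifference
      (continuousOn_quadForm_cfc_segment hn hU hUc hf.continuousOn hA hB hAU hBU w)
      (fun s hs η hη => ?_) ht
    have hM := isHermitian_segment hA hB s (1 - s)
    have h1 := eventually_secondDifference_nonneg hU hUc hf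
      (fun x hx l c => sum_divDiff_nonneg_of_forall_strictMono hU hUc hf h hx l c) hM (hA.sub hB)
      (spectrum_segment_subset hUc.convex hA hB hAU hBU (Ioo_subset_Icc_self hs) hM) w hη
    filter_upwards [h1] with k hk
    have e1 : (s + k) • A + (1 - (s + k)) • B = s • A + (1 - s) • B + k • (A - B) := by module
    have e2 : (s - k) • A + (1 - (s - k)) • B = s • A + (1 - s) • B + (-k) • (A - B) := by module
    simp only [e1, e2]
    exact hk
  simp only [hφ, one_smul, sub_self, zero_smul, add_zero, sub_zero, zero_add] at hle
  rw [map_sub, map_add, map_smul, map_smul, smul_eq_mul, smul_eq_mul]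
  linarith

/-! ### From `C²` matrix convexity to positive Kraus matrices. -/

theorem matrixConvexOn_iff_quadForm {n : ℕ} {I : Set ℝ} {f : ℝ → ℝ} :
    MatrixConvexOn n I f ↔ ∀ A B : Matrix (Fin n) (Fin n) ℂ, A.IsHermitian → B.IsHermitian →
      spectrum ℝ A ⊆ I → spectrum ℝ B ⊆ I → ∀ t : ℝ, t ∈ Icc (0 : ℝ) 1 → ∀ w,
        quadForm w (cfc f (t • A + (1 - t) • B)) ≤
          t * quadForm w (cfc f A) + (1 - t) * quadForm w (cfc f B) := by
  have hsa : ∀ M : Matrix (Fin n) (Fin n) ℂ, (cfc f M).IsHermitian := fun M => cfc_predicate f M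
  refine forall₂_congr fun A B => forall₂_congr fun hA hB => forall₂_congr fun hAI hBI =>
    forall₂_congr fun t ht => ⟨fun h w => ?_, fun h => ?_⟩
  · have h1 : 0 ≤ quadForm w _ := h.re_dotProduct_nonneg w
    rw [map_sub, map_add, map_smul, map_smul, smul_eq_mul, smul_eq_mul] at h1
    linarith
  · refine posSemidef_of_forall_quadForm_nonneg
      (Matrix.IsHermitian.sub (isHermitian_segment (hsa A) (hsa B) t (1 - t)) (hsa _)) fun w => ?_
    rw [map_sub, map_add, map_smul, map_smul, smul_eq_mul, smul_eq_mul]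
    linarith [h w]

theorem isHermitian_algebraMap (n : ℕ) (x : ℝ) :
    (algebraMap ℝ (Matrix (Fin n) (Fin n) ℂ) x).IsHermitian := by
  rw [Algebra.algebraMap_eq_smul_one]
  exact IsSelfAdjoint.smul (by simp [isSelfAdjoint_iff]) (IsSelfAdjoint.one _)

theorem MatrixConvexOn.convexOn {n : ℕ} (hn : 1 ≤ n) {U : Set ℝ} (hU : Convex ℝ U) {f : ℝ → ℝ}
    (h : MatrixConvexOn n U f) : ConvexOn ℝ U f := by
  rw [matrixConvexOn_iff_quadForm] at h
  have : Nonempty (Fin n) := ⟨⟨0, hn⟩⟩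
  set w : Fin n → ℂ := Pi.single ⟨0, hn⟩ 1 with hw
  have hw1 : quadForm w 1 = 1 := by
    rw [quadForm_one, Finset.sum_eq_single ⟨0, hn⟩]
    · simp [hw]
    · intro b _ hb
      simp [hw, hb]
    · simp
  have hq : ∀ c : ℝ, quadForm w (algebraMap ℝ _ c) = c := fun c => by
    rw [Algebra.algebraMap_eq_smul_one, map_smul, hw1, smul_eq_mul, mul_one]
  refine ⟨hU, fun x hx y hy a b ha hb hab => ?_⟩
  obtain rfl : b = 1 - a := by linarith
  have hs : ∀ z ∈ U, spectrum ℝ (algebraMap ℝ (Matrix (Fin n) (Fin n) ℂ) z) ⊆ U := fun z hz => by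
    rw [spectrum.scalar_eq]; simpa using hz
  have h1 := h _ _ (isHermitian_algebraMap n x) (isHermitian_algebraMap n y) (hs x hx) (hs y hy) a
    ⟨ha, by linarith⟩ w
  have h2 : a • algebraMap ℝ (Matrix (Fin n) (Fin n) ℂ) x + (1 - a) • algebraMap ℝ _ y =
      algebraMap ℝ _ (a * x + (1 - a) * y) := by
    simp only [Algebra.algebraMap_eq_smul_one]; module
  rw [h2, cfc_algebraMap, cfc_algebraMap, cfc_algebraMap, hq, hq, hq] at h1
  simpa using h1

/-- Midpoint convexity at `D + s B` and `D - s B` makes the second difference nonnegative; divide by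
`s²`. -/
theorem MatrixConvexOn.krausForm_nonneg {n : ℕ} {U : Set ℝ} (hU : IsOpen U) (hUc : OrdConnected U)
    {f : ℝ → ℝ} (hf : ContDiffOn ℝ 2 f U) (h : MatrixConvexOn n U f) {x : Fin n → ℝ}
    (hx : ∀ i, x i ∈ U) {B : Matrix (Fin n) (Fin n) ℂ} (hB : B.IsHermitian) (w : Fin n → ℂ) :
    0 ≤ krausForm f x B w := by
  rw [matrixConvexOn_iff_quadForm] at h
  refine le_of_forall_pos_le_add fun η hη => ?_
  have hspec0 : spectrum ℝ (Matrix.diagonal fun i => (x i : ℂ)) ⊆ U :=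
    (spectrum_real_diagonal x).trans (range_subset_iff.2 hx)
  have hspec : ∀ᶠ h in 𝓝 (0 : ℝ),
      spectrum ℝ (Matrix.diagonal (fun i => (x i : ℂ)) + h • B) ⊆ U := by
    have hc : Continuous fun h : ℝ => Matrix.diagonal (fun i => (x i : ℂ)) + h • B := by fun_prop
    have h1 := hc.tendsto 0
    simp only [zero_smul, add_zero] at h1
    exact h1.eventually (eventually_spectrum_subset _ hU hspec0)
  have hneg : Tendsto (fun h : ℝ => -h) (𝓝 0) (𝓝 0) := by
    simpa using (continuous_neg (G := ℝ)).tendsto 0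
  have hev := (eventually_abs_secondDifference_le hU hUc hf hx hB w hη).and
    (hspec.and (hneg.eventually hspec))
  have hev' := hev.filter_mono (nhdsWithin_le_nhds (s := Ioi (0 : ℝ)))
  obtain ⟨s, ⟨h1, h2, h3⟩, hs : 0 < s⟩ := (hev'.and eventually_mem_nhdsWithin).exists
  have h4 := h _ _ (isHermitian_diagonal_add x hB s) (isHermitian_diagonal_add x hB (-s)) h2 h3
    (1 / 2) (by norm_num) w
  have h5 : (1 / 2 : ℝ) • (Matrix.diagonal (fun i => (x i : ℂ)) + s • B) +
      (1 - 1 / 2 : ℝ) • (Matrix.diagonal (fun i => (x i : ℂ)) + (-s) • B) =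
      Matrix.diagonal fun i => (x i : ℂ) := by module
  rw [h5] at h4
  have h6 := (abs_le.1 h1).1
  have h7 := (abs_le.1 h1).2
  have h8 : 0 ≤ (2 * krausForm f x B w + η) * s ^ 2 := by linarith
  have h9 := nonneg_of_mul_nonneg_left h8 (by positivity)
  linarith

/-- The Kraus matrices of a `C²` matrix convex function are positive. -/
theorem MatrixConvexOn.posSemidef {n : ℕ} {U : Set ℝ} (hU : IsOpen U) (hUc : OrdConnected U)
    {f : ℝ → ℝ} (hf : ContDiffOn ℝ 2 f U) (h : MatrixConvexOn n U f) {x : Fin n → ℝ}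
    (hx : ∀ i, x i ∈ U) (l : Fin n) :
    (Matrix.of fun i j : Fin n => divDiff f ![x i, x j, x l]).PosSemidef := by
  rw [posSemidef_divDiff_iff]
  intro c
  set K := ∑ k, if k = l then 0 else c k ^ 2 * divDiff f ![x l, x l, x k] with hK
  set Q := ∑ i, ∑ j, c i * c j * divDiff f ![x i, x j, x l] with hQ
  have key : ∀ ε : ℝ, ε ≠ 0 → 0 ≤ Q + ε ^ 2 * K := by
    intro ε hε
    -- `B` is supported on row and column `l`, and `w` is `ε` at `l` and `1` elsewhere. The row `l`
    -- produces exactly the vector `c`; in every other row only the entry at `l` survives, with size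
    -- `ε`, so those rows contribute `ε ^ 2 * K`.
    set B : Matrix (Fin n) (Fin n) ℂ := Matrix.of fun i j =>
      if i = l then (if j = l then ((c l / ε : ℝ) : ℂ) else ((c j : ℝ) : ℂ))
      else if j = l then ((c i : ℝ) : ℂ) else 0 with hBdef
    have hB : B.IsHermitian := by
      refine Matrix.IsHermitian.ext fun i j => ?_
      simp only [hBdef, Matrix.of_apply]
      split_ifs <;> simp_all
    set w : Fin n → ℂ := fun j => if j = l then (ε : ℂ) else 1 with hw
    have e1 : ∀ i, B l i * w i = (c i : ℂ) := by
      intro i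
      simp only [hBdef, Matrix.of_apply, hw]
      by_cases hi : i = l
      · subst hi
        simp only [if_true]
        rw [← Complex.ofReal_mul, div_mul_cancel₀ _ hε]
      · simp [hi]
    have e2 : ∀ k ≠ l, ∀ i, B k i * w i = if i = l then ((c k * ε : ℝ) : ℂ) else 0 := by
      intro k hk i
      simp only [hBdef, Matrix.of_apply, hw, if_neg hk]
      split_ifs <;> simp
    have h1 := h.krausForm_nonneg hU hUc hf hx hB w
    refine h1.trans_eq ?_
    rw [krausForm, ← Finset.add_sum_erase _ _ (Finset.mem_univ l)]
    congr 1
    · simp only [e1, Complex.ofReal_re, Complex.ofReal_im, mul_zero, add_zero, hQ]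
    · rw [hK, ← Finset.add_sum_erase _ _ (Finset.mem_univ l), if_pos rfl, zero_add, Finset.mul_sum]
      refine Finset.sum_congr rfl fun k hk => ?_
      have hkl := Finset.ne_of_mem_erase hk
      rw [if_neg hkl, Finset.sum_eq_single l, Finset.sum_eq_single l]
      · simp only [e2 k hkl, if_true, Complex.ofReal_re, Complex.ofReal_im]; ring
      · intro j _ hj
        simp [e2 k hkl, hj]
      · simp
      · intro i _ hi
        simp [e2 k hkl, hi]
      · simp
  have hlim : Tendsto (fun ε : ℝ => Q + ε ^ 2 * K) (𝓝[≠] 0) (𝓝 Q) := by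
    have : Continuous fun ε : ℝ => Q + ε ^ 2 * K := by fun_prop
    have h1 := (this.tendsto 0).mono_left (nhdsWithin_le_nhds (s := {0}ᶜ))
    simpa using h1
  exact ge_of_tendsto hlim (eventually_mem_nhdsWithin.mono key)

/-! ### Mollification of matrix convex functions. -/

theorem MatrixConvexOn.congr {n : ℕ} {I : Set ℝ} (hI : Convex ℝ I) {f g : ℝ → ℝ}
    (h : MatrixConvexOn n I f) (hfg : EqOn f g I) : MatrixConvexOn n I g := by
  intro A B hA hB hAI hBI t ht
  have h1 := spectrum_segment_subset hI hA hB hAI hBI ht (isHermitian_segment hA hB t (1 - t))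
  rw [← cfc_congr (hfg.mono hAI), ← cfc_congr (hfg.mono hBI), ← cfc_congr (hfg.mono h1)]
  exact h A B hA hB hAI hBI t ht

theorem MatrixConvexOn.mono {n : ℕ} {I J : Set ℝ} {f : ℝ → ℝ} (h : MatrixConvexOn n I f)
    (hJI : J ⊆ I) : MatrixConvexOn n J f := fun A B hA hB hAJ hBJ =>
  h A B hA hB (hAJ.trans hJI) (hBJ.trans hJI)

/-- Matrix convexity is invariant under translations. -/
theorem MatrixConvexOn.comp_sub {n : ℕ} {I J : Set ℝ} {f : ℝ → ℝ} (h : MatrixConvexOn n I f)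
    {u : ℝ} (hJ : ∀ t ∈ J, t - u ∈ I) : MatrixConvexOn n J fun t => f (t - u) := by
  have hM : ∀ A : Matrix (Fin n) (Fin n) ℂ, A.IsHermitian →
      cfc (fun t => t - u) A = A - algebraMap ℝ _ u := fun A hA => by
    rw [cfc_sub (fun t => t) (fun _ => u) A (Matrix.finite_real_spectrum.continuousOn _)
      (Matrix.finite_real_spectrum.continuousOn _), cfc_id' ℝ A hA.isSelfAdjoint,
      cfc_const u A hA.isSelfAdjoint]
  have hf : ∀ A : Matrix (Fin n) (Fin n) ℂ, A.IsHermitian →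
      cfc (fun t => f (t - u)) A = cfc f (A - algebraMap ℝ _ u) := fun A hA => by
    rw [← hM A hA]
    exact cfc_comp' f (fun t => t - u) A
      ((Matrix.finite_real_spectrum.image _).continuousOn _)
      (Matrix.finite_real_spectrum.continuousOn _) hA.isSelfAdjoint
  have hs : ∀ A : Matrix (Fin n) (Fin n) ℂ, A.IsHermitian → spectrum ℝ A ⊆ J →
      spectrum ℝ (A - algebraMap ℝ _ u) ⊆ I := fun A hA hAJ => by
    rw [← hM A hA, cfc_map_spectrum (fun t => t - u) A hA.isSelfAdjoint
      (Matrix.finite_real_spectrum.continuousOn _)]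
    rintro _ ⟨t, ht, rfl⟩
    exact hJ t (hAJ ht)
  intro A B hA hB hAJ hBJ t ht
  have h1 := h _ _ (hA.sub (isHermitian_algebraMap n u)) (hB.sub (isHermitian_algebraMap n u))
    (hs A hA hAJ) (hs B hB hBJ) t ht
  have h2 : t • (A - algebraMap ℝ _ u) + (1 - t) • (B - algebraMap ℝ _ u) =
      t • A + (1 - t) • B - algebraMap ℝ _ u := by module
  rw [hf A hA, hf B hB, hf _ (isHermitian_segment hA hB t (1 - t)), ← h2]
  exact h1

/-- Averages of translates of a function that are matrix convex are matrix convex. -/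
theorem matrixConvexOn_integral {n : ℕ} {I : Set ℝ} {F ρ : ℝ → ℝ} (hρ : ∀ u, 0 ≤ ρ u)
    (hint : ∀ t, Integrable fun u => ρ u * F (t - u))
    (h : ∀ u, ρ u ≠ 0 → MatrixConvexOn n I fun t => F (t - u)) :
    MatrixConvexOn n I fun t => ∫ u, ρ u * F (t - u) := by
  have hq : ∀ (A : Matrix (Fin n) (Fin n) ℂ) (hA : A.IsHermitian) (w : Fin n → ℂ),
      (Integrable fun u => ρ u * quadForm w (cfc (fun t => F (t - u)) A)) ∧
      quadForm w (cfc (fun t => ∫ u, ρ u * F (t - u)) A) =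
        ∫ u, ρ u * quadForm w (cfc (fun t => F (t - u)) A) := by
    intro A hA w
    have e : (fun u => ρ u * quadForm w (cfc (fun t => F (t - u)) A)) = fun u =>
        ∑ k, ρ u * F (hA.eigenvalues k - u) * spectralWeight hA w k := by
      funext u
      rw [quadForm_cfc hA, Finset.mul_sum]
      exact Finset.sum_congr rfl fun k _ => (mul_assoc _ _ _).symm
    have hi : ∀ k ∈ Finset.univ, Integrable fun u =>
        ρ u * F (hA.eigenvalues k - u) * spectralWeight hA w k :=
      fun k _ => (hint _).mul_const _
    rw [e]
    refine ⟨integrable_finsetSum _ hi, ?_⟩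
    rw [integral_finsetSum _ hi, quadForm_cfc hA]
    exact Finset.sum_congr rfl fun k _ => (integral_mul_const _ _).symm
  rw [matrixConvexOn_iff_quadForm]
  intro A B hA hB hAI hBI t ht w
  obtain ⟨iA, eA⟩ := hq A hA w
  obtain ⟨iB, eB⟩ := hq B hB w
  obtain ⟨iM, eM⟩ := hq _ (isHermitian_segment hA hB t (1 - t)) w
  rw [eA, eB, eM, ← integral_const_mul, ← integral_const_mul,
    ← integral_add (iA.const_mul t) (iB.const_mul (1 - t))]
  refine integral_mono iM ((iA.const_mul t).add (iB.const_mul (1 - t))) fun u => ?_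
  by_cases hu : ρ u = 0
  · simp [hu]
  · have h1 := matrixConvexOn_iff_quadForm.1 (h u hu) A B hA hB hAI hBI t ht w
    have h2 := mul_le_mul_of_nonneg_left h1 (hρ u)
    linarith

/-- Matrix convex functions satisfy the divided difference inequalities. -/
theorem MatrixConvexOn.divDiffSqNonneg {n : ℕ} (hn : 1 ≤ n) {U : Set ℝ} (hU : IsOpen U)
    (hUc : OrdConnected U) {f : ℝ → ℝ} (h : MatrixConvexOn n U f) : DivDiffSqNonneg n U f := by
  intro s hs hcard q hq
  have hfc : ContinuousOn f U := (h.convexOn hn hUc.convex).continuousOn hU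
  have hsne : s.Nonempty := Finset.card_pos.1 (by omega)
  obtain ⟨α', α, β, β', hα, hβ, hsI, hIU⟩ := exists_Icc_subset_of_isOpen hU hUc hs
  obtain ⟨γ', γ, δ, δ', hγ, hδ, hsJ, hJI⟩ := exists_Icc_subset_of_isOpen isOpen_Ioo
    ordConnected_Ioo hsI
  obtain ⟨F, hF, hFf, -⟩ := exists_contDiff_eqOn_Icc hU (k := 0) (f := f)
    (by simpa using hfc) hα hβ (hIU hsne)
  have hFc : Continuous F := hF.continuous
  have hαβU : Ioo α β ⊆ U := fun t ht => hIU hsne ⟨hα.le.trans ht.1.le, ht.2.le.trans hβ.le⟩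
  have hFm : MatrixConvexOn n (Ioo α β) F :=
    (h.mono hαβU).congr (convex_Ioo α β) fun t ht => (hFf (Ioo_subset_Icc_self ht)).symm
  -- Translates by less than `r` keep points of `(γ, δ)` inside `(α, β)`, where `F` agrees with `f`.
  set r := min (γ - γ') (δ' - δ) with hr
  have hr0 : 0 < r := lt_min (sub_pos.2 hγ) (sub_pos.2 hδ)
  set φ : ℕ → ContDiffBump (0 : ℝ) := fun k =>
    ⟨r / (k + 2), r / (k + 1), by positivity, by gcongr; norm_num⟩ with hφ
  have hφr : ∀ k, (φ k).rOut = r / (k + 1) := fun k => rfl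
  have hφle : ∀ k, (φ k).rOut ≤ r := fun k => by
    rw [hφr]
    exact div_le_self hr0.le (by linarith [Nat.cast_nonneg (α := ℝ) k])
  have hφ0 : Tendsto (fun k => (φ k).rOut) atTop (𝓝 0) := by
    simp only [hφr]
    simpa [div_eq_mul_inv] using (tendsto_one_div_add_atTop_nhds_zero_nat (𝕜 := ℝ)).const_mul r
  set G : ℕ → ℝ → ℝ := fun k => convolution ((φ k).normed volume) F
    (ContinuousLinearMap.lsmul ℝ ℝ) volume with hG
  have hGe : ∀ k, G k = fun t => ∫ u, (φ k).normed volume u * F (t - u) := fun k => rfl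
  have hGs : ∀ k, ContDiff ℝ (2 * n : ℕ) (G k) := fun k =>
    (φ k).hasCompactSupport_normed.contDiff_convolution_left _
      ((φ k).contDiff_normed (n := ((2 * n : ℕ) : ℕ∞))) hFc.locallyIntegrable
  have hGm : ∀ k, MatrixConvexOn n (Ioo γ δ) (G k) := fun k => by
    rw [hGe]
    refine matrixConvexOn_integral (fun u => (φ k).nonneg_normed u) (fun t => ?_) fun u hu => ?_
    · refine Continuous.integrable_of_hasCompactSupport
        ((φ k).continuous_normed.mul (hFc.comp (by fun_prop))) ?_
      exact (φ k).hasCompactSupport_normed.mul_right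
    · refine hFm.comp_sub fun t ht => ?_
      have hu' : u ∈ Function.support ((φ k).normed volume) := hu
      rw [(φ k).support_normed_eq, mem_ball_zero_iff, Real.norm_eq_abs] at hu'
      have h1 := abs_lt.1 (hu'.trans_le (hφle k))
      have h2 : r ≤ γ - γ' := min_le_left _ _
      have h3 : r ≤ δ' - δ := min_le_right _ _
      exact hJI hsne ⟨by linarith [ht.1], by linarith [ht.2]⟩
  have hGS : ∀ k, 0 ≤ dd s fun t => G k t * q.eval t ^ 2 := fun k =>
    divDiffSqNonneg_of_posSemidef hn isOpen_Ioo ordConnected_Ioo (hGs k).contDiffOn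
      (fun x _ hx l => (hGm k).posSemidef isOpen_Ioo ordConnected_Ioo
        ((hGs k).of_le (by exact_mod_cast (by omega : 2 ≤ 2 * n))).contDiffOn hx l) s hsJ hcard q hq
  have hlim : Tendsto (fun k => dd s fun t => G k t * q.eval t ^ 2) atTop
      (𝓝 (dd s fun t => F t * q.eval t ^ 2)) := by
    refine tendsto_finsetSum _ fun a _ => Tendsto.div_const (Tendsto.mul_const _ ?_) _
    exact ContDiffBump.convolution_tendsto_right_of_continuous hφ0 hFc a
  rw [dd_congr (h := fun t => F t * q.eval t ^ 2) fun a ha => by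
    simp only [hFf (Ioo_subset_Icc_self (hsI ha))]]
  exact ge_of_tendsto' hlim hGS

/-! ### The equivalences. -/

theorem isOpen_openInterval (a b : EReal) : IsOpen (openInterval a b) :=
  isOpen_Ioo.preimage continuous_coe_real_ereal

theorem ordConnected_openInterval (a b : EReal) : OrdConnected (openInterval a b) :=
  (ordConnected_Ioo (a := a) (b := b)).preimage_mono EReal.coe_strictMono.monotone

theorem mainTheorem5 (n : ℕ) (hn : 2 ≤ n) (a b : EReal) (f : ℝ → ℝ) :
    List.TFAE [
      -- `f` is `n`-convex
      MatrixConvexOn n (openInterval a b) f,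
      -- divided differences of `f q²`
      ∀ x : Fin (2 * n + 1) → ℝ, StrictMono x → (∀ i, x i ∈ openInterval a b) →
        ∀ q : ℝ[X], q.natDegree ≤ n - 1 →
          0 ≤ divDiff (fun t => f t * (q.eval t) ^ 2) x,
      -- divided differences of `f N(q)`
      ∀ x : Fin (2 * n + 1) → ℝ, StrictMono x → (∀ i, x i ∈ openInterval a b) →
        ∀ q : ℂ[X], q.natDegree ≤ n - 1 → 0 ≤ divDiff (mulNorm f q) x,
      -- doubled nodes, the extra node being one of them
      ContDiffOn ℝ 2 f (openInterval a b) ∧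
        ∀ x : Fin n → ℝ, StrictMono x → (∀ i, x i ∈ openInterval a b) → ∀ l : Fin n,
          ∀ q : ℂ[X], q.natDegree ≤ n - 1 → 0 ≤ divDiff (mulNorm f q) (doubledNodes x (x l)),
      -- doubled nodes, with an arbitrary extra node
      ContDiffOn ℝ 2 f (openInterval a b) ∧
        ∀ x : Fin n → ℝ, StrictMono x → (∀ i, x i ∈ openInterval a b) →
          ∀ x₀ ∈ openInterval a b, ∀ q : ℂ[X], q.natDegree ≤ n - 1 →
            0 ≤ divDiff (mulNorm f q) (doubledNodes x x₀),
      -- Kraus matrices, the extra node being one of the `x i`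
      ContDiffOn ℝ 2 f (openInterval a b) ∧
        ∀ x : Fin n → ℝ, StrictMono x → (∀ i, x i ∈ openInterval a b) → ∀ l : Fin n,
          (Matrix.of fun i j : Fin n => divDiff f ![x i, x j, x l]).PosSemidef,
      -- Kraus matrices, with an arbitrary extra node
      ContDiffOn ℝ 2 f (openInterval a b) ∧
        ∀ x : Fin n → ℝ, StrictMono x → (∀ i, x i ∈ openInterval a b) →
          ∀ x₀ ∈ openInterval a b,
            (Matrix.of fun i j : Fin n => divDiff f ![x i, x j, x₀]).PosSemidef,
      -- derivatives of order `2 n` of `f N(q)`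
      ContDiffOn ℝ ((2 * n - 2 : ℕ) : WithTop ℕ∞) f (openInterval a b) ∧
        ConvexOn ℝ (openInterval a b) (iteratedDeriv (2 * n - 2) f) ∧
        ∀ q : ℂ[X], q.natDegree ≤ n - 1 →
          ∀ᵐ t ∂(volume : Measure ℝ), t ∈ openInterval a b →
            t ∈ derivDomain (openInterval a b) (mulNorm f q) (2 * n) ∧
              0 ≤ nthDerivOn (openInterval a b) (mulNorm f q) (2 * n) t,
      -- Hankel matrices; the rows and columns are numbered from `0`
      ContDiffOn ℝ ((2 * n - 2 : ℕ) : WithTop ℕ∞) f (openInterval a b) ∧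
        ConvexOn ℝ (openInterval a b) (iteratedDeriv (2 * n - 2) f) ∧
        ∀ᵐ t ∂(volume : Measure ℝ), t ∈ openInterval a b →
          (∀ i j : Fin n,
            t ∈ derivDomain (openInterval a b) f (((i : ℕ) + 1) + ((j : ℕ) + 1))) ∧
          (Matrix.of fun i j : Fin n =>
            nthDerivOn (openInterval a b) f (((i : ℕ) + 1) + ((j : ℕ) + 1)) t /
              ((((i : ℕ) + 1) + ((j : ℕ) + 1)).factorial : ℝ)).PosSemidef] := by
  have hn1 : 1 ≤ n := by omega
  have hU := isOpen_openInterval a b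
  have hUc := ordConnected_openInterval a b
  -- This is where `n ≥ 2` matters: the available smoothness `2 n - 2` must be at least `2`.
  have hC2 : DivDiffSqNonneg n (openInterval a b) f → ContDiffOn ℝ 2 f (openInterval a b) :=
    fun h => (h.contDiffOn_and_convexOn hn1 hU hUc).1.of_le
      (by exact_mod_cast (by omega : 2 ≤ 2 * n - 2))
  tfae_have 1 → 2 := fun h =>
    (forall_divDiff_sq_nonneg_iff n _ f).2 (h.divDiffSqNonneg hn1 hU hUc)
  tfae_have 2 ↔ 3 :=
    (forall_divDiff_sq_nonneg_iff n _ f).trans (forall_divDiff_mulNorm_nonneg_iff n _ f).symm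
  tfae_have 4 ↔ 6 := and_congr_right fun hf => forall_congr' fun x => forall_congr' fun hx =>
    forall_congr' fun hxU => forall_congr' fun l =>
      forall_divDiff_doubledNodes_nonneg_iff hU hf hn1 hx.injective hxU (hxU l)
  tfae_have 5 ↔ 7 := and_congr_right fun hf => forall_congr' fun x => forall_congr' fun hx =>
    forall_congr' fun hxU => forall_congr' fun _ => forall_congr' fun hy =>
      forall_divDiff_doubledNodes_nonneg_iff hU hf hn1 hx.injective hxU hy
  tfae_have 2 → 7 := fun h => by
    have hS := (forall_divDiff_sq_nonneg_iff n _ f).1 h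
    exact ⟨hC2 hS, fun x hx hxU y hy => hS.posSemidef hn1 hU hUc (hC2 hS) hx.injective hxU hy⟩
  tfae_have 7 → 6 := fun h => ⟨h.1, fun x hx hxU l => h.2 x hx hxU (x l) (hxU l)⟩
  tfae_have 6 → 1 := fun h => matrixConvexOn_of_posSemidef hn1 hU hUc h.1 h.2
  tfae_have 2 → 8 := fun h => by
    have hS := (forall_divDiff_sq_nonneg_iff n _ f).1 h
    obtain ⟨h1, h2⟩ := hS.contDiffOn_and_convexOn hn1 hU hUc
    exact ⟨h1, h2, fun q hq => hS.ae_nthDerivOn_mulNorm_nonneg hn1 hU hUc hq⟩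
  tfae_have 8 → 9 := fun h => ⟨h.1, h.2.1, ae_hankel_posSemidef hn1 hU h.1 h.2.1 h.2.2⟩
  tfae_have 9 → 2 := fun h => (forall_divDiff_sq_nonneg_iff n _ f).2
    (divDiffSqNonneg_of_ae_hankel hn1 hU hUc h.1 h.2.1
      (h.2.2.mono fun _ ht htU => (ht htU).2))
  tfae_finish
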